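/- Let $p>1$, let $p^*=p/(p-1)$ be its conjugate number, and let $0<D\le\infty$. Read $[0,D]$ as $[0,\infty)$ if $D=\infty$. Let $u,v$ be weights that are positive a.e. on $(0,D)$, put $\hat v=v^{1-p^*}$, and assume that $u$ and $\hat v$ are locally integrable on $[0,D]$. Write $d\mu=u\,dx$, $\mu(f)=\int_0^D f\,d\mu$, $D_p(f)=\int_0^D|f'|^p v\,dx$ and $\hat\nu(0,D)=\int_0^D\hat v\,dx$. The statement "$v^{p^*-1}f'\in\mathscr C(\alpha,\beta)$" means that $f$ is locally absolutely continuous on $(\alpha,\beta)$ and that $v^{p^*-1}f'$ agrees a.e. with a continuous function there; $f'<0$ and the values of $v f'|f'|^{p-2}$ are then understood through this continuous version. Let $$\lambda_p=\inf\{D_p(f): f\in\mathscr C[0,D],\ v^{p^*-1}f'\in\mathscr C(0,D),\ f\text{ has compact support in }[0,D],\ \mu(|f|^p)=1,\ f(D)=0\text{ if }D<\infty\}.$$ Define, with $1/0=\infty$ and $\operatorname{supp}(f)=\{f\ne0\}$, $$I(f)(x)=-\frac{1}{(v f'|f'|^{p-2})(x)}\int_0^x f^{p-1}d\mu,\qquad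 I\!I(f)(x)=\frac1{f^{p-1}(x)}\Big[\int_{(x,D)\cap\operatorname{supp}(f)}\hat v(s)\Big(\int_0^s f^{p-1}d\mu\Big)^{p^*-1}ds\Big]^{p-1},$$ $$R(h)=-u^{-1}|h|^{p-2}\big(v'h+(p-1)(h^2+h')v\big)\qquad(R(h)(x)=0\text{ where }h(x)=h'(x)=0),$$ and the classes * $\mathscr F_I$: all $f\in\mathscr C[0,D]$ with $v^{p^*-1}f'\in\mathscr C(0,D)$, $f>0$ and $f'<0$ on $(0,D)$; * $\widetilde{\mathscr F}_I$: all $f$ for which there are $0<x_0<x_1<D$ with $f\in\mathscr C[x_0,x_1]$, $v^{p^*-1}f'\in\mathscr C(x_0,x_1)$, $f'<0$ on $(x_0,x_1)$, $f=f(x_0)$ on $[0,x_0]$ and $f=0$ on $[x_1,D]$; here $I(f)=\infty$ on $(0,x_0]\cup[x_1,D)$; * $\mathscr F_{I\!I}$: all $f\in\mathscr C[0,D]$ with $f>0$ on $(0,D)$; * $\widetilde{\mathscr F}_{I\!I}$: all $f\ge0$, $f\not\equiv0$ on $[0,D]$, for which there is $x_0\in(0,D)$ with $f\in\mathscr C[0,x_0]$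 and $f=0$ on $[x_0,D]$; * $\mathscr H$: all $h\in\mathscr C^1(0,D)\cap\mathscr C[0,D)$ with $h(0)=0$, and $h<0$ on $(0,D)$ if $\hat\nu(0,D)<\infty$, $h\le0$ on $(0,D)$ if $\hat\nu(0,D)=\infty$; * $\widetilde{\mathscr H}$: all $h$ for which there is $x_0\in(0,D)$ with $h\in\mathscr C^1(0,x_0)\cap\mathscr C[0,x_0)$, $h(0)=0$, $h<0$ on $(0,x_0)$, $h=0$ on $[x_0,D]$, $\int_0^{x_0}h\,dx=-\infty$ and $\sup_{(0,x_0)}|h|^{p-2}\big(v'h+(p-1)(h^2+h')v\big)<0$. Then: (1) $\displaystyle\inf_{f\in\widetilde{\mathscr F}_I}\sup_{x\in(0,D)}I(f)(x)^{-1}=\lambda_p=\sup_{f\in\mathscr F_I}\inf_{x\in(0,D)}I(f)(x)^{-1}$; (2) $\displaystyle\inf_{f\in\widetilde{\mathscr F}_{I\!I}}\sup_{x\in\operatorname{supp}(f)}I\!I(f)(x)^{-1}=\lambda_p=\sup_{f\in\mathscr F_{I\!I}}\inf_{x\in(0,D)}I\!I(f)(x)^{-1}$; (3) if, moreover, $u$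 is continuous, $v$ is continuously differentiable, and both are positive on $[0,D)$, then $\displaystyle\inf_{h\in\widetilde{\mathscr H}}\sup_{x\in(0,D)}R(h)(x)=\lambda_p=\sup_{h\in\mathscr H}\inf_{x\in(0,D)}R(h)(x)$. In each of (1), (2), (3) the supremum over $f$ (respectively $h$) on the right-hand side is attained. -/

import Mathlib

open MeasureTheory Set
open scoped ENNReal

noncomputable section

namespace PLaplacianND

/-- The open interval `(0, D)`, `D ≤ ∞`. -/
def openDom (D : EReal) : Set ℝ := {x | 0 < x ∧ (x : EReal) < D}

/-- The half-open interval `[0, D)`. -/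
def halfDom (D : EReal) : Set ℝ := {x | 0 ≤ x ∧ (x : EReal) < D}

/-- The interval `[0, D]` if `D < ∞`, and `[0, ∞)` if `D = ∞`. -/
def closedDom (D : EReal) : Set ℝ := {x | 0 ≤ x ∧ (x : EReal) ≤ D}

/-- The conjugate number `p* = p / (p - 1)` of `p`. -/
def conj (p : ℝ) : ℝ := p / (p - 1)

/-- The density `v̂ = v ^ (1 - p*)`. -/
def vhat (v : ℝ → ℝ) (p : ℝ) (x : ℝ) : ℝ := v x ^ (1 - conj p)

/-- The standing assumptions on the weights `u`, `v` on `(0, D)`: both are positive (almost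
everywhere), and `u`, `v̂` are locally integrable on `[0, D]` (on `[0, ∞)` if `D = ∞`). -/
structure IsWeightPair (u v : ℝ → ℝ) (p : ℝ) (D : EReal) : Prop where
  u_pos : ∀ᵐ x : ℝ, x ∈ openDom D → 0 < u x
  v_pos : ∀ᵐ x : ℝ, x ∈ openDom D → 0 < v x
  u_int : LocallyIntegrableOn u (closedDom D)
  vhat_int : LocallyIntegrableOn (vhat v p) (closedDom D)

/-- `v ^ (p* - 1) f' ∈ C(s)` for an open interval `s`, with continuous version `w`.
As `v` is only measurable, `f'` is the a.e. derivative of the locally absolutely continuous `f`;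
`w` is determined by `f` everywhere on `s`. If `v` is continuous and positive, then this says that
`f` is `C¹` on `s` and `w = v ^ (p* - 1) f'`. -/
def HasQuasiDerivOn (v : ℝ → ℝ) (p : ℝ) (f w : ℝ → ℝ) (s : Set ℝ) : Prop :=
  (∀ a ∈ s, ∀ b ∈ s, AbsolutelyContinuousOnInterval f a b) ∧
  ContinuousOn w s ∧
  ∀ᵐ x : ℝ, x ∈ s → v x ^ (conj p - 1) * deriv f x = w x

/-- `μ(|f| ^ p) = ∫_0^D |f| ^ p u dx`. -/
def muNorm (u : ℝ → ℝ) (p : ℝ) (D : EReal) (f : ℝ → ℝ) : ℝ≥0∞ :=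
  ∫⁻ x in openDom D, ENNReal.ofReal (|f x| ^ p * u x)

/-- `D_p(f) = ∫_0^D |f'| ^ p v dx`. -/
def energy (v : ℝ → ℝ) (p : ℝ) (D : EReal) (f : ℝ → ℝ) : ℝ≥0∞ :=
  ∫⁻ x in openDom D, ENNReal.ofReal (|deriv f x| ^ p * v x)

/-- The class `C_K[0, D]`. -/
def CK (v : ℝ → ℝ) (p : ℝ) (D : EReal) : Set (ℝ → ℝ) :=
  {f | ContinuousOn f (closedDom D) ∧
    (∃ w, HasQuasiDerivOn v p f w (openDom D)) ∧
    ∃ K ⊆ closedDom D, IsCompact K ∧ ∀ x ∈ closedDom D, x ∉ K → f x = 0}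

/-- The first eigenvalue:
`λ_p = inf {D_p(f) : f ∈ C_K[0, D], μ(|f|^p) = 1, f(D) = 0 if D < ∞}`. -/
def lambdaP (u v : ℝ → ℝ) (p : ℝ) (D : EReal) : ℝ≥0∞ :=
  sInf {e | ∃ f ∈ CK v p D, muNorm u p D f = 1 ∧ (∀ d : ℝ, D = d → f d = 0) ∧
    e = energy v p D f}

/-- `∫_0^x f ^ (p - 1) dμ`. -/
def primitive (u : ℝ → ℝ) (p : ℝ) (f : ℝ → ℝ) (x : ℝ) : ℝ≥0∞ :=
  ∫⁻ t in Ioo 0 x, ENNReal.ofReal (f t ^ (p - 1) * u t)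

/-- The single integral operator `I(f)(x) = -(v f' |f'| ^ (p - 2))(x)⁻¹ ∫_0^x f ^ (p - 1) dμ`, where
`w = v ^ (p* - 1) f' ≤ 0`, so that `-v f' |f'| ^ (p - 2) = |w| ^ (p - 1)`. It is `∞` where `w = 0`
(and the integral is positive). -/
def opI (u : ℝ → ℝ) (p : ℝ) (f w : ℝ → ℝ) (x : ℝ) : ℝ≥0∞ :=
  primitive u p f x / ENNReal.ofReal (|w x| ^ (p - 1))

/-- The double integral operator `II(f)(x)`. -/
def opII (u v : ℝ → ℝ) (p : ℝ) (D : EReal) (f : ℝ → ℝ) (x : ℝ) : ℝ≥0∞ :=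
  (∫⁻ s in {s : ℝ | x < s ∧ (s : EReal) < D} ∩ Function.support f,
      ENNReal.ofReal (vhat v p s) * primitive u p f s ^ (conj p - 1)) ^ (p - 1) /
    ENNReal.ofReal (f x ^ (p - 1))

/-- The expression `|h| ^ (p - 2) (v' h + (p - 1) (h² + h') v)`. -/
def riccati (v : ℝ → ℝ) (p : ℝ) (h : ℝ → ℝ) (x : ℝ) : ℝ :=
  |h x| ^ (p - 2) * (deriv v x * h x + (p - 1) * (h x ^ 2 + deriv h x) * v x)

/-- The differential operator
`R(h) = u⁻¹ [-|h| ^ (p - 2) (v' h + (p - 1) (h² + h') v)]`. -/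
def opR (u v : ℝ → ℝ) (p : ℝ) (h : ℝ → ℝ) (x : ℝ) : ℝ :=
  (u x)⁻¹ * -riccati v p h x

/-- The class `F_I`; `w` is the continuous version of `v ^ (p* - 1) f'`, and `f' < 0` is expressed
as `w < 0`. -/
def FI (v : ℝ → ℝ) (p : ℝ) (D : EReal) : Set ((ℝ → ℝ) × (ℝ → ℝ)) :=
  {q | ContinuousOn q.1 (closedDom D) ∧ HasQuasiDerivOn v p q.1 q.2 (openDom D) ∧
    (∀ x ∈ openDom D, 0 < q.1 x) ∧ ∀ x ∈ openDom D, q.2 x < 0}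

/-- The class `F̃_I`: `f` is constant on `[0, x₀]`, strictly decreasing on `[x₀, x₁]`, and zero
from `x₁` on; `w` is the continuous version of `v ^ (p* - 1) f'` on `(x₀, x₁)` and zero elsewhere. -/
def FItilde (v : ℝ → ℝ) (p : ℝ) (D : EReal) : Set ((ℝ → ℝ) × (ℝ → ℝ)) :=
  {q | ∃ x₀ x₁ : ℝ, x₀ ∈ openDom D ∧ x₁ ∈ openDom D ∧ x₀ < x₁ ∧
    ContinuousOn q.1 (Icc x₀ x₁) ∧ HasQuasiDerivOn v p q.1 q.2 (Ioo x₀ x₁) ∧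
    (∀ x ∈ Ioo x₀ x₁, q.2 x < 0) ∧ (∀ x ∉ Ioo x₀ x₁, q.2 x = 0) ∧
    (∀ x ∈ Icc 0 x₀, q.1 x = q.1 x₀) ∧ ∀ x ∈ closedDom D, x₁ ≤ x → q.1 x = 0}

/-- The class `F_II`. -/
def FII (D : EReal) : Set (ℝ → ℝ) :=
  {f | ContinuousOn f (closedDom D) ∧ ∀ x ∈ openDom D, 0 < f x}

/-- The class `F̃_II`; its members are non-negative (so that `f ^ (p - 1)` makes sense) and
not identically zero. -/
def FIItilde (D : EReal) : Set (ℝ → ℝ) :=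
  {f | ∃ x₀ ∈ openDom D, ContinuousOn f (Icc 0 x₀) ∧
    (∀ x ∈ closedDom D, x₀ ≤ x → f x = 0) ∧
    (∀ x ∈ closedDom D, 0 ≤ f x) ∧ ∃ x ∈ closedDom D, f x ≠ 0}

/-- `ν̂(0, D)`. -/
def nuHatTotal (v : ℝ → ℝ) (p : ℝ) (D : EReal) : ℝ≥0∞ :=
  ∫⁻ x in openDom D, ENNReal.ofReal (vhat v p x)

/-- The class `H`. For `D < ∞` the function `h` is allowed to tend to `-∞` at the Dirichlet
endpoint `D`, as `g' / g` does for a positive function `g` vanishing there. -/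
def HH (v : ℝ → ℝ) (p : ℝ) (D : EReal) : Set (ℝ → ℝ) :=
  {h | ContDiffOn ℝ 1 h (openDom D) ∧ ContinuousOn h (halfDom D) ∧ h 0 = 0 ∧
    (nuHatTotal v p D < ∞ → ∀ x ∈ openDom D, h x < 0) ∧
    (nuHatTotal v p D = ∞ → ∀ x ∈ openDom D, h x ≤ 0)}

/-- The class `H̃`. The condition `∫_0^{x₀} h = -∞` says that the positive function
`g = exp (∫_0^· h)`, for which `h = g' / g`, vanishes at `x₀`. -/
def HHtilde (v : ℝ → ℝ) (p : ℝ) (D : EReal) : Set (ℝ → ℝ) :=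
  {h | ∃ x₀ ∈ openDom D, ContDiffOn ℝ 1 h (Ioo 0 x₀) ∧ ContinuousOn h (Ico 0 x₀) ∧ h 0 = 0 ∧
    (∀ x ∈ Ioo 0 x₀, h x < 0) ∧
    (∀ x ∈ closedDom D, x₀ ≤ x → h x = 0) ∧
    ∫⁻ x in Ioo 0 x₀, ENNReal.ofReal (-h x) = ∞ ∧
    ∃ δ > 0, ∀ x ∈ Ioo 0 x₀, riccati v p h x ≤ -δ}

end PLaplacianND

end

/-! Write $d\nu=\hat v\,dx$. If $w=v^{p^*-1}f'$ then $f'\,dx=w\,d\nu$ and $D_p(f)=\int|w|^p\,d\nu$.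
So $\lambda_p$ is the best constant $c$ in the Hardy inequality $c\int(\int_x^D
w\,d\nu)^p\,d\mu\le\int w^p\,d\nu$ for $w\ge0$: `le_lambdaP` gives one direction, `lambdaP_mul_le`
the other.

All the bounds compare with the Euler–Lagrange equation $W^{p-1}(s)=c\int_0^s f^{p-1}d\mu$,
$f=\int_\cdot^D W\,d\nu$. If $\ge$ holds for a positive $W$, weighted Hölder and Tonelli yield the
Hardy inequality with constant $c$ (`hardy_of_super`). If $\le$ holds where $W\ne0$, the Rayleigh
quotient of $W$ is at most $c$ (`le_of_sub`). Bounds on the three operators are conditions of this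
kind. For $I$ take $W=|w|$. For $I\!I$ let $W$ be a power of the inner integral. For $R$ put
$g=\exp\int_0^\cdot h$; then the flux $v(-hg)^{p-1}$ has derivative $R(h)\,u\,g^{p-1}$. This gives
inf sup $\ge\lambda_p\ge$ sup inf.

Equality comes from the initial value problem $f(0)=1$, $v|f'|^{p-1}=c\int_0^x f_+^{p-1}d\mu$ with
$f$ decreasing (`exists_isSolution`). The positive part lets $f$ run past a zero. Powers need not be
Lipschitz, so existence is obtained by applying Knaster–Tarski to the square of the antitone
integral operator. The resulting alternating pair is identified by a multiplicative contraction,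
which rests on the degree-one homogeneity of the equation.

A solution positive on $(0,D)$ is a supersolution, so $c\le\lambda_p$. Hence for $c>\lambda_p$ the
solution has a zero inside, and cutting it off there produces competitors for the infima with values
close to $c$. For $c=\lambda_p>0$ there is no interior zero (`pos_of_eq_lambdaP`): otherwise the
solution reaches some $-\kappa<0$, and adding $\kappa$ creates a subsolution with a constant
strictly below $\lambda_p$. So this eigenfunction attains the suprema. If $\lambda_p=0$, any member
of the classes for $I$ and $I\!I$ attains them, and for $R$ a member with $R(h)\ge0$ is written
down. -/

noncomputable section

namespace PLaplacianND

/-! ### Hardy inequalities for two measures from super- and subsolutions. -/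

section

/-- The weighted tail integral `∫_x^∞ W dν`. -/
def tail (ν : Measure ℝ) (W : ℝ → ℝ≥0∞) (x : ℝ) : ℝ≥0∞ := ∫⁻ s in Ioi x, W s ∂ν

/-- The weighted head integral `∫_{-∞}^x f ^ (p - 1) dμ`. -/
def head (μ : Measure ℝ) (p : ℝ) (f : ℝ → ℝ≥0∞) (x : ℝ) : ℝ≥0∞ :=
  ∫⁻ t in Iio x, f t ^ (p - 1) ∂μ

lemma tail_antitone (ν : Measure ℝ) (W : ℝ → ℝ≥0∞) : Antitone (tail ν W) :=
  fun _ _ h => lintegral_mono_set (Ioi_subset_Ioi h)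

lemma measurable_tail (ν : Measure ℝ) (W : ℝ → ℝ≥0∞) : Measurable (tail ν W) :=
  (tail_antitone ν W).measurable

lemma head_monotone (μ : Measure ℝ) (p : ℝ) (f : ℝ → ℝ≥0∞) : Monotone (head μ p f) :=
  fun _ _ h => lintegral_mono_set (Iio_subset_Iio h)

lemma measurable_head (μ : Measure ℝ) (p : ℝ) (f : ℝ → ℝ≥0∞) : Measurable (head μ p f) :=
  (head_monotone μ p f).measurable

lemma head_le_head {μ : Measure ℝ} {p : ℝ} (hp : 1 < p) {f g : ℝ → ℝ≥0∞} {x : ℝ}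
    (h : ∀ t < x, f t ≤ g t) : head μ p f x ≤ head μ p g x :=
  setLIntegral_mono' measurableSet_Iio fun t ht =>
    ENNReal.rpow_le_rpow (h t ht) (by linarith)

lemma head_const_mul {μ : Measure ℝ} {p : ℝ} (hp : 1 < p) {c : ℝ≥0∞} (hc : c ≠ ∞)
    (f : ℝ → ℝ≥0∞) (x : ℝ) :
    head μ p (fun t => c * f t) x = c ^ (p - 1) * head μ p f x := by
  unfold head
  rw [← lintegral_const_mul' _ _ (ENNReal.rpow_ne_top_of_nonneg (by linarith) hc)]
  simp_rw [ENNReal.mul_rpow_of_nonneg _ _ (by linarith : (0 : ℝ) ≤ p - 1)]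

/-- Tonelli's theorem on the triangle `x < s`. -/
lemma lintegral_mul_tail {μ ν : Measure ℝ} [SFinite μ] [SFinite ν] {A B : ℝ → ℝ≥0∞}
    (hA : Measurable A) (hB : Measurable B) :
    ∫⁻ x, A x * tail ν B x ∂μ = ∫⁻ s, B s * ∫⁻ x in Iio s, A x ∂μ ∂ν := by
  have hm : MeasurableSet {z : ℝ × ℝ | z.1 < z.2} := measurableSet_lt measurable_fst measurable_snd
  have hmeas : Measurable (fun z : ℝ × ℝ =>
      {z : ℝ × ℝ | z.1 < z.2}.indicator (fun z => A z.1 * B z.2) z) :=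
    ((hA.comp measurable_fst).mul (hB.comp measurable_snd)).indicator hm
  calc ∫⁻ x, A x * tail ν B x ∂μ
      = ∫⁻ x, ∫⁻ s, {z : ℝ × ℝ | z.1 < z.2}.indicator (fun z => A z.1 * B z.2) (x, s) ∂ν ∂μ := by
        refine lintegral_congr fun x => ?_
        rw [tail, ← lintegral_const_mul _ hB, ← lintegral_indicator measurableSet_Ioi]
        rfl
    _ = ∫⁻ s, ∫⁻ x, {z : ℝ × ℝ | z.1 < z.2}.indicator (fun z => A z.1 * B z.2) (x, s) ∂μ ∂ν :=
        lintegral_lintegral_swap hmeas.aemeasurable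
    _ = _ := by
        refine lintegral_congr fun s => ?_
        rw [← lintegral_const_mul _ hA, ← lintegral_indicator measurableSet_Iio]
        refine lintegral_congr fun x => ?_
        by_cases h : x < s <;> simp [indicator, h, mul_comm]

/-- A weighted Hardy inequality from a supersolution `W`. -/
lemma hardy_of_super {μ ν : Measure ℝ} [SFinite μ] [SFinite ν] {p : ℝ} (hp : 1 < p)
    {c : ℝ≥0∞} {W : ℝ → ℝ≥0∞} (hW : Measurable W) (hW0 : ∀ᵐ s ∂ν, W s ≠ 0 ∧ W s ≠ ∞)
    (h : ∀ᵐ s ∂ν, c * head μ p (tail ν W) s ≤ W s ^ (p - 1))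
    {w : ℝ → ℝ≥0∞} (hw : Measurable w) :
    c * ∫⁻ x, tail ν w x ^ p ∂μ ≤ ∫⁻ s, w s ^ p ∂ν := by
  have hp0 : 0 < p := by linarith
  have hp1 : 0 < p - 1 := by linarith
  set B : ℝ → ℝ≥0∞ := fun s => w s ^ p * (W s ^ (p - 1))⁻¹ with hBdef
  have hB : Measurable B := (hw.pow_const p).mul (hW.pow_const _).inv
  have hA : Measurable fun x => tail ν W x ^ (p - 1) := (measurable_tail ν W).pow_const _
  have holder : ∀ x, tail ν w x ^ p ≤ tail ν W x ^ (p - 1) * tail ν B x := by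
    intro x
    have hpq : p.HolderConjugate (p / (p - 1)) := Real.HolderConjugate.conjExponent hp
    -- Split $w=wW^{-(p-1)/p}\cdot W^{(p-1)/p}$: the $p$-th power of the first factor is `B`, the
    -- conjugate power of the second is `W`.
    have h1 := ENNReal.lintegral_mul_le_Lp_mul_Lq (ν.restrict (Ioi x)) hpq
      (f := fun s => w s * (W s ^ ((p - 1) / p))⁻¹) (g := fun s => W s ^ ((p - 1) / p))
      (hw.mul (hW.pow_const _).inv).aemeasurable (hW.pow_const _).aemeasurable
    have e1 : tail ν w x = ∫⁻ s in Ioi x,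
        ((fun s => w s * (W s ^ ((p - 1) / p))⁻¹) * fun s => W s ^ ((p - 1) / p)) s ∂ν := by
      refine lintegral_congr_ae ((ae_restrict_of_ae hW0).mono fun s hs => ?_)
      simp only [Pi.mul_apply]
      rw [mul_assoc, ENNReal.inv_mul_cancel, mul_one]
      · exact (ENNReal.rpow_pos (pos_iff_ne_zero.2 hs.1) hs.2).ne'
      · exact ENNReal.rpow_ne_top_of_nonneg (by positivity) hs.2
    have e2 : ∫⁻ s in Ioi x, (w s * (W s ^ ((p - 1) / p))⁻¹) ^ p ∂ν = tail ν B x := by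
      refine lintegral_congr fun s => ?_
      rw [ENNReal.mul_rpow_of_nonneg _ _ hp0.le, ENNReal.inv_rpow, ← ENNReal.rpow_mul,
        div_mul_cancel₀ _ hp0.ne']
    have e3 : ∫⁻ s in Ioi x, (W s ^ ((p - 1) / p)) ^ (p / (p - 1)) ∂ν = tail ν W x := by
      refine lintegral_congr fun s => ?_
      rw [← ENNReal.rpow_mul, div_mul_div_cancel₀ hp0.ne', div_self hp1.ne', ENNReal.rpow_one]
    rw [← e1, e2, e3] at h1
    calc tail ν w x ^ p ≤ (tail ν B x ^ (1 / p) * tail ν W x ^ (1 / (p / (p - 1)))) ^ p :=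
          ENNReal.rpow_le_rpow h1 hp0.le
      _ = _ := by
          rw [ENNReal.mul_rpow_of_nonneg _ _ hp0.le, ← ENNReal.rpow_mul, ← ENNReal.rpow_mul,
            one_div_mul_cancel hp0.ne', ENNReal.rpow_one, mul_comm]
          congr 2
          field_simp
  calc c * ∫⁻ x, tail ν w x ^ p ∂μ
      ≤ c * ∫⁻ x, tail ν W x ^ (p - 1) * tail ν B x ∂μ := by gcongr with x; exact holder x
    _ = ∫⁻ s, c * (B s * head μ p (tail ν W) s) ∂ν := by
        -- Tonelli turns the tail of `B` into a head of the tail of `W`, where the supersolution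
        -- inequality applies pointwise and cancels the weight in `B`.
        rw [lintegral_mul_tail hA hB, lintegral_const_mul]
        · rfl
        · exact hB.mul (measurable_head μ p _)
    _ ≤ ∫⁻ s, w s ^ p ∂ν := by
        refine lintegral_mono_ae ?_
        filter_upwards [h, hW0] with s hs hs0
        calc c * (B s * head μ p (tail ν W) s) = B s * (c * head μ p (tail ν W) s) := by ring
          _ ≤ B s * W s ^ (p - 1) := by gcongr
          _ = w s ^ p := by
            rw [hBdef, mul_assoc, ENNReal.inv_mul_cancel, mul_one]
            · exact (ENNReal.rpow_pos (pos_iff_ne_zero.2 hs0.1) hs0.2).ne'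
            · exact ENNReal.rpow_ne_top_of_nonneg hp1.le hs0.2

/-- The Rayleigh quotient of a subsolution `W` bounds Hardy constants from above. -/
lemma le_of_sub {μ ν : Measure ℝ} [SFinite μ] [SFinite ν] {p : ℝ} (hp : 1 < p)
    {c C : ℝ≥0∞} {W : ℝ → ℝ≥0∞} (hW : Measurable W)
    (hc : c * ∫⁻ x, tail ν W x ^ p ∂μ ≤ ∫⁻ s, W s ^ p ∂ν)
    (h : ∀ᵐ s ∂ν, W s ≠ 0 → W s ^ (p - 1) ≤ C * head μ p (tail ν W) s)
    (h0 : ∫⁻ x, tail ν W x ^ p ∂μ ≠ 0) (h1 : ∫⁻ x, tail ν W x ^ p ∂μ ≠ ∞) : c ≤ C := by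
  have hp1 : 0 < p - 1 := by linarith
  have hsplit : ∀ a : ℝ≥0∞, a ^ p = a ^ (p - 1) * a := by
    intro a
    conv_rhs => rw [← ENNReal.rpow_one a, ← ENNReal.rpow_mul, one_mul]
    rw [← ENNReal.rpow_add_of_nonneg _ _ hp1.le zero_le_one, sub_add_cancel]
  have hA : Measurable fun x => tail ν W x ^ (p - 1) := (measurable_tail ν W).pow_const _
  -- Multiply the subsolution inequality by `W` and integrate; Tonelli identifies the right side
  -- with the $p$-th moment of the tail.
  have key : ∫⁻ s, W s ^ p ∂ν ≤ C * ∫⁻ x, tail ν W x ^ p ∂μ := by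
    calc ∫⁻ s, W s ^ p ∂ν ≤ ∫⁻ s, C * (W s * head μ p (tail ν W) s) ∂ν := by
          refine lintegral_mono_ae (h.mono fun s hs => ?_)
          by_cases hz : W s = 0
          · simp [hz, ENNReal.zero_rpow_of_pos (by linarith : 0 < p)]
          · rw [hsplit]
            calc W s ^ (p - 1) * W s ≤ C * head μ p (tail ν W) s * W s := by gcongr; exact hs hz
              _ = _ := by ring
      _ = C * ∫⁻ x, tail ν W x ^ p ∂μ := by
          rw [lintegral_const_mul C (f := fun s => W s * head μ p (tail ν W) s)
            (hW.mul (measurable_head μ p _))]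
          simp_rw [hsplit (tail ν W _)]
          rw [lintegral_mul_tail hA hW]
          rfl
  exact (ENNReal.mul_le_mul_iff_left h0 h1).1 (hc.trans key)

end

/-! ### The initial value problem with values in $[0,\infty]$. -/

section

/-- The flux `(c ∫_{-∞}^x F ^ (p - 1) dμ) ^ (1 / (p - 1))`. -/
def flux (μ : Measure ℝ) (p : ℝ) (c : ℝ≥0∞) (F : ℝ → ℝ≥0∞) (s : ℝ) : ℝ≥0∞ :=
  (c * head μ p F s) ^ (p - 1)⁻¹

/-- The decrease `∫_{-∞}^x (c ∫_{-∞}^s F ^ (p - 1) dμ) ^ (1 / (p - 1)) dν(s)`. -/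
def decrease (μ ν : Measure ℝ) (p : ℝ) (c : ℝ≥0∞) (F : ℝ → ℝ≥0∞) (x : ℝ) : ℝ≥0∞ :=
  ∫⁻ s in Iio x, flux μ p c F s ∂ν

section

variable {μ ν : Measure ℝ} {p : ℝ} {c : ℝ≥0∞}

lemma flux_le_flux (hp : 1 < p) {F G : ℝ → ℝ≥0∞} {x : ℝ} (h : ∀ t < x, F t ≤ G t) :
    flux μ p c F x ≤ flux μ p c G x :=
  ENNReal.rpow_le_rpow (mul_le_mul_right (head_le_head hp h) c)
    (inv_nonneg.2 (by linarith))

lemma flux_monotone (hp : 1 < p) (F : ℝ → ℝ≥0∞) : Monotone (flux μ p c F) := fun _ _ h =>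
  ENNReal.rpow_le_rpow (mul_le_mul_right (head_monotone μ p F h) c)
    (inv_nonneg.2 (by linarith))

/-- The powers $p-1$ and $1/(p-1)$ cancel. This homogeneity replaces a Lipschitz estimate in the
uniqueness argument. -/
lemma flux_const_mul (hp : 1 < p) {k : ℝ≥0∞} (hk : k ≠ ∞) (F : ℝ → ℝ≥0∞) (x : ℝ) :
    flux μ p c (fun t => k * F t) x = k * flux μ p c F x := by
  have hp1 : 0 < p - 1 := by linarith
  unfold flux
  rw [head_const_mul hp hk, mul_left_comm, ENNReal.mul_rpow_of_nonneg _ _ (inv_nonneg.2 hp1.le),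
    ← ENNReal.rpow_mul, mul_inv_cancel₀ hp1.ne', ENNReal.rpow_one]

lemma head_ne_top (hp : 1 < p) (hμ : ∀ x, μ (Iio x) ≠ ∞) {F : ℝ → ℝ≥0∞} (hF : ∀ x, F x ≤ 1)
    (x : ℝ) : head μ p F x ≠ ∞ := by
  refine ne_top_of_le_ne_top (hμ x) ?_
  calc head μ p F x ≤ ∫⁻ _ in Iio x, 1 ∂μ :=
        lintegral_mono fun t => ENNReal.rpow_le_one (hF t) (by linarith)
    _ = μ (Iio x) := by simp

lemma flux_ne_top (hp : 1 < p) (hμ : ∀ x, μ (Iio x) ≠ ∞) (hc : c ≠ ∞) {F : ℝ → ℝ≥0∞}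
    (hF : ∀ x, F x ≤ 1) (x : ℝ) : flux μ p c F x ≠ ∞ :=
  ENNReal.rpow_ne_top_of_nonneg (inv_nonneg.2 (by linarith))
    (ENNReal.mul_ne_top hc (head_ne_top hp hμ hF x))

lemma decrease_le_decrease (hp : 1 < p) {F G : ℝ → ℝ≥0∞} {x : ℝ} (h : ∀ t < x, F t ≤ G t) :
    decrease μ ν p c F x ≤ decrease μ ν p c G x :=
  setLIntegral_mono' measurableSet_Iio fun _ hs =>
    flux_le_flux hp fun t ht => h t (lt_trans ht hs)

lemma decrease_monotone (F : ℝ → ℝ≥0∞) : Monotone (decrease μ ν p c F) :=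
  fun _ _ h => lintegral_mono_set (Iio_subset_Iio h)

lemma decrease_split (F : ℝ → ℝ≥0∞) {a x : ℝ} (h : a ≤ x) :
    decrease μ ν p c F x = decrease μ ν p c F a + ∫⁻ s in Ico a x, flux μ p c F s ∂ν := by
  rw [decrease, decrease, ← lintegral_union measurableSet_Ico, Iio_union_Ico_eq_Iio h]
  exact disjoint_left.2 fun t ht ht' => (not_lt.2 ht'.1) ht

/-- A pair `F = 1 - S G`, `G = 1 - S F` with `G ≤ F`, from the Knaster–Tarski theorem. -/
lemma exists_alternating_pair (hp : 1 < p) : ∃ F G : ℝ → ℝ≥0∞,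
    (∀ x, F x = 1 - decrease μ ν p c G x) ∧ (∀ x, G x = 1 - decrease μ ν p c F x) ∧ G ≤ F := by
  let T : (ℝ → ℝ≥0∞) → ℝ → ℝ≥0∞ := fun F x => 1 - decrease μ ν p c F x
  have hT : Antitone T := fun F G h x =>
    tsub_le_tsub_left (decrease_le_decrease hp fun t _ => h t) 1
  let TT : (ℝ → ℝ≥0∞) →o (ℝ → ℝ≥0∞) := ⟨fun F => T (T F), fun F G h => hT (hT h)⟩
  have hfix : T (T TT.gfp) = TT.gfp := TT.map_gfp
  refine ⟨TT.gfp, T TT.gfp, fun x => (congrFun hfix x).symm, fun x => rfl, ?_⟩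
  -- `T` maps fixed points of its square to fixed points of its square, and the greatest one
  -- dominates its image.
  exact TT.le_gfp (show T TT.gfp ≤ T (T (T TT.gfp)) by rw [hfix])

/-- One contraction step for an alternating pair. -/
lemma contraction_step (hp : 1 < p) {F G : ℝ → ℝ≥0∞} (hF : ∀ x, F x = 1 - decrease μ ν p c G x)
    (hG : ∀ x, G x = 1 - decrease μ ν p c F x) (hGF : G ≤ F) {a z : ℝ}
    {m : ℝ≥0∞}
    (heq : ∀ x ≤ a, F x = G x) (hm : ∀ x < z, m + m ≤ G x)
    (hsmall : ∫⁻ s in Ico a z, flux μ p c F s ∂ν ≤ m) {k : ℝ≥0∞} (hk : k ≠ ∞)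
    (h : ∀ x < z, F x ≤ (1 + (k + k)) * G x) : ∀ x < z, F x ≤ (1 + k) * G x := by
  intro x hx
  rcases le_total x a with hxa | hax
  · rw [heq x hxa]
    exact le_mul_of_one_le_left' le_self_add
  have hk' : 1 + (k + k) ≠ ∞ := by finiteness
  -- By homogeneity, beyond `a` the decrease of `F` exceeds that of `G` by at most $2kJ\le2km$.
  -- Since $G\ge2m$, this error is at most $kG$, so the constant is halved.
  set J := ∫⁻ s in Ico a x, flux μ p c G s ∂ν with hJ
  have hJm : J ≤ m := by
    refine le_trans ?_ hsmall
    refine le_trans (lintegral_mono fun s => flux_le_flux hp fun t _ => hGF t) ?_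
    exact lintegral_mono_set (Ico_subset_Ico_right hx.le)
  have hdec : decrease μ ν p c F x ≤ decrease μ ν p c G x + (k + k) * J := by
    rw [decrease_split F hax, decrease_split G hax, add_assoc]
    refine add_le_add (decrease_le_decrease hp fun t ht => (heq t ht.le).le) ?_
    calc ∫⁻ s in Ico a x, flux μ p c F s ∂ν
        ≤ ∫⁻ s in Ico a x, (1 + (k + k)) * flux μ p c G s ∂ν := by
          refine setLIntegral_mono' measurableSet_Ico fun s hs => ?_
          rw [← flux_const_mul hp hk']
          exact flux_le_flux hp fun t ht => h t (ht.trans (hs.2.trans hx))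
      _ = J + (k + k) * J := by rw [lintegral_const_mul' _ _ hk', ← hJ, add_mul, one_mul]
  have hkJ : (k + k) * J ≤ k * G x := by
    calc (k + k) * J ≤ (k + k) * m := by gcongr
      _ = k * (m + m) := by ring
      _ ≤ k * G x := by gcongr; exact hm x hx
  calc F x = 1 - decrease μ ν p c G x := hF x
    _ ≤ (1 - decrease μ ν p c F x) + (k + k) * J := by
        rw [tsub_le_iff_right]
        calc (1 : ℝ≥0∞) ≤ (1 - decrease μ ν p c F x) + decrease μ ν p c F x := le_tsub_add
          _ ≤ (1 - decrease μ ν p c F x) + (decrease μ ν p c G x + (k + k) * J) := by gcongr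
          _ = _ := by ring
    _ ≤ G x + k * G x := by rw [← hG x]; gcongr
    _ = _ := by ring

/-- The intervals $[a,z)$ shrink to the null set $\{a\}$ as $z\downarrow a$, and a monotone finite
`φ` is bounded near `a`. -/
lemma exists_small_Ico [NullSingletonClass ν] (hν : ∀ x, ν (Iio x) ≠ ∞)
    {φ : ℝ → ℝ≥0∞} (hφ : Monotone φ) (hφ' : ∀ x, φ x ≠ ∞) (a : ℝ) {m : ℝ≥0∞} (hm : m ≠ 0) :
    ∃ z > a, ∫⁻ s in Ico a z, φ s ∂ν ≤ m := by
  have hlim : Filter.Tendsto (fun z => ν (Ico a z)) (nhdsWithin a (Ioi a)) (nhds (ν {a})) := by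
    have h := tendsto_measure_biInter_gt (μ := ν) (s := fun z => Ico a z) (a := a)
      (fun r _ => measurableSet_Ico.nullMeasurableSet)
      (fun i j _ hij => Ico_subset_Ico_right hij)
      ⟨a + 1, by simp, ne_top_of_le_ne_top (hν (a + 1)) (measure_mono Ico_subset_Iio_self)⟩
    suffices hset : ({a} : Set ℝ) = ⋂ z, ⋂ (_ : z > a), Ico a z by rw [hset]; exact h
    ext t
    simp only [mem_singleton_iff, mem_iInter, mem_Ico]
    constructor
    · rintro rfl z hz
      exact ⟨le_rfl, hz⟩
    · intro ht
      refine le_antisymm ?_ (ht (a + 1) (by linarith)).1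
      exact le_of_forall_gt fun z hz => (ht z hz).2
  rw [measure_singleton] at hlim
  have hlim2 := ENNReal.Tendsto.const_mul (a := φ (a + 1)) hlim (Or.inr (hφ' _))
  rw [mul_zero] at hlim2
  have hev := hlim2.eventually (gt_mem_nhds (pos_iff_ne_zero.2 hm))
  have hev2 : ∀ᶠ z in nhdsWithin a (Ioi a), z ∈ Ioc a (a + 1) :=
    Ioc_mem_nhdsGT (by linarith)
  obtain ⟨z, hz, hz2⟩ := (hev.and hev2).exists
  refine ⟨z, hz2.1, le_trans ?_ hz.le⟩
  calc ∫⁻ s in Ico a z, φ s ∂ν ≤ ∫⁻ _ in Ico a z, φ (a + 1) ∂ν :=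
        setLIntegral_mono' measurableSet_Ico fun s hs => hφ (hs.2.le.trans hz2.2)
    _ = _ := by simp

/-- Existence for the initial value problem `F = 1 - S F`. -/
lemma exists_ivp [NullSingletonClass ν] (hp : 1 < p) (hc : c ≠ ∞) (hμ : ∀ x, μ (Iio x) ≠ ∞)
    (hν : ∀ x, ν (Iio x) ≠ ∞) (hν0 : ν (Iio 0) = 0) :
    ∃ F : ℝ → ℝ≥0∞, ∀ x, F x = 1 - decrease μ ν p c F x := by
  obtain ⟨F, G, hF, hG, hGF⟩ := exists_alternating_pair (μ := μ) (ν := ν) (c := c) hp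
  have hF1 : ∀ x, F x ≤ 1 := fun x => by rw [hF]; exact tsub_le_self
  have hFanti : Antitone F := fun x y h => by
    rw [hF, hF]; exact tsub_le_tsub_left (decrease_monotone G h) 1
  suffices hEq : F = G by exact ⟨F, fun x => by conv_lhs => rw [hEq, hG]⟩
  by_contra hne
  -- The two functions agree up to and including $a=\inf B$; agreement slightly beyond `a` is the
  -- contradiction sought.
  set B : Set ℝ := {x | G x ≠ F x}
  have hB : B.Nonempty := by
    by_contra hB
    rw [not_nonempty_iff_eq_empty] at hB
    refine hne (funext fun x => ?_)
    by_contra hx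
    exact (hB ▸ (show x ∈ B from fun h => hx h.symm) : x ∈ (∅ : Set ℝ))
  have hzero : ∀ H : ℝ → ℝ≥0∞, ∀ x ≤ 0, decrease μ ν p c H x = 0 := fun H x hx =>
    setLIntegral_measure_zero _ _ (measure_mono_null (Iio_subset_Iio hx) hν0)
  have hBpos : ∀ x ∈ B, 0 ≤ x := by
    intro x hx
    by_contra hx0
    exact hx (by rw [hF, hG, hzero _ x (not_le.1 hx0).le, hzero _ x (not_le.1 hx0).le])
  have hbdd : BddBelow B := ⟨0, hBpos⟩
  set a := sInf B
  have hlt : ∀ x < a, F x = G x := fun x hx => by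
    by_contra h
    exact (notMem_of_lt_csInf hx hbdd) fun h' => h h'.symm
  have hdeca : decrease μ ν p c F a = decrease μ ν p c G a :=
    le_antisymm (decrease_le_decrease hp fun t ht => (hlt t ht).le)
      (decrease_le_decrease hp fun t ht => (hlt t ht).ge)
  have heq : ∀ x ≤ a, F x = G x := by
    intro x hx
    rcases hx.eq_or_lt with rfl | hx
    · rw [hF, hG, hdeca]
    · exact hlt x hx
  -- If the common value at `a` is zero, monotonicity keeps both functions at zero to the right, so
  -- they cannot separate.
  by_cases hGa : G a = 0
  · obtain ⟨y, hy⟩ := hB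
    have hFy : F y = 0 := le_antisymm
      ((hFanti (csInf_le hbdd hy)).trans (heq a le_rfl ▸ hGa.le)) (zero_le)
    exact hy (le_antisymm (hGF y) (hFy ▸ zero_le))
  have hGa1 : G a ≤ 1 := (hGF a).trans (hF1 a)
  -- A third of $G(a)$ may be lost on $[a,z)$; the remaining $2m$ is the lower bound on `G` required
  -- by `contraction_step`.
  set m : ℝ≥0∞ := G a / 3 with hmdef
  have hm0 : m ≠ 0 := ENNReal.div_ne_zero.2 ⟨hGa, by simp⟩
  have h3m : m + m + m = G a := by rw [hmdef]; exact ENNReal.add_thirds _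
  obtain ⟨z, haz, hz⟩ := exists_small_Ico hν (flux_monotone (μ := μ) (c := c) hp F)
    (flux_ne_top hp hμ hc hF1) a hm0
  have hmne : m ≠ ∞ := ne_top_of_le_ne_top (ne_top_of_le_ne_top ENNReal.one_ne_top hGa1)
    (h3m ▸ le_add_self)
  have hGanti : Antitone G := fun x y h => by
    rw [hG, hG]; exact tsub_le_tsub_left (decrease_monotone F h) 1
  have hm : ∀ x < z, m + m ≤ G x := by
    intro x hx
    rcases le_total x a with hxa | hax
    · exact (le_self_add.trans h3m.le).trans (hGanti hxa)
    · rw [hG, decrease_split F hax, ← tsub_tsub, ← hG]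
      refine ENNReal.le_sub_of_add_le_right ?_ ?_
      · exact ne_top_of_le_ne_top hmne
          ((lintegral_mono_set (Ico_subset_Ico_right hx.le)).trans hz)
      · rw [← h3m]
        gcongr
        exact (lintegral_mono_set (Ico_subset_Ico_right hx.le)).trans hz
  -- The start is crude, $F\le1=m^{-1}m\le m^{-1}G$; each contraction then halves the excess over
  -- one.
  have hiter : ∀ n : ℕ, ∀ x < z, F x ≤ (1 + m⁻¹ / 2 ^ n) * G x := by
    intro n
    induction n with
    | zero =>
      intro x hx
      calc F x ≤ 1 := hF1 x
        _ = m⁻¹ * m := (ENNReal.inv_mul_cancel hm0 hmne).symm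
        _ ≤ (1 + m⁻¹ / 2 ^ 0) * G x := by
          gcongr
          · simp
          · exact le_self_add.trans (hm x hx)
    | succ n ih =>
      refine contraction_step hp hF hG hGF heq hm hz ?_ ?_
      · exact ENNReal.div_ne_top (ENNReal.inv_ne_top.2 hm0) (by simp)
      · have : m⁻¹ / 2 ^ (n + 1) + m⁻¹ / 2 ^ (n + 1) = m⁻¹ / 2 ^ n := by
          rw [← ENNReal.add_halves (m⁻¹ / 2 ^ n)]
          have : m⁻¹ / 2 ^ n / 2 = m⁻¹ / 2 ^ (n + 1) := by
            rw [pow_succ, div_eq_mul_inv, div_eq_mul_inv, div_eq_mul_inv, mul_assoc,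
              ENNReal.mul_inv (Or.inr (by simp)) (Or.inr (by simp))]
          rw [this]
        rw [this]
        exact ih
  have hle : ∀ x < z, F x ≤ G x := by
    intro x hx
    have hlim : Filter.Tendsto (fun n : ℕ => (1 + m⁻¹ / 2 ^ n) * G x) Filter.atTop
        (nhds ((1 + 0) * G x)) := by
      refine ENNReal.Tendsto.mul_const (Filter.Tendsto.const_add _ ?_) (Or.inr ?_)
      · simp_rw [div_eq_mul_inv, ENNReal.inv_pow]
        have := ENNReal.Tendsto.const_mul (a := m⁻¹)
          (ENNReal.tendsto_pow_atTop_nhds_zero_of_lt_one (r := 2⁻¹) (by simp))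
          (Or.inr (ENNReal.inv_ne_top.2 hm0))
        simpa using this
      · exact ne_top_of_le_ne_top ENNReal.one_ne_top ((hGF x).trans (hF1 x))
    rw [add_zero, one_mul] at hlim
    exact ge_of_tendsto' hlim fun n => hiter n x hx
  obtain ⟨y, hy, hyz⟩ := exists_lt_of_csInf_lt hB haz
  exact hy (le_antisymm (hGF y) (hle y hyz))

end

end

/-! ### The measures $u\,dx$ and $\hat v\,dx$ on $(0,D)$, and calculus with quasi-derivatives. -/

section

lemma isOpen_openDom (D : EReal) : IsOpen (openDom D) :=
  (isOpen_lt continuous_const continuous_id).inter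
    (isOpen_lt continuous_coe_real_ereal continuous_const)

lemma isClosed_closedDom (D : EReal) : IsClosed (closedDom D) :=
  (isClosed_le continuous_const continuous_id).inter
    (isClosed_le continuous_coe_real_ereal continuous_const)

lemma openDom_subset_closedDom (D : EReal) : openDom D ⊆ closedDom D :=
  fun _ hx => ⟨hx.1.le, hx.2.le⟩

lemma openDom_subset_halfDom (D : EReal) : openDom D ⊆ halfDom D :=
  fun _ hx => ⟨hx.1.le, hx.2⟩

lemma ordConnected_openDom (D : EReal) : OrdConnected (openDom D) :=
  ⟨fun _ hx _ hy _ hz => ⟨hx.1.trans_le hz.1, (EReal.coe_le_coe_iff.2 hz.2).trans_lt hy.2⟩⟩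

lemma mem_openDom_of_lt {D : EReal} {x y : ℝ} (hx : 0 < x) (hxy : x ≤ y)
    (hy : (y : EReal) ≤ D) (h : x < y ∨ (y : EReal) < D) : x ∈ openDom D := by
  refine ⟨hx, ?_⟩
  rcases h with h | h
  · exact (EReal.coe_lt_coe_iff.2 h).trans_le hy
  · exact (EReal.coe_le_coe_iff.2 hxy).trans_lt h

lemma Ioo_subset_openDom {D : EReal} {x : ℝ} (hx : (x : EReal) ≤ D) : Ioo 0 x ⊆ openDom D :=
  fun _ ht => mem_openDom_of_lt ht.1 ht.2.le hx (Or.inl ht.2)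

lemma Ioo_subset_openDom' {D : EReal} {a b : ℝ} (ha : 0 ≤ a) (hb : (b : EReal) ≤ D) :
    Ioo a b ⊆ openDom D :=
  (Ioo_subset_Ioo_left ha).trans (Ioo_subset_openDom hb)

lemma exists_gt_mem_openDom {D : EReal} {x : ℝ} (hx : 0 ≤ x) (hxD : (x : EReal) < D) :
    ∃ y ∈ openDom D, x < y := by
  obtain ⟨y, hxy, hyD⟩ := EReal.lt_iff_exists_real_btwn.1 hxD
  rw [EReal.coe_lt_coe_iff] at hxy
  exact ⟨y, ⟨hx.trans_lt hxy, hyD⟩, hxy⟩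

lemma openDom_nonempty {D : EReal} (hD : 0 < D) : (openDom D).Nonempty := by
  obtain ⟨y, hy, -⟩ := exists_gt_mem_openDom (x := 0) le_rfl (by simpa using hD)
  exact ⟨y, hy⟩

/-- The density `k` cut off outside `(0, D)`. -/
def dens (D : EReal) (k : ℝ → ℝ) : ℝ → ℝ := (openDom D).indicator fun x => max (k x) 0

/-- The measure `k dx` on `(0, D)`. -/
def wm (D : EReal) (k : ℝ → ℝ) : Measure ℝ :=
  volume.withDensity fun x => ENNReal.ofReal (dens D k x)

instance (D : EReal) (k : ℝ → ℝ) : SFinite (wm D k) := by unfold wm; infer_instance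

instance (D : EReal) (k : ℝ → ℝ) : NullSingletonClass (wm D k) := by unfold wm; infer_instance

section

variable {D : EReal} {k : ℝ → ℝ}

lemma dens_nonneg (D : EReal) (k : ℝ → ℝ) (x : ℝ) : 0 ≤ dens D k x :=
  indicator_nonneg (fun _ _ => le_max_right _ _) x

lemma dens_of_notMem {x : ℝ} (hx : x ∉ openDom D) : dens D k x = 0 := indicator_of_notMem hx _

lemma dens_of_pos {x : ℝ} (hx : x ∈ openDom D) (h : 0 < k x) : dens D k x = k x := by
  rw [dens, indicator_of_mem hx, max_eq_left h.le]

lemma locallyIntegrable_dens (hk : LocallyIntegrableOn k (closedDom D)) :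
    LocallyIntegrable (dens D k) := by
  rw [locallyIntegrable_iff]
  intro K hK
  rw [dens, integrableOn_indicator_iff (isOpen_openDom D).measurableSet]
  have h1 : IntegrableOn k (K ∩ closedDom D) :=
    hk.integrableOn_compact_subset inter_subset_right (hK.inter_right (isClosed_closedDom D))
  have h2 : IntegrableOn (fun x => max (k x) 0) (K ∩ closedDom D) := h1.pos_part
  exact h2.mono_set fun x hx => ⟨hx.2, openDom_subset_closedDom D hx.1⟩

lemma intervalIntegrable_of_locallyIntegrable {k : ℝ → ℝ} (hk : LocallyIntegrable k) (a b : ℝ) :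
    IntervalIntegrable k volume a b :=
  (hk.integrableOn_isCompact isCompact_uIcc).intervalIntegrable

lemma setLIntegral_wm (hk : LocallyIntegrable (dens D k)) {A : Set ℝ} (hA : MeasurableSet A)
    {g : ℝ → ℝ≥0∞} (hg : AEMeasurable g (volume.restrict A)) :
    ∫⁻ x in A, g x ∂wm D k = ∫⁻ x in A, ENNReal.ofReal (dens D k x) * g x := by
  rw [wm, restrict_withDensity hA, lintegral_withDensity_eq_lintegral_mul₀ _ hg]
  · rfl
  · exact hk.aestronglyMeasurable.aemeasurable.ennreal_ofReal.restrict

lemma wm_compl_openDom (hk : LocallyIntegrable (dens D k)) : wm D k (openDom D)ᶜ = 0 := by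
  have := setLIntegral_wm hk (isOpen_openDom D).measurableSet.compl (g := fun _ => 1)
    aemeasurable_const
  rw [setLIntegral_one] at this
  rw [this]
  refine setLIntegral_eq_zero (isOpen_openDom D).measurableSet.compl fun x hx => ?_
  simp [dens_of_notMem hx]

lemma ae_wm_mem (hk : LocallyIntegrable (dens D k)) : ∀ᵐ x ∂wm D k, x ∈ openDom D :=
  wm_compl_openDom hk

lemma setLIntegral_wm_inter (hk : LocallyIntegrable (dens D k)) (A : Set ℝ) (g : ℝ → ℝ≥0∞) :
    ∫⁻ x in A, g x ∂wm D k = ∫⁻ x in A ∩ openDom D, g x ∂wm D k := by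
  refine setLIntegral_congr ?_
  filter_upwards [ae_wm_mem hk] with x hx
  exact propext ⟨fun h => ⟨h, hx⟩, fun h => h.1⟩

lemma lintegral_wm (hk : LocallyIntegrable (dens D k)) (g : ℝ → ℝ≥0∞) :
    ∫⁻ x, g x ∂wm D k = ∫⁻ x in openDom D, g x ∂wm D k := by
  rw [← setLIntegral_univ, setLIntegral_wm_inter hk, univ_inter]

lemma setLIntegral_Iio_wm (hk : LocallyIntegrable (dens D k)) (x : ℝ) (g : ℝ → ℝ≥0∞) :
    ∫⁻ t in Iio x, g t ∂wm D k = ∫⁻ t in Ioo 0 x, g t ∂wm D k := by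
  rw [setLIntegral_wm_inter hk, setLIntegral_wm_inter hk (Ioo 0 x)]
  congr 2
  ext t
  exact ⟨fun h => ⟨⟨h.2.1, h.1⟩, h.2⟩, fun h => ⟨h.1.2, h.2⟩⟩

/-- Integrals of non-negative functions against `wm D k` as interval integrals. -/
lemma setLIntegral_Ioo_wm (hk : LocallyIntegrable (dens D k)) {a b : ℝ} (hab : a ≤ b)
    {g : ℝ → ℝ} (hg : AEMeasurable g (volume.restrict (Ioo a b)))
    (h0 : ∀ t ∈ Ioo a b, 0 ≤ g t)
    (hi : IntervalIntegrable (fun t => dens D k t * g t) volume a b) :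
    ∫⁻ t in Ioo a b, ENNReal.ofReal (g t) ∂wm D k
      = ENNReal.ofReal (∫ t in a..b, dens D k t * g t) := by
  rw [setLIntegral_wm hk measurableSet_Ioo hg.ennreal_ofReal, intervalIntegral.integral_of_le hab,
    integral_Ioc_eq_integral_Ioo, ofReal_integral_eq_lintegral_ofReal]
  · exact lintegral_congr fun t => (ENNReal.ofReal_mul (dens_nonneg D k t)).symm
  · exact ((intervalIntegrable_iff_integrableOn_Ioc_of_le hab).1 hi).mono_set Ioo_subset_Ioc_self
  · exact (ae_restrict_iff' measurableSet_Ioo).2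
      (Filter.Eventually.of_forall fun t ht => mul_nonneg (dens_nonneg D k t) (h0 t ht))

lemma setLIntegral_Iio_wm_eq_ofReal (hk : LocallyIntegrable (dens D k)) {x : ℝ} (hx : 0 ≤ x)
    {g : ℝ → ℝ} (hg : Measurable g) (h0 : ∀ t, 0 ≤ g t)
    (hi : LocallyIntegrable fun t => dens D k t * g t) :
    ∫⁻ t in Iio x, ENNReal.ofReal (g t) ∂wm D k
      = ENNReal.ofReal (∫ t in 0..x, dens D k t * g t) := by
  rw [setLIntegral_Iio_wm hk, setLIntegral_Ioo_wm hk hx hg.aemeasurable (fun t _ => h0 t)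
    (intervalIntegrable_of_locallyIntegrable hi _ _)]

lemma wm_Iio_zero (hk : LocallyIntegrable (dens D k)) : wm D k (Iio 0) = 0 := by
  refine measure_mono_null (t := (openDom D)ᶜ) (fun _ ht h => ?_) (wm_compl_openDom hk)
  exact not_lt.2 (le_of_lt h.1) ht

lemma wm_Iio_ne_top (hk : LocallyIntegrable (dens D k)) (x : ℝ) : wm D k (Iio x) ≠ ∞ := by
  rcases le_total 0 x with hx | hx
  · have := setLIntegral_Iio_wm_eq_ofReal hk hx (g := fun _ => 1) measurable_const
      (fun _ => zero_le_one) (by simpa using hk)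
    simp only [ENNReal.ofReal_one, setLIntegral_one] at this
    rw [this]
    exact ENNReal.ofReal_ne_top
  · exact ne_top_of_le_ne_top (wm_Iio_zero hk ▸ ENNReal.zero_ne_top)
      (measure_mono (Iio_subset_Iio hx))

/-- A weight that is positive almost everywhere charges every nonempty open subinterval. Strict
monotonicity and nonvanishing of test integrals rest on this. -/
lemma setLIntegral_wm_pos (hk : LocallyIntegrable (dens D k))
    (hpos : ∀ᵐ x : ℝ, x ∈ openDom D → 0 < k x) {a b : ℝ} (hab : a < b)
    (hsub : Ioo a b ⊆ openDom D) {W : ℝ → ℝ≥0∞} (hW : Measurable W)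
    (h : ∀ t ∈ Ioo a b, W t ≠ 0) : 0 < ∫⁻ t in Ioo a b, W t ∂wm D k := by
  rw [setLIntegral_wm hk measurableSet_Ioo hW.aemeasurable, pos_iff_ne_zero]
  intro h0
  rw [lintegral_eq_zero_iff' (f := fun x => ENNReal.ofReal (dens D k x) * W x)
    (hk.aestronglyMeasurable.aemeasurable.ennreal_ofReal.restrict.mul
    hW.aemeasurable)] at h0
  have h1 : ∀ᵐ x ∂volume.restrict (Ioo a b), False := by
    filter_upwards [h0, ae_restrict_of_ae hpos, ae_restrict_mem measurableSet_Ioo] with x hx hx1 hx2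
    have hkx := hx1 (hsub hx2)
    simp only [Pi.zero_apply, mul_eq_zero, ENNReal.ofReal_eq_zero,
      dens_of_pos (hsub hx2) hkx, h x hx2, or_false] at hx
    exact absurd hkx (not_lt.2 hx)
  rw [Filter.eventually_false_iff_eq_bot, ae_eq_bot, Measure.restrict_eq_zero] at h1
  simp only [Real.volume_Ioo, ENNReal.ofReal_eq_zero] at h1
  linarith

lemma continuous_primitive_dens {g : ℝ → ℝ} (hi : LocallyIntegrable fun t => dens D k t * g t) :
    Continuous fun x => ∫ t in 0..x, dens D k t * g t :=
  intervalIntegral.continuous_primitive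
    (fun a b => intervalIntegrable_of_locallyIntegrable hi a b) 0

end

/-- Exhaustion of a right-open interval by compactly contained ones. -/
lemma setLIntegral_le_of_forall_Ioo {ν : Measure ℝ} {W : ℝ → ℝ≥0∞} {x : ℝ} {E : EReal}
    {c : ℝ≥0∞} (h : ∀ b : ℝ, x < b → (b : EReal) < E → ∫⁻ s in Ioo x b, W s ∂ν ≤ c) :
    ∫⁻ s in {s : ℝ | x < s ∧ (s : EReal) < E}, W s ∂ν ≤ c := by
  -- Rational right endpoints keep the directed union countable, also when `E` is infinite.
  have hset : {s : ℝ | x < s ∧ (s : EReal) < E}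
      = ⋃ q : {q : ℚ // x < q ∧ ((q : ℝ) : EReal) < E}, Ioo x ((q : ℚ) : ℝ) := by
    ext s
    simp only [mem_iUnion, mem_Ioo, Subtype.exists, mem_ofPred_eq]
    constructor
    · rintro ⟨h1, h2⟩
      obtain ⟨q, hq1, hq2⟩ := EReal.lt_iff_exists_rat_btwn.1 h2
      have hq1' : s < (q : ℝ) := by exact_mod_cast hq1
      exact ⟨q, ⟨h1.trans hq1', hq2⟩, h1, hq1'⟩
    · rintro ⟨q, ⟨_, hq2⟩, h1, h2⟩
      exact ⟨h1, (EReal.coe_lt_coe_iff.2 h2).trans hq2⟩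
  rw [hset, setLIntegral_iUnion_of_directed]
  · exact iSup_le fun q => h _ q.2.1 q.2.2
  · refine directed_of_isDirected_le fun q q' hqq' => Ioo_subset_Ioo_right ?_
    exact_mod_cast hqq'

lemma absolutelyContinuousOnInterval_of_dist_le {f g : ℝ → ℝ} {a b : ℝ}
    (hg : AbsolutelyContinuousOnInterval g a b)
    (h : ∀ x ∈ uIcc a b, ∀ y ∈ uIcc a b, dist (f x) (f y) ≤ dist (g x) (g y)) :
    AbsolutelyContinuousOnInterval f a b := by
  rw [absolutelyContinuousOnInterval_iff] at hg ⊢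
  intro ε hε
  obtain ⟨δ, hδ, hg⟩ := hg ε hε
  refine ⟨δ, hδ, fun E hE hEδ => lt_of_le_of_lt (Finset.sum_le_sum fun i hi => ?_) (hg E hE hEδ)⟩
  exact h _ (hE.1 i hi).1 _ (hE.1 i hi).2

lemma absolutelyContinuousOnInterval_primitive {k : ℝ → ℝ} (hk : LocallyIntegrable k)
    (c a b : ℝ) : AbsolutelyContinuousOnInterval (fun x => ∫ t in c..x, k t) a b := by
  have h := (intervalIntegrable_of_locallyIntegrable hk (min c (min a b))
    (max c (max a b))).absolutelyContinuousOnInterval_intervalIntegral (c := c)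
    (by rw [mem_uIcc]; left; simp)
  refine h.mono ?_
  rw [uIcc_of_le (show min c (min a b) ≤ max c (max a b) by simp)]
  exact Icc_subset_Icc (by simp) (by simp)

section

variable {v : ℝ → ℝ} {p : ℝ} {D : EReal}

lemma conj_sub_one (hp : 1 < p) : conj p - 1 = (p - 1)⁻¹ := by
  have : p - 1 ≠ 0 := by linarith
  rw [conj]
  field_simp
  ring

lemma vhat_eq (hp : 1 < p) (x : ℝ) : vhat v p x = v x ^ (-(p - 1)⁻¹) := by
  rw [vhat, ← conj_sub_one hp]
  congr 1
  ring

lemma vhat_pos {x : ℝ} (hv : 0 < v x) : 0 < vhat v p x := Real.rpow_pos_of_pos hv _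

/-- Lebesgue differentiation gives $f'=-\hat vW$ almost everywhere, and $v^{p^*-1}\hat v=1$.
Absolute continuity is inherited from the primitive. -/
lemma hasQuasiDerivOn_of_integral (hp : 1 < p)
    (hv : ∀ᵐ x : ℝ, x ∈ openDom D → 0 < v x) {W : ℝ → ℝ}
    (hloc : LocallyIntegrable fun t => dens D (vhat v p) t * W t) {s : Set ℝ} (hs : IsOpen s)
    (hsD : s ⊆ openDom D) (hconn : OrdConnected s) {f : ℝ → ℝ} {c : ℝ}
    (hf : ∀ x ∈ s, f x = c - ∫ t in 0..x, dens D (vhat v p) t * W t) (hW : ContinuousOn W s) :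
    HasQuasiDerivOn v p f (fun x => -W x) s := by
  refine ⟨fun a ha b hb => ?_, hW.neg, ?_⟩
  · refine absolutelyContinuousOnInterval_of_dist_le
      (absolutelyContinuousOnInterval_primitive hloc 0 a b) fun x hx y hy => ?_
    rw [hf x (hconn.uIcc_subset ha hb hx), hf y (hconn.uIcc_subset ha hb hy),
      dist_sub_left]
  · filter_upwards [LocallyIntegrable.ae_hasDerivAt_integral hloc, hv] with x hx hvx hxs
    have hvx := hvx (hsD hxs)
    have h1 : HasDerivAt f (-(dens D (vhat v p) x * W x)) x :=
      ((hx 0).const_sub c).congr_of_eventuallyEq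
        (Filter.eventuallyEq_of_mem (hs.mem_nhds hxs) hf)
    rw [h1.deriv, dens_of_pos (hsD hxs) (vhat_pos hvx), vhat_eq hp, conj_sub_one hp, mul_neg,
      ← mul_assoc, ← Real.rpow_add hvx]
    simp

/-- Since $v^{p^*-1}$ and $\hat v$ are reciprocal, `w` is the density of $df$ with respect to $\hat
v\,dx$. Increments and energy of `f` are hereby expressed through `w`. -/
lemma HasQuasiDerivOn.ae_deriv_eq (hp : 1 < p)
    (hv : ∀ᵐ x : ℝ, x ∈ openDom D → 0 < v x) {f w : ℝ → ℝ} {s : Set ℝ} (hsD : s ⊆ openDom D)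
    (hf : HasQuasiDerivOn v p f w s) :
    ∀ᵐ x : ℝ, x ∈ s → deriv f x = dens D (vhat v p) x * w x := by
  filter_upwards [hf.2.2, hv] with x hx hvx hxs
  have hvx := hvx (hsD hxs)
  rw [← hx hxs, dens_of_pos (hsD hxs) (vhat_pos hvx), vhat_eq hp, conj_sub_one hp,
      ← mul_assoc, ← Real.rpow_add hvx]
  simp

lemma HasQuasiDerivOn.intervalIntegrable
    (hk : LocallyIntegrable (dens D (vhat v p))) {f w : ℝ → ℝ} {s : Set ℝ}
    (hf : HasQuasiDerivOn v p f w s) {a b : ℝ} (hs : uIcc a b ⊆ s) :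
    IntervalIntegrable (fun t => dens D (vhat v p) t * w t) volume a b :=
  (intervalIntegrable_of_locallyIntegrable hk a b).mul_continuousOn (hf.2.1.mono hs)

lemma HasQuasiDerivOn.sub_eq_integral (hp : 1 < p)
    (hv : ∀ᵐ x : ℝ, x ∈ openDom D → 0 < v x) {f w : ℝ → ℝ} {s : Set ℝ} (hsD : s ⊆ openDom D)
    (hf : HasQuasiDerivOn v p f w s) {a b : ℝ} (hs : uIcc a b ⊆ s) :
    f b - f a = ∫ t in a..b, dens D (vhat v p) t * w t := by
  rw [← (hf.1 a (hs left_mem_uIcc) b (hs right_mem_uIcc)).integral_deriv_eq_sub]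
  refine intervalIntegral.integral_congr_ae ?_
  filter_upwards [hf.ae_deriv_eq hp hv hsD] with x hx hxs
  exact hx (hs (uIoc_subset_uIcc hxs))

lemma HasQuasiDerivOn.lintegral_eq (hp : 1 < p)
    (hv : ∀ᵐ x : ℝ, x ∈ openDom D → 0 < v x) (hk : LocallyIntegrable (dens D (vhat v p)))
    {f w : ℝ → ℝ} {s : Set ℝ} (hsD : s ⊆ openDom D)
    (hf : HasQuasiDerivOn v p f w s) (hw : ∀ x ∈ s, w x ≤ 0) {a b : ℝ} (hab : a ≤ b)
    (hs : Icc a b ⊆ s) :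
    ∫⁻ t in Ioo a b, ENNReal.ofReal |w t| ∂wm D (vhat v p) = ENNReal.ofReal (f a - f b) := by
  have hs' : uIcc a b ⊆ s := by rwa [uIcc_of_le hab]
  have habs : ∀ t ∈ Ioo a b, |w t| = -w t := fun t ht =>
    abs_of_nonpos (hw t (hs (Ioo_subset_Icc_self ht)))
  rw [setLIntegral_congr_fun measurableSet_Ioo fun t ht => by rw [habs t ht],
    setLIntegral_Ioo_wm hk hab]
  · congr 1
    rw [← neg_sub, hf.sub_eq_integral hp hv hsD hs', ← intervalIntegral.integral_neg]
    simp
  · exact ((hf.2.1.mono (Ioo_subset_Icc_self.trans hs)).neg).aemeasurable measurableSet_Ioo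
  · intro t ht
    have := hw t (hs (Ioo_subset_Icc_self ht))
    linarith
  · simpa [Pi.neg_def] using (hf.intervalIntegrable hk hs').neg

lemma HasQuasiDerivOn.ofReal_abs_sub_le (hp : 1 < p)
    (hv : ∀ᵐ x : ℝ, x ∈ openDom D → 0 < v x) (hk : LocallyIntegrable (dens D (vhat v p)))
    {f w : ℝ → ℝ} {s : Set ℝ} (hsD : s ⊆ openDom D)
    (hf : HasQuasiDerivOn v p f w s) {a b : ℝ} (hab : a ≤ b) (hs : Icc a b ⊆ s) :
    ENNReal.ofReal |f b - f a| ≤ ∫⁻ t in Ioo a b, ENNReal.ofReal |w t| ∂wm D (vhat v p) := by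
  have hs' : uIcc a b ⊆ s := by rwa [uIcc_of_le hab]
  have hi : IntervalIntegrable (fun t => dens D (vhat v p) t * |w t|) volume a b :=
    (intervalIntegrable_of_locallyIntegrable hk a b).mul_continuousOn (hf.2.1.mono hs').abs
  rw [setLIntegral_Ioo_wm hk hab _ (fun t _ => abs_nonneg _) hi]
  · refine ENNReal.ofReal_le_ofReal ?_
    rw [hf.sub_eq_integral hp hv hsD hs']
    refine (intervalIntegral.abs_integral_le_integral_abs hab).trans (le_of_eq ?_)
    simp_rw [abs_mul, abs_of_nonneg (dens_nonneg D (vhat v p) _)]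
  · exact ((hf.2.1.mono (Ioo_subset_Icc_self.trans hs)).abs).aemeasurable measurableSet_Ioo

lemma HasQuasiDerivOn.energy_eq (hp : 1 < p)
    (hv : ∀ᵐ x : ℝ, x ∈ openDom D → 0 < v x) (hk : LocallyIntegrable (dens D (vhat v p)))
    {f w : ℝ → ℝ} (hf : HasQuasiDerivOn v p f w (openDom D)) :
    energy v p D f = ∫⁻ x, ENNReal.ofReal |w x| ^ p ∂wm D (vhat v p) := by
  have hm := (isOpen_openDom D).measurableSet
  rw [lintegral_wm hk, setLIntegral_wm hk hm, energy]
  · refine setLIntegral_congr_fun_ae hm ?_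
    filter_upwards [hf.ae_deriv_eq hp hv subset_rfl, hv] with x hx hvx hxs
    have hvx := hvx hxs
    have hpos := vhat_pos (p := p) hvx
    rw [hx hxs, dens_of_pos hxs hpos, ENNReal.ofReal_rpow_of_nonneg (abs_nonneg _) (by linarith),
      ← ENNReal.ofReal_mul hpos.le, abs_mul, abs_of_pos hpos,
      Real.mul_rpow hpos.le (abs_nonneg _)]
    congr 1
    -- The exponents satisfy $-p/(p-1)+1=-1/(p-1)$, so exactly one factor $\hat v$ is left as the
    -- density.
    have : vhat v p x ^ p * v x = vhat v p x := by
      rw [vhat_eq hp, ← Real.rpow_mul hvx.le]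
      nth_rewrite 2 [← Real.rpow_one (v x)]
      rw [← Real.rpow_add hvx]
      congr 1
      have : p - 1 ≠ 0 := by linarith
      field_simp
      ring
    rw [mul_right_comm, this]
  · exact (hf.2.1.abs.aemeasurable hm).ennreal_ofReal.pow_const _

end

end

/-! ### Identification of $\lambda_p$ with the best Hardy constant. -/

section

section

variable {u v : ℝ → ℝ} {p : ℝ} {D : EReal}

lemma IsWeightPair.locallyIntegrable_u (huv : IsWeightPair u v p D) :
    LocallyIntegrable (dens D u) := locallyIntegrable_dens huv.u_int

lemma IsWeightPair.locallyIntegrable_vhat (huv : IsWeightPair u v p D) :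
    LocallyIntegrable (dens D (vhat v p)) := locallyIntegrable_dens huv.vhat_int

lemma IsWeightPair.ae_vhat_pos (huv : IsWeightPair u v p D) :
    ∀ᵐ x : ℝ, x ∈ openDom D → 0 < vhat v p x :=
  huv.v_pos.mono fun _ h hx => vhat_pos (h hx)

lemma muNorm_eq (hp : 1 < p) (huv : IsWeightPair u v p D) {f : ℝ → ℝ}
    (hf : ContinuousOn f (openDom D)) :
    muNorm u p D f = ∫⁻ x, ENNReal.ofReal |f x| ^ p ∂wm D u := by
  have hm := (isOpen_openDom D).measurableSet
  rw [lintegral_wm huv.locallyIntegrable_u, setLIntegral_wm huv.locallyIntegrable_u hm, muNorm]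
  · refine setLIntegral_congr_fun_ae hm ?_
    filter_upwards [huv.u_pos] with x hx hxs
    have hux := hx hxs
    rw [dens_of_pos hxs hux, ENNReal.ofReal_rpow_of_nonneg (abs_nonneg _) (by linarith),
      ← ENNReal.ofReal_mul hux.le, mul_comm]
  · exact (hf.abs.aemeasurable hm).ennreal_ofReal.pow_const _

lemma lintegral_tail_rpow_ne_zero (hp : 1 < p) (huv : IsWeightPair u v p D) {W : ℝ → ℝ≥0∞}
    (hW : Measurable W) {a b : ℝ} (ha : 0 ≤ a) (hab : a < b) (hb : (b : EReal) ≤ D)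
    (h : ∀ t ∈ Ioo a b, W t ≠ 0) :
    ∫⁻ x, tail (wm D (vhat v p)) W x ^ p ∂wm D u ≠ 0 := by
  -- On $(0,m)$ the tail is at least the positive integral over $(m,b)$, and $(0,m)$ has positive
  -- $\mu$-measure.
  set m := (a + b) / 2
  have ham : a < m := by simp only [m]; linarith
  have hmb : m < b := by simp only [m]; linarith
  refine (lt_of_lt_of_le ?_ (setLIntegral_le_lintegral (Ioo 0 m) _)).ne'
  refine setLIntegral_wm_pos huv.locallyIntegrable_u huv.u_pos (ha.trans_lt ham)
    (Ioo_subset_openDom ((EReal.coe_le_coe_iff.2 hmb.le).trans hb))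
    ((measurable_tail _ _).pow_const _) fun x hx => ?_
  have hpos : 0 < ∫⁻ t in Ioo m b, W t ∂wm D (vhat v p) :=
    setLIntegral_wm_pos huv.locallyIntegrable_vhat huv.ae_vhat_pos hmb
      (Ioo_subset_openDom' (ha.trans ham.le) hb) hW fun t ht => h t ⟨ham.trans ht.1, ht.2⟩
  have : 0 < tail (wm D (vhat v p)) W x :=
    hpos.trans_le (lintegral_mono_set fun t ht => hx.2.trans ht.1)
  rw [Ne, ENNReal.rpow_eq_zero_iff_of_pos (by linarith)]
  exact this.ne'

lemma tail_eq_zero {ν : Measure ℝ} {W : ℝ → ℝ≥0∞} {R x : ℝ} (hW : ∀ t, R ≤ t → W t = 0)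
    (hx : R ≤ x) : tail ν W x = 0 :=
  setLIntegral_eq_zero measurableSet_Ioi fun t ht => hW t (hx.trans (le_of_lt ht))

lemma lintegral_tail_rpow_ne_top (hp : 1 < p) (huv : IsWeightPair u v p D) {W : ℝ → ℝ≥0∞}
    {R : ℝ} (hW : ∀ t, R ≤ t → W t = 0) (h0 : tail (wm D (vhat v p)) W 0 ≠ ∞) :
    ∫⁻ x, tail (wm D (vhat v p)) W x ^ p ∂wm D u ≠ ∞ := by
  have hp0 : 0 < p := by linarith
  set T := tail (wm D (vhat v p)) W
  have h1 : ∫⁻ x, T x ^ p ∂wm D u ≤ ∫⁻ x, (Iio R).indicator (fun _ => T 0 ^ p) x ∂wm D u := by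
    refine lintegral_mono_ae ((ae_wm_mem huv.locallyIntegrable_u).mono fun x hx => ?_)
    by_cases hxR : x < R
    · rw [indicator_of_mem (show x ∈ Iio R from hxR)]
      exact ENNReal.rpow_le_rpow (tail_antitone _ _ hx.1.le) hp0.le
    · simp only [T, tail_eq_zero hW (not_lt.1 hxR), ENNReal.zero_rpow_of_pos hp0, zero_le]
  refine ne_top_of_le_ne_top ?_ h1
  rw [lintegral_indicator measurableSet_Iio, setLIntegral_const]
  exact ENNReal.mul_ne_top (ENNReal.rpow_ne_top_of_nonneg hp0.le h0)
    (wm_Iio_ne_top huv.locallyIntegrable_u R)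

/-- Hardy constants are at most `λ_p`. -/
lemma le_lambdaP (hp : 1 < p) (huv : IsWeightPair u v p D) {c : ℝ≥0∞}
    (h : ∀ w : ℝ → ℝ≥0∞, Measurable w →
      c * ∫⁻ x, tail (wm D (vhat v p)) w x ^ p ∂wm D u ≤ ∫⁻ s, w s ^ p ∂wm D (vhat v p)) :
    c ≤ lambdaP u v p D := by
  refine le_sInf ?_
  rintro e ⟨f, ⟨hfc, ⟨w, hw⟩, K, hKD, hK, hfK⟩, hnorm, hfD, rfl⟩
  have hm := (isOpen_openDom D).measurableSet
  set W : ℝ → ℝ≥0∞ := (openDom D).indicator fun x => ENNReal.ofReal |w x| with hWdef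
  have hWm : Measurable W := by
    classical
    rw [hWdef, ← piecewise_eq_indicator]
    exact (ENNReal.continuous_ofReal.comp_continuousOn hw.2.1.abs).measurable_piecewise
      continuousOn_const hm
  -- The Dirichlet condition without a limit at $D$: for $D=\infty$ use the compact support, for
  -- $D<\infty$ continuity and $f(D)=0$.
  have hsmall : ∀ x ∈ openDom D, ∀ ε > 0, ∃ b ∈ openDom D, x < b ∧ |f b| < ε := by
    intro x hx ε hε
    induction D with
    | bot => exact absurd hx.2 (by simp)
    | top =>
      obtain ⟨R, hR⟩ := hK.bddAbove
      refine ⟨max R x + 1, ⟨?_, EReal.coe_lt_top _⟩, ?_, ?_⟩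
      · linarith [hx.1, le_max_right R x]
      · linarith [le_max_right R x]
      · rw [hfK _ ⟨by linarith [hx.1, le_max_right R x], le_top⟩]
        · simpa using hε
        · intro hmem
          linarith [hR hmem, le_max_left R x]
    | coe d =>
      have hxd : x < d := EReal.coe_lt_coe_iff.1 hx.2
      have hcont : ContinuousWithinAt f (Iio d) d := by
        have h1 := hfc d ⟨(hx.1.trans hxd).le, le_rfl⟩
        refine (h1.mono_of_mem_nhdsWithin ?_)
        filter_upwards [Ioo_mem_nhdsLT (hx.1.trans hxd)] with t ht
        exact ⟨ht.1.le, EReal.coe_le_coe_iff.2 ht.2.le⟩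
      have hlim := hcont.tendsto
      rw [hfD d rfl] at hlim
      have hev := (tendsto_zero_iff_abs_tendsto_zero _).1 hlim |>.eventually (gt_mem_nhds hε)
      obtain ⟨b, hb, hb2⟩ := (hev.and (Ioo_mem_nhdsLT hxd)).exists
      exact ⟨b, ⟨hx.1.trans hb2.1, EReal.coe_lt_coe_iff.2 hb2.2⟩, hb2.1, hb⟩
  -- No sign or monotonicity of `f` is known; integrating $|w|$ from `x` to a point where
  -- $|f|<\varepsilon$ dominates $|f(x)|$ up to $\varepsilon$.
  have hle : ∀ x ∈ openDom D, ENNReal.ofReal |f x| ≤ tail (wm D (vhat v p)) W x := by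
    intro x hx
    refine ENNReal.le_of_forall_pos_le_add fun ε hε _ => ?_
    obtain ⟨b, hb, hxb, hfb⟩ := hsmall x hx ε (by exact_mod_cast hε)
    have hsub : Icc x b ⊆ openDom D := (ordConnected_openDom D).out hx hb
    have h1 := hw.ofReal_abs_sub_le hp huv.v_pos huv.locallyIntegrable_vhat subset_rfl hxb.le hsub
    calc ENNReal.ofReal |f x| ≤ ENNReal.ofReal (|f b - f x| + ε) := by
          refine ENNReal.ofReal_le_ofReal ?_
          have : |f x| ≤ |f b - f x| + |f b| := by
            have := abs_sub_abs_le_abs_sub (f x) (f b)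
            rw [abs_sub_comm] at this
            linarith
          linarith
      _ ≤ ENNReal.ofReal |f b - f x| + ε := by
          refine ENNReal.ofReal_add_le.trans ?_
          simp
      _ ≤ tail (wm D (vhat v p)) W x + ε := by
          gcongr
          refine h1.trans ?_
          calc ∫⁻ t in Ioo x b, ENNReal.ofReal |w t| ∂wm D (vhat v p)
              = ∫⁻ t in Ioo x b, W t ∂wm D (vhat v p) := by
                refine setLIntegral_congr_fun measurableSet_Ioo fun t ht => ?_
                rw [hWdef, indicator_of_mem (hsub (Ioo_subset_Icc_self ht))]
            _ ≤ _ := lintegral_mono_set fun t ht => ht.1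
  calc c = c * muNorm u p D f := by rw [hnorm, mul_one]
    _ ≤ c * ∫⁻ x, tail (wm D (vhat v p)) W x ^ p ∂wm D u := by
        rw [muNorm_eq hp huv (hfc.mono (openDom_subset_closedDom D))]
        refine mul_le_mul_right (lintegral_mono_ae ?_) c
        exact (ae_wm_mem huv.locallyIntegrable_u).mono fun x hx =>
          ENNReal.rpow_le_rpow (hle x hx) (by linarith)
    _ ≤ ∫⁻ s, W s ^ p ∂wm D (vhat v p) := h W hWm
    _ = energy v p D f := by
        rw [hw.energy_eq hp huv.v_pos huv.locallyIntegrable_vhat]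
        refine lintegral_congr_ae ((ae_wm_mem huv.locallyIntegrable_vhat).mono fun x hx => ?_)
        simp only [hWdef, indicator_of_mem hx]

/-- The tail integral of a continuous function of bounded support is a test function for `λ_p`. -/
lemma lambdaP_le_of_continuous (hp : 1 < p) (huv : IsWeightPair u v p D) {φ : ℝ → ℝ}
    (hφ : Continuous φ) (h0 : ∀ x, 0 ≤ φ x) {R : ℝ} (hR : ∀ x, R ≤ x → φ x = 0)
    (h1 : ∫⁻ x, tail (wm D (vhat v p)) (fun s => ENNReal.ofReal (φ s)) x ^ p ∂wm D u = 1) :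
    lambdaP u v p D ≤ ∫⁻ s, ENNReal.ofReal (φ s) ^ p ∂wm D (vhat v p) := by
  have hk := huv.locallyIntegrable_vhat
  have hloc : LocallyIntegrable fun t => dens D (vhat v p) t * φ t := hk.mul_continuous hφ
  have hint := intervalIntegrable_of_locallyIntegrable hloc
  set f : ℝ → ℝ := fun x => ∫ t in x..R, dens D (vhat v p) t * φ t with hfdef
  have hfeq : ∀ x, f x = (∫ t in 0..R, dens D (vhat v p) t * φ t)
      - ∫ t in 0..x, dens D (vhat v p) t * φ t := fun x =>
    (intervalIntegral.integral_interval_sub_left (hint _ _) (hint _ _)).symm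
  have hfc : Continuous f := by
    rw [funext hfeq]
    exact continuous_const.sub (continuous_primitive_dens hloc)
  have hfR : ∀ x, R ≤ x → f x = 0 := fun x hx => by
    rw [hfdef]
    refine intervalIntegral.integral_zero_ae (Filter.Eventually.of_forall fun t ht => ?_)
    rw [uIoc_of_ge hx] at ht
    rw [hR t ht.1.le, mul_zero]
  have hf0 : ∀ x ≤ R, 0 ≤ f x := fun x hx =>
    intervalIntegral.integral_nonneg hx fun t _ => mul_nonneg (dens_nonneg _ _ _) (h0 t)
  have htail : ∀ x, tail (wm D (vhat v p)) (fun s => ENNReal.ofReal (φ s)) x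
      = ENNReal.ofReal |f x| := by
    intro x
    rcases le_total R x with hx | hx
    · rw [tail_eq_zero (R := R) (fun t ht => by simp [hR t ht]) hx, hfR x hx]
      simp
    · rw [abs_of_nonneg (hf0 x hx), hfdef,
        ← setLIntegral_Ioo_wm hk hx hφ.measurable.aemeasurable (fun t _ => h0 t) (hint _ _), tail,
        ← lintegral_indicator measurableSet_Ioi, ← lintegral_indicator measurableSet_Ioo]
      refine lintegral_congr fun t => ?_
      by_cases htx : x < t
      · by_cases htR : t < R
        · rw [indicator_of_mem (show t ∈ Ioi x from htx),
            indicator_of_mem (show t ∈ Ioo x R from ⟨htx, htR⟩)]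
        · rw [indicator_of_mem (show t ∈ Ioi x from htx),
            indicator_of_notMem fun h => htR h.2, hR t (not_lt.1 htR), ENNReal.ofReal_zero]
      · rw [indicator_of_notMem (show t ∉ Ioi x from htx), indicator_of_notMem fun h => htx h.1]
  have hq : HasQuasiDerivOn v p f (fun x => -φ x) (openDom D) :=
    hasQuasiDerivOn_of_integral hp huv.v_pos hloc (isOpen_openDom D) subset_rfl
      (ordConnected_openDom D) (fun x _ => hfeq x) hφ.continuousOn
  refine sInf_le ⟨f, ⟨hfc.continuousOn, ⟨_, hq⟩, closedDom D ∩ Icc 0 R, inter_subset_left,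
    isCompact_Icc.inter_left (isClosed_closedDom D), fun x hx hxK => ?_⟩, ?_, fun d hd => ?_, ?_⟩
  · refine hfR x (not_lt.1 fun h => hxK ⟨hx, hx.1, h.le⟩)
  · rw [muNorm_eq hp huv hfc.continuousOn]
    simpa only [htail] using h1
  · rcases le_total R d with h | h
    · exact hfR d h
    · rw [hfdef]
      -- When $D=d\le R$ the density is cut off on $(d,R]$, which makes the boundary value zero even
      -- if `φ` does not vanish there.
      refine intervalIntegral.integral_zero_ae (Filter.Eventually.of_forall fun t ht => ?_)
      rw [uIoc_of_le h] at ht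
      rw [dens_of_notMem, zero_mul]
      rintro ⟨-, h2⟩
      rw [hd, EReal.coe_lt_coe_iff] at h2
      exact absurd ht.1 (not_lt.2 h2.le)
  · rw [hq.energy_eq hp huv.v_pos hk]
    refine lintegral_congr fun t => ?_
    rw [abs_neg, abs_of_nonneg (h0 t)]

/-- Both sides are homogeneous of degree $p$, so scaling reduces to $\mu(|f|^p)=1$. Bounded support
makes the norm finite, and norm zero is trivial. -/
lemma lambdaP_mul_le_of_continuous (hp : 1 < p) (huv : IsWeightPair u v p D) {φ : ℝ → ℝ}
    (hφ : Continuous φ) (h0 : ∀ x, 0 ≤ φ x) {R : ℝ} (hR0 : 0 ≤ R) (hR : ∀ x, R ≤ x → φ x = 0) :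
    lambdaP u v p D *
        ∫⁻ x, tail (wm D (vhat v p)) (fun s => ENNReal.ofReal (φ s)) x ^ p ∂wm D u
      ≤ ∫⁻ s, ENNReal.ofReal (φ s) ^ p ∂wm D (vhat v p) := by
  have hp0 : 0 < p := by linarith
  have hk := huv.locallyIntegrable_vhat
  set M := ∫⁻ x, tail (wm D (vhat v p)) (fun s => ENNReal.ofReal (φ s)) x ^ p ∂wm D u with hM
  have hMtop : M ≠ ∞ := by
    refine lintegral_tail_rpow_ne_top hp huv (R := R) (fun t ht => by simp [hR t ht]) ?_
    have hle : tail (wm D (vhat v p)) (fun s => ENNReal.ofReal (φ s)) 0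
        ≤ ∫⁻ t in Iio R, ENNReal.ofReal (φ t) ∂wm D (vhat v p) := by
      rw [tail, ← lintegral_indicator measurableSet_Ioi, ← lintegral_indicator measurableSet_Iio]
      refine lintegral_mono fun t => ?_
      by_cases htR : t < R
      · rw [indicator_of_mem (show t ∈ Iio R from htR)]
        exact indicator_le_self _ _ _
      · rw [indicator_of_notMem (show t ∉ Iio R from htR)]
        simp [indicator, hR t (not_lt.1 htR)]
    refine ne_top_of_le_ne_top ?_ hle
    rw [setLIntegral_Iio_wm_eq_ofReal hk hR0 hφ.measurable h0 (hk.mul_continuous hφ)]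
    exact ENNReal.ofReal_ne_top
  by_cases hM0 : M = 0
  · rw [hM0, mul_zero]
    exact zero_le
  have hMpos : 0 < M.toReal := ENNReal.toReal_pos hM0 hMtop
  -- The normalising factor: $a^pM=1$.
  set a : ℝ := M.toReal ^ (-(1 / p)) with ha
  have ha0 : 0 ≤ a := Real.rpow_nonneg hMpos.le _
  have hap : ENNReal.ofReal a ^ p = M⁻¹ := by
    rw [ENNReal.ofReal_rpow_of_nonneg ha0 hp0.le, ha, ← Real.rpow_mul hMpos.le, neg_mul,
      one_div_mul_cancel hp0.ne', Real.rpow_neg_one, ENNReal.ofReal_inv_of_pos hMpos,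
      ENNReal.ofReal_toReal hMtop]
  have hapt : ENNReal.ofReal a ^ p ≠ ∞ := by rw [hap]; exact ENNReal.inv_ne_top.2 hM0
  have h2 := lambdaP_le_of_continuous hp huv (φ := fun x => a * φ x) (hφ.const_mul a)
    (fun x => mul_nonneg ha0 (h0 x)) (fun x hx => by rw [hR x hx, mul_zero]) (by
      have : ∀ x, tail (wm D (vhat v p)) (fun s => ENNReal.ofReal (a * φ s)) x ^ p
          = ENNReal.ofReal a ^ p *
            tail (wm D (vhat v p)) (fun s => ENNReal.ofReal (φ s)) x ^ p := by
        intro x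
        rw [← ENNReal.mul_rpow_of_nonneg _ _ hp0.le]
        congr 1
        simp_rw [tail, ENNReal.ofReal_mul ha0]
        exact lintegral_const_mul' _ _ ENNReal.ofReal_ne_top
      simp_rw [this]
      rw [lintegral_const_mul' _ _ hapt, ← hM, hap, ENNReal.inv_mul_cancel hM0 hMtop])
  simp_rw [ENNReal.ofReal_mul ha0, ENNReal.mul_rpow_of_nonneg _ _ hp0.le] at h2
  rw [lintegral_const_mul' _ _ hapt, hap] at h2
  calc lambdaP u v p D * M
      ≤ M⁻¹ * (∫⁻ s, ENNReal.ofReal (φ s) ^ p ∂wm D (vhat v p)) * M := by gcongr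
    _ = M⁻¹ * M * ∫⁻ s, ENNReal.ofReal (φ s) ^ p ∂wm D (vhat v p) := by ring
    _ = _ := by rw [ENNReal.inv_mul_cancel hM0 hMtop, one_mul]

/-- The cutoff functions increasing to the indicator of an open set `U`. -/
def cutoff (U : Set ℝ) (n : ℕ) (x : ℝ) : ℝ :=
  min 1 (max 0 (n * Metric.infDist x Uᶜ - 1)) * min 1 (max 0 (n - x))

lemma cutoff_nonneg (U : Set ℝ) (n : ℕ) (x : ℝ) : 0 ≤ cutoff U n x := by
  unfold cutoff; positivity

lemma cutoff_le_one (U : Set ℝ) (n : ℕ) (x : ℝ) : cutoff U n x ≤ 1 :=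
  mul_le_one₀ (min_le_left _ _) (by positivity) (min_le_left _ _)

lemma cutoff_mono (U : Set ℝ) (x : ℝ) : Monotone fun n => cutoff U n x := by
  intro m n h
  have h' : (m : ℝ) ≤ n := by exact_mod_cast h
  have := Metric.infDist_nonneg (x := x) (s := Uᶜ)
  simp only [cutoff]
  gcongr

lemma cutoff_continuous (U : Set ℝ) (n : ℕ) : Continuous (cutoff U n) := by
  unfold cutoff
  have := Metric.continuous_infDist_pt Uᶜ
  fun_prop

lemma cutoff_eventually_eq_one {U : Set ℝ} (hU : IsOpen U) (hne : Uᶜ.Nonempty) {x : ℝ}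
    (hx : x ∈ U) : ∀ᶠ n in Filter.atTop, cutoff U n x = 1 := by
  have hd : 0 < Metric.infDist x Uᶜ :=
    (hU.isClosed_compl.notMem_iff_infDist_pos hne).1 (by simpa using hx)
  -- Beyond this `N` both truncated expressions, $n\,\mathrm{dist}(x,U^c)-1$ and $n-x$, are at least
  -- one.
  obtain ⟨N, hN⟩ := exists_nat_ge (max (2 / Metric.infDist x Uᶜ) (x + 1))
  filter_upwards [Filter.eventually_ge_atTop N] with n hn
  have hn' : (N : ℝ) ≤ n := by exact_mod_cast hn
  have h1 : 2 ≤ n * Metric.infDist x Uᶜ :=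
    (div_le_iff₀ hd).1 ((le_max_left _ _).trans (hN.trans hn'))
  have h2 : x + 1 ≤ n := (le_max_right _ _).trans (hN.trans hn')
  rw [cutoff, min_eq_left (le_max_of_le_right (by linarith)),
    min_eq_left (le_max_of_le_right (by linarith)), one_mul]

lemma continuous_mul_cutoff {U : Set ℝ} (hU : IsOpen U) {W : ℝ → ℝ} (hW : ContinuousOn W U)
    (n : ℕ) : Continuous fun x => W x * cutoff U n x := by
  rw [continuous_iff_continuousAt]
  intro x
  by_cases hx : x ∈ U
  · exact (hW.continuousAt (hU.mem_nhds hx)).mul (cutoff_continuous U n).continuousAt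
  -- The shift by $-1$ makes the cutoff vanish on a whole neighbourhood of $U^c$, so `W` may be
  -- unbounded or discontinuous at the boundary of `U`.
  · have h0 : Metric.infDist x Uᶜ = 0 := Metric.infDist_zero_of_mem hx
    have hev : ∀ᶠ y in nhds x, n * Metric.infDist y Uᶜ < 1 := by
      have hc : Continuous fun y => n * Metric.infDist y Uᶜ :=
        (Metric.continuous_infDist_pt Uᶜ).const_mul _
      refine hc.continuousAt.eventually (gt_mem_nhds ?_)
      simp [h0]
    refine (continuousAt_const (y := (0 : ℝ))).congr ?_
    filter_upwards [hev] with y hy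
    rw [cutoff, max_eq_left (by linarith), min_eq_right zero_le_one]
    simp

/-- The Hardy inequality with constant `λ_p` for functions continuous on an open set and
vanishing off it. -/
lemma lambdaP_mul_le (hp : 1 < p) (huv : IsWeightPair u v p D) {U : Set ℝ} (hU : IsOpen U)
    (hne : Uᶜ.Nonempty) {W : ℝ → ℝ} (hW : ContinuousOn W U) (h0 : ∀ x, 0 ≤ W x)
    (hoff : ∀ x ∉ U, W x = 0) :
    lambdaP u v p D *
        ∫⁻ x, tail (wm D (vhat v p)) (fun s => ENNReal.ofReal (W s)) x ^ p ∂wm D u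
      ≤ ∫⁻ s, ENNReal.ofReal (W s) ^ p ∂wm D (vhat v p) := by
  have hp0 : 0 ≤ p := by linarith
  set φ : ℕ → ℝ → ℝ := fun n x => W x * cutoff U n x with hφ
  have hφc : ∀ n, Continuous (φ n) := continuous_mul_cutoff hU hW
  have hφ0 : ∀ n x, 0 ≤ φ n x := fun n x => mul_nonneg (h0 x) (cutoff_nonneg U n x)
  have hφm : ∀ x, Monotone fun n => φ n x := fun x m n h =>
    mul_le_mul_of_nonneg_left (cutoff_mono U x h) (h0 x)
  have hφW : ∀ n x, φ n x ≤ W x := fun n x => mul_le_of_le_one_right (h0 x) (cutoff_le_one U n x)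
  have hlim : ∀ x, Filter.Tendsto (fun n => ENNReal.ofReal (φ n x)) Filter.atTop
      (nhds (ENNReal.ofReal (W x))) := by
    intro x
    refine tendsto_const_nhds.congr' ?_
    by_cases hx : x ∈ U
    · filter_upwards [cutoff_eventually_eq_one hU hne hx] with n hn
      simp [hφ, hn]
    · simp [hφ, hoff x hx]
  have hm : ∀ n, Measurable fun x => ENNReal.ofReal (φ n x) := fun n =>
    (hφc n).measurable.ennreal_ofReal
  have htmono : ∀ x, Monotone fun n =>
      tail (wm D (vhat v p)) (fun s => ENNReal.ofReal (φ n s)) x := fun x m n h =>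
    lintegral_mono fun s => ENNReal.ofReal_le_ofReal (hφm s h)
  have htail : ∀ x, Filter.Tendsto
      (fun n => tail (wm D (vhat v p)) (fun s => ENNReal.ofReal (φ n s)) x) Filter.atTop
      (nhds (tail (wm D (vhat v p)) (fun s => ENNReal.ofReal (W s)) x)) := fun x =>
    lintegral_tendsto_of_tendsto_of_monotone (fun n => (hm n).aemeasurable)
      (Filter.Eventually.of_forall fun s m n h => ENNReal.ofReal_le_ofReal (hφm s h))
      (Filter.Eventually.of_forall hlim)
  have hfinal := lintegral_tendsto_of_tendsto_of_monotone (μ := wm D u)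
    (f := fun n x => tail (wm D (vhat v p)) (fun s => ENNReal.ofReal (φ n s)) x ^ p)
    (F := fun x => tail (wm D (vhat v p)) (fun s => ENNReal.ofReal (W s)) x ^ p)
    (fun n => ((measurable_tail _ _).pow_const p).aemeasurable)
    (Filter.Eventually.of_forall fun x m n h => ENNReal.rpow_le_rpow (htmono x h) hp0)
    (Filter.Eventually.of_forall fun x =>
      (ENNReal.continuous_rpow_const.tendsto _).comp (htail x))
  by_cases hz : ∫⁻ x, tail (wm D (vhat v p)) (fun s => ENNReal.ofReal (W s)) x ^ p ∂wm D u = 0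
  · rw [hz, mul_zero]
    exact zero_le
  -- Only the left side is passed to the limit; the right side is bounded by $\varphi_n\le W$.
  -- Nonvanishing of the limit allows multiplication by a possibly infinite $\lambda_p$.
  refine le_of_tendsto' (ENNReal.Tendsto.const_mul hfinal (Or.inl hz)) fun n => ?_
  refine (lambdaP_mul_le_of_continuous hp huv (hφc n) (hφ0 n) (Nat.cast_nonneg n)
    fun x hx => ?_).trans ?_
  · simp only [hφ, cutoff, max_eq_left (show (n : ℝ) - x ≤ 0 by linarith)]
    simp
  · exact lintegral_mono fun s =>
      ENNReal.rpow_le_rpow (ENNReal.ofReal_le_ofReal (hφW n s)) hp0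

lemma measurable_of_continuousOn_open {U : Set ℝ} (hU : IsOpen U) {W : ℝ → ℝ}
    (hW : ContinuousOn W U) (hoff : ∀ x ∉ U, W x = 0) : Measurable W := by
  classical
  have : W = U.piecewise W fun _ => 0 := by
    ext x
    by_cases hx : x ∈ U <;> simp [hx, hoff]
  rw [this]
  exact hW.measurable_piecewise continuousOn_const hU.measurableSet

/-- A constant quasi-derivative on $(0,b)$, $b<D$, has finite energy and a nonzero norm, which an
infinite Hardy constant forbids. -/
lemma lambdaP_ne_top (hp : 1 < p) (hD : 0 < D) (huv : IsWeightPair u v p D) :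
    lambdaP u v p D ≠ ∞ := by
  obtain ⟨b, hb⟩ := openDom_nonempty hD
  intro htop
  set W : ℝ → ℝ := (Ioo 0 b).indicator fun _ => 1 with hW
  have hWc : ContinuousOn W (Ioo 0 b) :=
    continuousOn_const.congr fun x hx => indicator_of_mem hx _
  have hoff : ∀ x ∉ Ioo 0 b, W x = 0 := fun x hx => indicator_of_notMem hx _
  have h := lambdaP_mul_le hp huv isOpen_Ioo ⟨0, by simp⟩ hWc
    (indicator_nonneg fun _ _ => zero_le_one) hoff
  rw [htop, ENNReal.top_mul] at h
  · rw [top_le_iff] at h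
    refine absurd h (ne_top_of_le_ne_top (wm_Iio_ne_top huv.locallyIntegrable_vhat b) ?_)
    rw [← lintegral_indicator_one measurableSet_Iio]
    refine lintegral_mono fun t => ?_
    by_cases ht : t ∈ Ioo 0 b
    · simp [hW, ht, ht.2]
    · simp [hoff t ht, ENNReal.zero_rpow_of_pos (by linarith : 0 < p)]
  · refine lintegral_tail_rpow_ne_zero hp huv
      (measurable_of_continuousOn_open isOpen_Ioo hWc hoff).ennreal_ofReal le_rfl hb.1 hb.2.le
      fun t ht => ?_
    simp [hW, indicator_of_mem ht]

end

end

/-! ### Comparison principles for $\lambda_p$ and solutions of the initial value problem. -/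

section

section

variable {u v : ℝ → ℝ} {p : ℝ} {D : EReal}

lemma head_wm_le (hp : 1 < p) (hk : LocallyIntegrable (dens D u)) {f g : ℝ → ℝ≥0∞} {x : ℝ}
    (h : ∀ t ∈ openDom D, t < x → f t ≤ g t) : head (wm D u) p f x ≤ head (wm D u) p g x := by
  refine setLIntegral_mono_ae' measurableSet_Iio ((ae_wm_mem hk).mono fun t ht htx => ?_)
  exact ENNReal.rpow_le_rpow (h t ht htx) (by linarith)

lemma head_wm_congr (hp : 1 < p) (hk : LocallyIntegrable (dens D u)) {f g : ℝ → ℝ≥0∞} {x : ℝ}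
    (h : ∀ t ∈ openDom D, t < x → f t = g t) : head (wm D u) p f x = head (wm D u) p g x :=
  le_antisymm (head_wm_le hp hk fun t ht htx => (h t ht htx).le)
    (head_wm_le hp hk fun t ht htx => (h t ht htx).ge)

/-- A supersolution bounds `λ_p` from below. -/
lemma le_lambdaP_of_super (hp : 1 < p) (huv : IsWeightPair u v p D) {c : ℝ≥0∞}
    {W g : ℝ → ℝ≥0∞} (hW : Measurable W) (hW0 : ∀ s ∈ openDom D, W s ≠ 0 ∧ W s ≠ ∞)
    (hg : ∀ x ∈ openDom D, tail (wm D (vhat v p)) W x ≤ g x)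
    (h : ∀ s ∈ openDom D, c * head (wm D u) p g s ≤ W s ^ (p - 1)) : c ≤ lambdaP u v p D := by
  have hmem := ae_wm_mem huv.locallyIntegrable_vhat
  refine le_lambdaP hp huv fun w hw =>
    hardy_of_super hp hW (hmem.mono hW0) (hmem.mono fun s hs => ?_) hw
  -- Here `g` is the function itself, which may exceed the tail of `W` by a positive limit at $D$;
  -- enlarging it only strengthens the hypothesis.
  refine le_trans ?_ (h s hs)
  gcongr
  exact head_wm_le hp huv.locallyIntegrable_u fun t ht _ => hg t ht

lemma tail_ne_top {k : ℝ → ℝ} (hk : LocallyIntegrable (dens D k)) {W : ℝ → ℝ≥0∞} {R : ℝ}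
    {M : ℝ≥0∞} (hR : ∀ t, R ≤ t → W t = 0) (hM : M ≠ ∞) (hWM : ∀ t, W t ≤ M) (x : ℝ) :
    tail (wm D k) W x ≠ ∞ := by
  have : tail (wm D k) W x ≤ ∫⁻ t in Iio R, M ∂wm D k := by
    rw [tail, ← lintegral_indicator measurableSet_Ioi, ← lintegral_indicator measurableSet_Iio]
    refine lintegral_mono fun t => (indicator_le_self _ _ _).trans ?_
    by_cases htR : t < R
    · rw [indicator_of_mem (show t ∈ Iio R from htR)]
      exact hWM t
    · rw [hR t (not_lt.1 htR)]
      exact zero_le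
  refine ne_top_of_le_ne_top ?_ this
  rw [setLIntegral_const]
  exact ENNReal.mul_ne_top hM (wm_Iio_ne_top hk R)

/-- A subsolution bounds `λ_p` from above. -/
lemma lambdaP_le_of_sub (hp : 1 < p) (huv : IsWeightPair u v p D) {C : ℝ≥0∞} {U : Set ℝ}
    (hU : IsOpen U) {W : ℝ → ℝ} (hW : ContinuousOn W U) (h0 : ∀ x, 0 ≤ W x)
    (hoff : ∀ x ∉ U, W x = 0) {R M a b : ℝ} (hUR : U ⊆ Iio R) (hM : ∀ x, W x ≤ M) (ha : 0 ≤ a)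
    (hab : a < b) (hb : (b : EReal) ≤ D) (hpos : ∀ t ∈ Ioo a b, 0 < W t)
    (h : ∀ s ∈ U ∩ openDom D, ENNReal.ofReal (W s) ^ (p - 1)
      ≤ C * head (wm D u) p (tail (wm D (vhat v p)) fun s => ENNReal.ofReal (W s)) s) :
    lambdaP u v p D ≤ C := by
  have hm := (measurable_of_continuousOn_open hU hW hoff).ennreal_ofReal
  have hR0 : ∀ t, R ≤ t → ENNReal.ofReal (W t) = 0 := fun t ht => by
    rw [hoff t fun h => not_lt.2 ht (hUR h), ENNReal.ofReal_zero]
  -- Bounded support and the bound `M` keep the norm finite; positivity on $(a,b)$ keeps it nonzero.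
  refine le_of_sub (μ := wm D u) (ν := wm D (vhat v p)) hp hm
    (lambdaP_mul_le hp huv hU ⟨R, fun h => absurd (hUR h) (lt_irrefl R)⟩ hW h0 hoff) ?_ ?_ ?_
  · refine (ae_wm_mem huv.locallyIntegrable_vhat).mono fun s hs hne => h s ⟨?_, hs⟩
    by_contra hsU
    exact hne (by rw [hoff s hsU, ENNReal.ofReal_zero])
  · exact lintegral_tail_rpow_ne_zero hp huv hm ha hab hb fun t ht => by simpa using hpos t ht
  · exact lintegral_tail_rpow_ne_top hp huv hR0 (tail_ne_top huv.locallyIntegrable_vhat hR0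
      ENNReal.ofReal_ne_top (fun t => ENNReal.ofReal_le_ofReal (hM t)) 0)

lemma primitive_eq_head (hp : 1 < p) (huv : IsWeightPair u v p D) {f : ℝ → ℝ} {x : ℝ}
    (hx : (x : EReal) ≤ D) (hf : ContinuousOn f (Ioo 0 x)) (h0 : ∀ t ∈ Ioo 0 x, 0 ≤ f t) :
    primitive u p f x = head (wm D u) p (fun t => ENNReal.ofReal (f t)) x := by
  have hk := huv.locallyIntegrable_u
  rw [head, setLIntegral_Iio_wm hk, setLIntegral_wm hk measurableSet_Ioo, primitive]
  · refine setLIntegral_congr_fun_ae measurableSet_Ioo ?_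
    filter_upwards [huv.u_pos] with t ht htx
    have hu := ht (Ioo_subset_openDom hx htx)
    rw [dens_of_pos (Ioo_subset_openDom hx htx) hu,
      ENNReal.ofReal_rpow_of_nonneg (h0 t htx) (by linarith), ← ENNReal.ofReal_mul hu.le, mul_comm]
  · exact (hf.aemeasurable measurableSet_Ioo).ennreal_ofReal.pow_const _

lemma head_pos (hp : 1 < p) (huv : IsWeightPair u v p D) {f : ℝ → ℝ} {a b x : ℝ} (ha : 0 ≤ a)
    (hab : a < b) (hbx : b ≤ x) (hb : (b : EReal) ≤ D) (hf : ContinuousOn f (Ioo a b))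
    (h0 : ∀ t ∈ Ioo a b, 0 < f t) :
    head (wm D u) p (fun t => ENNReal.ofReal (f t)) x ≠ 0 := by
  have hp1 : 0 < p - 1 := by linarith
  have hsub := Ioo_subset_openDom' (D := D) ha hb
  set g : ℝ → ℝ := (Ioo a b).indicator f with hg
  have hgm : Measurable g := measurable_of_continuousOn_open isOpen_Ioo
    (hf.congr fun t ht => indicator_of_mem ht _) fun t ht => indicator_of_notMem ht _
  have h := setLIntegral_wm_pos huv.locallyIntegrable_u huv.u_pos hab hsub
    (hgm.ennreal_ofReal.pow_const (p - 1)) fun t ht => by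
      rw [hg, indicator_of_mem ht, Ne, ENNReal.rpow_eq_zero_iff_of_pos hp1]
      simpa using h0 t ht
  refine (h.trans_le ?_).ne'
  calc ∫⁻ t in Ioo a b, ENNReal.ofReal (g t) ^ (p - 1) ∂wm D u
      = ∫⁻ t in Ioo a b, ENNReal.ofReal (f t) ^ (p - 1) ∂wm D u :=
        setLIntegral_congr_fun measurableSet_Ioo fun t ht => by rw [hg, indicator_of_mem ht]
    _ ≤ _ := lintegral_mono_set fun t ht => ht.2.trans_le hbx

lemma head_ne_top_of_le (hp : 1 < p) (hk : LocallyIntegrable (dens D u)) {f : ℝ → ℝ≥0∞}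
    {M : ℝ≥0∞} (hM : M ≠ ∞) {x : ℝ} (h : ∀ t ∈ openDom D, t < x → f t ≤ M) :
    head (wm D u) p f x ≠ ∞ := by
  refine ne_top_of_le_ne_top ?_ (head_wm_le hp hk h)
  rw [head, setLIntegral_const]
  exact ENNReal.mul_ne_top (ENNReal.rpow_ne_top_of_nonneg (by linarith) hM) (wm_Iio_ne_top hk x)

/-! ### The real-valued initial value problem -/

/-- `∫_0^x f_+ ^ (p - 1) dμ`. -/
def posPrim (u : ℝ → ℝ) (p : ℝ) (D : EReal) (f : ℝ → ℝ) (x : ℝ) : ℝ :=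
  ∫ t in 0..x, dens D u t * max (f t) 0 ^ (p - 1)

/-- `(c ∫_0^x f_+ ^ (p - 1) dμ) ^ (1 / (p - 1))`. -/
def posFlux (u : ℝ → ℝ) (p : ℝ) (D : EReal) (c : ℝ) (f : ℝ → ℝ) (x : ℝ) : ℝ :=
  (c * posPrim u p D f x) ^ (p - 1)⁻¹

lemma continuous_posPart_rpow (hp : 1 < p) {f : ℝ → ℝ} (hf : Continuous f) :
    Continuous fun t => max (f t) 0 ^ (p - 1) :=
  (hf.max continuous_const).rpow_const fun _ => Or.inr (by linarith)

lemma continuous_posPrim (hp : 1 < p) (huv : IsWeightPair u v p D) {f : ℝ → ℝ}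
    (hf : Continuous f) : Continuous (posPrim u p D f) :=
  continuous_primitive_dens
    (huv.locallyIntegrable_u.mul_continuous (continuous_posPart_rpow hp hf))

lemma primitive_dens_eq_zero {k g : ℝ → ℝ} {x : ℝ} (hx : x ≤ 0) :
    ∫ t in 0..x, dens D k t * g t = 0 := by
  refine intervalIntegral.integral_zero_ae (Filter.Eventually.of_forall fun t ht => ?_)
  rw [uIoc_of_ge hx] at ht
  rw [dens_of_notMem fun h => not_lt.2 ht.2 h.1, zero_mul]

lemma posPrim_nonneg (f : ℝ → ℝ) (x : ℝ) : 0 ≤ posPrim u p D f x := by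
  rcases le_total 0 x with hx | hx
  · exact intervalIntegral.integral_nonneg hx fun t _ =>
      mul_nonneg (dens_nonneg _ _ _) (Real.rpow_nonneg (le_max_right _ _) _)
  · exact (primitive_dens_eq_zero hx).ge

lemma posPrim_zero (f : ℝ → ℝ) : posPrim u p D f 0 = 0 := intervalIntegral.integral_same

lemma head_eq_ofReal_posPrim (hp : 1 < p) (huv : IsWeightPair u v p D) {f : ℝ → ℝ}
    (hf : Continuous f) {x : ℝ} (hx : 0 ≤ x) :
    head (wm D u) p (fun t => ENNReal.ofReal (f t)) x = ENNReal.ofReal (posPrim u p D f x) := by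
  have hc := continuous_posPart_rpow hp hf
  have h0 : ∀ t, 0 ≤ max (f t) 0 ^ (p - 1) := fun t => Real.rpow_nonneg (le_max_right _ _) _
  rw [posPrim, ← setLIntegral_Iio_wm_eq_ofReal huv.locallyIntegrable_u hx hc.measurable h0
    (huv.locallyIntegrable_u.mul_continuous hc), head]
  refine lintegral_congr fun t => ?_
  rw [← ENNReal.ofReal_rpow_of_nonneg (le_max_right _ _) (by linarith)]
  simp

lemma posFlux_nonneg {c : ℝ} (hc : 0 ≤ c) (f : ℝ → ℝ) (x : ℝ) : 0 ≤ posFlux u p D c f x :=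
  Real.rpow_nonneg (mul_nonneg hc (posPrim_nonneg f x)) _

lemma continuous_posFlux (hp : 1 < p) (huv : IsWeightPair u v p D) {c : ℝ} {f : ℝ → ℝ}
    (hf : Continuous f) : Continuous (posFlux u p D c f) :=
  ((continuous_posPrim hp huv hf).const_mul c).rpow_const
    fun _ => Or.inr (inv_nonneg.2 (by linarith))

lemma posFlux_rpow (hp : 1 < p) {c : ℝ} (hc : 0 ≤ c) (f : ℝ → ℝ) (x : ℝ) :
    posFlux u p D c f x ^ (p - 1) = c * posPrim u p D f x := by
  rw [posFlux, ← Real.rpow_mul (mul_nonneg hc (posPrim_nonneg f x)),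
    inv_mul_cancel₀ (by linarith), Real.rpow_one]

/-- The Euler–Lagrange equation in the form used by the comparison principles; `ENNReal.ofReal`
takes the positive part of `f` automatically. -/
lemma ofReal_posFlux_rpow (hp : 1 < p) (huv : IsWeightPair u v p D) {c : ℝ} (hc : 0 ≤ c)
    {f : ℝ → ℝ} (hf : Continuous f) {x : ℝ} (hx : 0 ≤ x) :
    ENNReal.ofReal (posFlux u p D c f x) ^ (p - 1)
      = ENNReal.ofReal c * head (wm D u) p (fun t => ENNReal.ofReal (f t)) x := by
  rw [ENNReal.ofReal_rpow_of_nonneg (posFlux_nonneg hc f x) (by linarith), posFlux_rpow hp hc,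
    ENNReal.ofReal_mul hc, head_eq_ofReal_posPrim hp huv hf hx]

/-- `f` solves `v f' |f'| ^ (p - 2) = -c ∫_0^x f_+ ^ (p - 1) dμ`, `f 0 = 1`. -/
structure IsSolution (u v : ℝ → ℝ) (p : ℝ) (D : EReal) (c : ℝ) (f : ℝ → ℝ) : Prop where
  cont : Continuous f
  eq : ∀ x, 0 ≤ x → f x = 1 - ∫ t in 0..x, dens D (vhat v p) t * posFlux u p D c f t

/-- The $[0,\infty]$-valued solution `F` is truncated at zero. Its flux is finite, and subtracting
the primitive of that flux from 1 in $\mathbb R$ gives a continuation below zero with positive part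
`F`. -/
lemma exists_isSolution (hp : 1 < p) (huv : IsWeightPair u v p D) {c : ℝ} (hc : 0 ≤ c) :
    ∃ f, IsSolution u v p D c f := by
  have hp1 : 0 < p - 1 := by linarith
  have hku := huv.locallyIntegrable_u
  have hkv := huv.locallyIntegrable_vhat
  obtain ⟨F, hF⟩ := exists_ivp (c := ENNReal.ofReal c) hp ENNReal.ofReal_ne_top
    (wm_Iio_ne_top hku) (wm_Iio_ne_top hkv) (wm_Iio_zero hkv)
  have hF1 : ∀ x, F x ≤ 1 := fun x => by rw [hF]; exact tsub_le_self
  have hFt : ∀ x, F x ≠ ∞ := fun x => ne_top_of_le_ne_top ENNReal.one_ne_top (hF1 x)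
  have hFanti : Antitone F := fun x y h => by
    rw [hF, hF]; exact tsub_le_tsub_left (decrease_monotone F h) 1
  have hgm : Measurable fun t => (F t).toReal ^ (p - 1) :=
    hFanti.measurable.ennreal_toReal.pow_const _
  have hg0 : ∀ t, 0 ≤ (F t).toReal ^ (p - 1) := fun t => Real.rpow_nonneg ENNReal.toReal_nonneg _
  have hg1 : ∀ t, (F t).toReal ^ (p - 1) ≤ 1 := fun t =>
    Real.rpow_le_one ENNReal.toReal_nonneg
      (ENNReal.toReal_le_of_le_ofReal zero_le_one (by simpa using hF1 t)) hp1.le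
  have hloc : LocallyIntegrable fun t => dens D u t * (F t).toReal ^ (p - 1) := by
    refine hku.mono (hku.aestronglyMeasurable.mul hgm.aestronglyMeasurable)
      (Filter.Eventually.of_forall fun t => ?_)
    rw [norm_mul, Real.norm_of_nonneg (hg0 t)]
    exact mul_le_of_le_one_right (norm_nonneg _) (hg1 t)
  set P : ℝ → ℝ := fun x => ∫ t in 0..x, dens D u t * (F t).toReal ^ (p - 1) with hP
  have hPc : Continuous P := continuous_primitive_dens hloc
  have hP0 : ∀ x, 0 ≤ P x := by
    intro x
    rcases le_total 0 x with hx | hx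
    · exact intervalIntegral.integral_nonneg hx fun t _ => mul_nonneg (dens_nonneg _ _ _) (hg0 t)
    · exact (primitive_dens_eq_zero hx).ge
  set W : ℝ → ℝ := fun x => (c * P x) ^ (p - 1)⁻¹ with hW
  have hWc : Continuous W := (hPc.const_mul c).rpow_const fun _ => Or.inr (inv_nonneg.2 hp1.le)
  have hcP : ∀ x, 0 ≤ c * P x := fun x => mul_nonneg hc (hP0 x)
  have hW0 : ∀ x, 0 ≤ W x := fun x => Real.rpow_nonneg (hcP x) _
  have hlocW : LocallyIntegrable fun t => dens D (vhat v p) t * W t := hkv.mul_continuous hWc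
  have hflux : ∀ s, 0 ≤ s → flux (wm D u) p (ENNReal.ofReal c) F s = ENNReal.ofReal (W s) := by
    intro s hs
    rw [flux, hW, ← ENNReal.ofReal_rpow_of_nonneg (hcP s) (inv_nonneg.2 hp1.le),
      ENNReal.ofReal_mul hc, hP, ← setLIntegral_Iio_wm_eq_ofReal hku hs hgm hg0 hloc, head]
    congr 2
    refine lintegral_congr fun t => ?_
    rw [← ENNReal.ofReal_rpow_of_nonneg ENNReal.toReal_nonneg hp1.le, ENNReal.ofReal_toReal (hFt t)]
  set f : ℝ → ℝ := fun x => 1 - ∫ t in 0..x, dens D (vhat v p) t * W t with hf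
  -- Subtraction in $[0,\infty]$ truncates exactly as `ENNReal.ofReal` does; hence the flux built
  -- from `F` is that of `f`.
  have hfF : ∀ x, 0 ≤ x → ENNReal.ofReal (f x) = F x := by
    intro x hx
    rw [hF, hf, ENNReal.ofReal_sub _ (intervalIntegral.integral_nonneg hx fun t _ =>
      mul_nonneg (dens_nonneg _ _ _) (hW0 t)), ENNReal.ofReal_one, decrease,
      ← setLIntegral_Iio_wm_eq_ofReal hkv hx hWc.measurable hW0 hlocW, setLIntegral_Iio_wm hkv,
      setLIntegral_Iio_wm hkv]
    congr 1
    exact setLIntegral_congr_fun measurableSet_Ioo fun t ht => (hflux t ht.1.le).symm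
  have hPeq : ∀ x, 0 ≤ x → posPrim u p D f x = P x := by
    intro x hx
    refine intervalIntegral.integral_congr fun t ht => ?_
    rw [uIcc_of_le hx] at ht
    simp only [← hfF t ht.1, ENNReal.toReal_ofReal']
  refine ⟨f, continuous_const.sub (continuous_primitive_dens hlocW), fun x hx => ?_⟩
  change 1 - ∫ t in 0..x, dens D (vhat v p) t * W t = _
  congr 1
  refine intervalIntegral.integral_congr fun t ht => ?_
  rw [uIcc_of_le hx] at ht
  rw [posFlux, hPeq t ht.1]

namespace IsSolution

variable {c : ℝ} {f : ℝ → ℝ}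

lemma apply_zero (hf : IsSolution u v p D c f) : f 0 = 1 := by
  rw [hf.eq 0 le_rfl]
  simp

lemma locallyIntegrable (hf : IsSolution u v p D c f) (hp : 1 < p)
    (huv : IsWeightPair u v p D) :
    LocallyIntegrable fun t => dens D (vhat v p) t * posFlux u p D c f t :=
  huv.locallyIntegrable_vhat.mul_continuous (continuous_posFlux hp huv hf.cont)

lemma lintegral_posFlux (hf : IsSolution u v p D c f) (hp : 1 < p)
    (huv : IsWeightPair u v p D) (hc : 0 ≤ c) {a b : ℝ} (ha : 0 ≤ a) (hab : a ≤ b) :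
    ∫⁻ t in Ioo a b, ENNReal.ofReal (posFlux u p D c f t) ∂wm D (vhat v p)
      = ENNReal.ofReal (f a - f b) := by
  have hi := intervalIntegrable_of_locallyIntegrable (hf.locallyIntegrable hp huv)
  rw [setLIntegral_Ioo_wm huv.locallyIntegrable_vhat hab
    (continuous_posFlux hp huv hf.cont).measurable.aemeasurable
    (fun t _ => posFlux_nonneg hc f t) (hi _ _), hf.eq a ha, hf.eq b (ha.trans hab)]
  congr 1
  rw [← intervalIntegral.integral_interval_sub_left (hi 0 b) (hi 0 a)]
  ring

lemma le_of_le (hf : IsSolution u v p D c f) (hp : 1 < p) (huv : IsWeightPair u v p D)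
    (hc : 0 ≤ c) {a b : ℝ} (ha : 0 ≤ a) (hab : a ≤ b) : f b ≤ f a := by
  have hi := intervalIntegrable_of_locallyIntegrable (hf.locallyIntegrable hp huv)
  have h : 0 ≤ ∫ t in a..b, dens D (vhat v p) t * posFlux u p D c f t :=
    intervalIntegral.integral_nonneg hab fun t _ =>
      mul_nonneg (dens_nonneg _ _ _) (posFlux_nonneg hc f t)
  rw [← intervalIntegral.integral_interval_sub_left (hi 0 b) (hi 0 a)] at h
  rw [hf.eq a ha, hf.eq b (ha.trans hab)]
  linarith

lemma le_one (hf : IsSolution u v p D c f) (hp : 1 < p) (huv : IsWeightPair u v p D)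
    (hc : 0 ≤ c) {x : ℝ} (hx : 0 ≤ x) : f x ≤ 1 :=
  hf.apply_zero ▸ hf.le_of_le hp huv hc le_rfl hx

/-- Near the origin `f` is close to $f(0)=1$, and that neighbourhood already contributes. -/
lemma head_ne_zero (hf : IsSolution u v p D c f) (hp : 1 < p) (huv : IsWeightPair u v p D)
    {x : ℝ} (hx : x ∈ openDom D) : head (wm D u) p (fun t => ENNReal.ofReal (f t)) x ≠ 0 := by
  have hev : ∀ᶠ t in nhds 0, 0 < f t :=
    hf.cont.continuousAt.eventually (lt_mem_nhds (by rw [hf.apply_zero]; exact one_pos))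
  obtain ⟨δ, hδ, hball⟩ := Metric.eventually_nhds_iff.1 hev
  refine head_pos hp huv le_rfl (lt_min hδ hx.1) (min_le_right δ x)
    ((EReal.coe_le_coe_iff.2 (min_le_right δ x)).trans hx.2.le) hf.cont.continuousOn fun t ht => ?_
  refine hball ?_
  rw [Real.dist_eq, sub_zero, abs_of_pos ht.1]
  exact ht.2.trans_le (min_le_left _ _)

lemma posPrim_pos (hf : IsSolution u v p D c f) (hp : 1 < p) (huv : IsWeightPair u v p D)
    {x : ℝ} (hx : x ∈ openDom D) : 0 < posPrim u p D f x := by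
  have h := hf.head_ne_zero hp huv hx
  rwa [head_eq_ofReal_posPrim hp huv hf.cont hx.1.le, Ne, ENNReal.ofReal_eq_zero, not_le] at h

lemma posFlux_pos (hf : IsSolution u v p D c f) (hp : 1 < p) (huv : IsWeightPair u v p D)
    (hc : 0 < c) {x : ℝ} (hx : x ∈ openDom D) : 0 < posFlux u p D c f x :=
  Real.rpow_pos_of_pos (mul_pos hc (hf.posPrim_pos hp huv hx)) _

/-- The flux stays positive even after `f` has vanished, so `f` becomes strictly negative beyond an
interior zero. -/
lemma lt_of_lt (hf : IsSolution u v p D c f) (hp : 1 < p) (huv : IsWeightPair u v p D)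
    (hc : 0 < c) {a b : ℝ} (ha : 0 ≤ a) (hab : a < b) (hb : (b : EReal) ≤ D) : f b < f a := by
  have hsub := Ioo_subset_openDom' (D := D) ha hb
  have h := setLIntegral_wm_pos huv.locallyIntegrable_vhat huv.ae_vhat_pos hab hsub
    (continuous_posFlux (c := c) hp huv hf.cont).measurable.ennreal_ofReal
    fun t ht => by simpa using hf.posFlux_pos hp huv hc (hsub ht)
  rw [hf.lintegral_posFlux hp huv hc.le ha hab.le, ENNReal.ofReal_pos] at h
  linarith

/-- A solution is positive on `(0, D)`, or has a first zero there. -/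
lemma pos_or_first_zero (hf : IsSolution u v p D c f) (hp : 1 < p) (huv : IsWeightPair u v p D)
    (hc : 0 ≤ c) : (∀ x ∈ openDom D, 0 < f x) ∨
      ∃ x₁ ∈ openDom D, f x₁ = 0 ∧ ∀ x, 0 ≤ x → x < x₁ → 0 < f x := by
  by_cases h : ∀ x ∈ openDom D, 0 < f x
  · exact Or.inl h
  right
  push Not at h
  obtain ⟨y, hy, hfy⟩ := h
  have hIVT := intermediate_value_Icc' hy.1.le hf.cont.continuousOn
  obtain ⟨z, hz, hfz⟩ := hIVT ⟨hfy, by rw [hf.apply_zero]; exact zero_le_one⟩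
  set S : Set ℝ := Icc 0 y ∩ f ⁻¹' {0} with hS
  have hSc : IsCompact S := isCompact_Icc.inter_right (isClosed_singleton.preimage hf.cont)
  obtain ⟨x₁, hx₁, hmin⟩ := hSc.exists_isLeast ⟨z, hz, hfz⟩
  have hx₁0 : f x₁ = 0 := hx₁.2
  have hne : x₁ ≠ 0 := fun h0 => by
    rw [h0, hf.apply_zero] at hx₁0
    exact one_ne_zero hx₁0
  have hx₁pos : 0 < x₁ := lt_of_le_of_ne hx₁.1.1 hne.symm
  refine ⟨x₁, ⟨hx₁pos, (EReal.coe_le_coe_iff.2 hx₁.1.2).trans_lt hy.2⟩, hx₁0, fun x hx hxlt => ?_⟩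
  have hge : 0 ≤ f x := hx₁0 ▸ hf.le_of_le hp huv hc hx hxlt.le
  refine lt_of_le_of_ne hge fun h0 => ?_
  exact not_le.2 hxlt (hmin ⟨⟨hx, hxlt.le.trans hx₁.1.2⟩, h0.symm⟩)

lemma hasQuasiDerivOn (hf : IsSolution u v p D c f) (hp : 1 < p) (huv : IsWeightPair u v p D)
    {s : Set ℝ} (hs : IsOpen s) (hsD : s ⊆ openDom D) (hconn : OrdConnected s) :
    HasQuasiDerivOn v p f (fun x => -posFlux u p D c f x) s :=
  hasQuasiDerivOn_of_integral hp huv.v_pos (hf.locallyIntegrable hp huv) hs hsD hconn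
    (fun x hx => hf.eq x (hsD hx).1.le) (continuous_posFlux hp huv hf.cont).continuousOn

/-- The flux over $(x,b)$ integrates to $f(x)-f(b)<f(x)$; let $b$ tend to $D$. Equality can fail, as
`f` may keep a positive limit at $D$. -/
lemma tail_le (hf : IsSolution u v p D c f) (hp : 1 < p) (huv : IsWeightPair u v p D)
    (hc : 0 ≤ c) (hpos : ∀ x ∈ openDom D, 0 < f x) {x : ℝ} (hx : x ∈ openDom D) :
    tail (wm D (vhat v p)) (fun t => ENNReal.ofReal (posFlux u p D c f t)) x
      ≤ ENNReal.ofReal (f x) := by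
  rw [tail, setLIntegral_wm_inter huv.locallyIntegrable_vhat]
  refine (lintegral_mono_set (t := {s : ℝ | x < s ∧ (s : EReal) < D})
    fun t ht => ⟨ht.1, ht.2.2⟩).trans (setLIntegral_le_of_forall_Ioo fun b hxb hb => ?_)
  rw [hf.lintegral_posFlux hp huv hc hx.1.le hxb.le]
  exact ENNReal.ofReal_le_ofReal (by linarith [hpos b ⟨hx.1.trans hxb, hb⟩])

/-- The flux of a positive solution is a supersolution with constant `c`. Read contrapositively,
this forces interior zeros above $\lambda_p$. -/
lemma le_lambdaP (hf : IsSolution u v p D c f) (hp : 1 < p) (huv : IsWeightPair u v p D)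
    (hc : 0 < c) (hpos : ∀ x ∈ openDom D, 0 < f x) : ENNReal.ofReal c ≤ lambdaP u v p D := by
  refine le_lambdaP_of_super hp huv
    (W := fun t => ENNReal.ofReal (posFlux u p D c f t)) (g := fun t => ENNReal.ofReal (f t))
    (continuous_posFlux hp huv hf.cont).measurable.ennreal_ofReal (fun s hs => ⟨?_, by simp⟩)
    (fun x hx => hf.tail_le hp huv hc.le hpos hx) fun s hs => ?_
  · simpa using hf.posFlux_pos hp huv hc hs
  · rw [ofReal_posFlux_rpow hp huv hc.le hf.cont hs.1.le]

/-- At `c = λ_p` the solution has no zero in `(0, D)`. -/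
lemma pos_of_eq_lambdaP (hf : IsSolution u v p D c f) (hp : 1 < p) (huv : IsWeightPair u v p D)
    (hc : 0 < c) (hcl : ENNReal.ofReal c = lambdaP u v p D) : ∀ x ∈ openDom D, 0 < f x := by
  rcases hf.pos_or_first_zero hp huv hc.le with h | ⟨x₁, hx₁, hfx₁, hlt⟩
  · exact h
  exfalso
  have hp1 : 0 < p - 1 := by linarith
  -- The test function is the solution followed past its zero to $x_2$ and raised by
  -- $\kappa=-f(x_2)$, so that it vanishes at $x_2$.
  obtain ⟨x₂, hx₂, h12⟩ := exists_gt_mem_openDom hx₁.1.le hx₁.2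
  have hneg : f x₂ < 0 := hfx₁ ▸ hf.lt_of_lt hp huv hc hx₁.1.le h12 hx₂.2.le
  set κ := -f x₂ with hκ
  have hκ0 : 0 < κ := by linarith
  set W : ℝ → ℝ := (Ioo 0 x₂).indicator (posFlux u p D c f) with hW
  have hWmem : ∀ t ∈ Ioo 0 x₂, W t = posFlux u p D c f t := fun t ht => indicator_of_mem ht _
  have hoff : ∀ t ∉ Ioo 0 x₂, W t = 0 := fun t ht => indicator_of_notMem ht _
  have hfc := continuous_posFlux (c := c) hp huv hf.cont
  obtain ⟨M, hM⟩ := isCompact_Icc.exists_bound_of_continuousOn (s := Icc 0 x₂) hfc.continuousOn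
  have hM0 : 0 ≤ M := (norm_nonneg _).trans (hM 0 ⟨le_rfl, hx₂.1.le⟩)
  have htail : ∀ t ∈ openDom D, t < x₂ →
      ENNReal.ofReal (f t + κ) ≤ tail (wm D (vhat v p)) (fun s => ENNReal.ofReal (W s)) t := by
    intro t ht htx
    have h1 := hf.lintegral_posFlux hp huv hc.le ht.1.le htx.le
    rw [sub_eq_add_neg, ← hκ] at h1
    rw [← h1]
    calc ∫⁻ s in Ioo t x₂, ENNReal.ofReal (posFlux u p D c f s) ∂wm D (vhat v p)
        = ∫⁻ s in Ioo t x₂, ENNReal.ofReal (W s) ∂wm D (vhat v p) :=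
          setLIntegral_congr_fun measurableSet_Ioo fun s hs => by
            rw [hWmem s ⟨ht.1.trans hs.1, hs.2⟩]
      _ ≤ _ := lintegral_mono_set fun s hs => hs.1
  -- From $f\le1$ follows $f\le\theta(f+\kappa)$, so the raised function is a subsolution with
  -- constant $c\,\theta^{p-1}<c$.
  set θ : ℝ := (1 + κ)⁻¹ with hθ
  have hθ0 : 0 < θ := by positivity
  have hθ1 : θ < 1 := inv_lt_one_of_one_lt₀ (by linarith)
  have key := lambdaP_le_of_sub (u := u) (C := ENNReal.ofReal c * ENNReal.ofReal θ ^ (p - 1)) hp huv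
    isOpen_Ioo (hfc.continuousOn.congr hWmem)
    (indicator_nonneg fun t _ => posFlux_nonneg hc.le f t) hoff (R := x₂) (M := M)
    (fun t ht => ht.2) (fun t => by
      by_cases ht : t ∈ Ioo 0 x₂
      · rw [hWmem t ht]
        exact (le_abs_self _).trans (hM t (Ioo_subset_Icc_self ht))
      · rw [hoff t ht]; exact hM0) le_rfl hx₂.1 hx₂.2.le
    (fun t ht => by
      rw [hWmem t ht]
      exact hf.posFlux_pos hp huv hc (Ioo_subset_openDom hx₂.2.le ht)) (by
    rintro s ⟨hs, hsD⟩
    rw [hWmem s hs, ofReal_posFlux_rpow hp huv hc.le hf.cont hs.1.le, mul_assoc,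
      ← head_const_mul hp ENNReal.ofReal_ne_top]
    gcongr
    refine head_wm_le hp huv.locallyIntegrable_u fun t ht hts => ?_
    refine le_trans ?_ (mul_le_mul_right (htail t ht (hts.trans hs.2)) _)
    rw [← ENNReal.ofReal_mul hθ0.le]
    refine ENNReal.ofReal_le_ofReal ?_
    have h1 := hf.le_one hp huv hc.le ht.1.le
    rw [hθ, inv_mul_eq_div, le_div_iff₀ (by linarith)]
    nlinarith)
  rw [← hcl] at key
  have hlt1 : ENNReal.ofReal θ ^ (p - 1) < 1 := ENNReal.rpow_lt_one (by simpa using hθ1) hp1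
  have hc0 : ENNReal.ofReal c ≠ 0 := by simpa using hc
  have := ENNReal.mul_lt_mul_right hc0 ENNReal.ofReal_ne_top hlt1
  rw [mul_one] at this
  exact absurd key (not_le.2 this)

end IsSolution

end

end

/-! ### Inequalities for inverted quotients, and the formulas for $I$. -/

section

lemma le_inv_div {a b c : ℝ≥0∞} (hc0 : c ≠ 0) (hc : c ≠ ∞) (h : c * a ≤ b) : c ≤ (a / b)⁻¹ := by
  rw [ENNReal.le_inv_iff_le_inv]
  refine ENNReal.div_le_of_le_mul ?_
  calc a = c⁻¹ * (c * a) := by rw [← mul_assoc, ENNReal.inv_mul_cancel hc0 hc, one_mul]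
    _ ≤ c⁻¹ * b := by gcongr

lemma mul_le_of_le_inv_div {a b c : ℝ≥0∞} (hb0 : b ≠ 0) (hb : b ≠ ∞) (h : c ≤ (a / b)⁻¹) :
    c * a ≤ b := by
  rw [ENNReal.inv_div (Or.inl hb) (Or.inl hb0)] at h
  exact ENNReal.mul_le_of_le_div h

lemma le_mul_of_inv_div_le {a b c : ℝ≥0∞} (hb0 : b ≠ 0) (hb : b ≠ ∞) (hc : c ≠ ∞) (ha : a ≠ ∞)
    (h : (a / b)⁻¹ ≤ c) : b ≤ c * a := by
  rw [ENNReal.inv_div (Or.inl hb) (Or.inl hb0)] at h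
  exact (ENNReal.div_le_iff_le_mul (Or.inr hc) (Or.inl ha)).1 h

lemma inv_div_le {a b c : ℝ≥0∞} (hb0 : b ≠ 0) (hb : b ≠ ∞) (h : b ≤ c * a) : (a / b)⁻¹ ≤ c := by
  rw [ENNReal.inv_div (Or.inl hb) (Or.inl hb0)]
  exact ENNReal.div_le_of_le_mul h

section

variable {u v : ℝ → ℝ} {p : ℝ} {D : EReal}

lemma ofReal_abs_rpow_ne_zero {p a : ℝ} (h : a ≠ 0) : ENNReal.ofReal (|a| ^ p) ≠ 0 := by
  simpa using Real.rpow_pos_of_pos (abs_pos.2 h) p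

/-! ### Single integral forms -/

/-- With $c$ the infimum, $W=|w|$ satisfies $c\int_0^s f^{p-1}d\mu\le W^{p-1}$, and its tail is at
most `f` because `f` is positive up to $D$: a supersolution. -/
lemma iInf_opI_le (hp : 1 < p) (huv : IsWeightPair u v p D)
    {q : (ℝ → ℝ) × (ℝ → ℝ)} (hq : q ∈ FI v p D) :
    ⨅ x ∈ openDom D, (opI u p q.1 q.2 x)⁻¹ ≤ lambdaP u v p D := by
  obtain ⟨hfc, hqd, hpos, hneg⟩ := hq
  have hm := (isOpen_openDom D).measurableSet
  set W : ℝ → ℝ := (openDom D).indicator fun x => |q.2 x| with hW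
  have hWmem : ∀ x ∈ openDom D, W x = |q.2 x| := fun x hx => indicator_of_mem hx _
  have hWm : Measurable W := measurable_of_continuousOn_open (isOpen_openDom D)
    (hqd.2.1.abs.congr hWmem) fun x hx => indicator_of_notMem hx _
  refine le_lambdaP_of_super hp huv (W := fun x => ENNReal.ofReal (W x))
    (g := fun x => ENNReal.ofReal (q.1 x)) hWm.ennreal_ofReal (fun s hs => ⟨?_, by simp⟩)
    (fun x hx => ?_) fun s hs => ?_
  · rw [hWmem s hs]
    simpa using (hneg s hs).ne
  · rw [tail, setLIntegral_wm_inter huv.locallyIntegrable_vhat]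
    refine (lintegral_mono_set (t := {s : ℝ | x < s ∧ (s : EReal) < D})
      fun t ht => ⟨ht.1, ht.2.2⟩).trans (setLIntegral_le_of_forall_Ioo fun b hxb hb => ?_)
    have hbD : b ∈ openDom D := ⟨hx.1.trans hxb, hb⟩
    have hsub : Icc x b ⊆ openDom D := (ordConnected_openDom D).out hx hbD
    rw [setLIntegral_congr_fun measurableSet_Ioo fun t ht => by
      rw [hWmem t (hsub (Ioo_subset_Icc_self ht))],
      hqd.lintegral_eq hp huv.v_pos huv.locallyIntegrable_vhat subset_rfl
        (fun t ht => (hneg t ht).le) hxb.le hsub]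
    exact ENNReal.ofReal_le_ofReal (by linarith [hpos b hbD])
  · have hsub := Ioo_subset_openDom (D := D) hs.2.le
    have h : ⨅ x ∈ openDom D, (opI u p q.1 q.2 x)⁻¹ ≤ (opI u p q.1 q.2 s)⁻¹ := iInf₂_le s hs
    rw [opI, primitive_eq_head hp huv hs.2.le
      ((hfc.mono (openDom_subset_closedDom D)).mono hsub) fun t ht => (hpos t (hsub ht)).le] at h
    rw [hWmem s hs, ENNReal.ofReal_rpow_of_nonneg (abs_nonneg _) (by linarith)]
    exact mul_le_of_le_inv_div (ofReal_abs_rpow_ne_zero (hneg s hs).ne) (by simp) h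

/-- Now `f` reaches zero at $x_1$, so it is dominated by the tail of $|w|$, and $|w|$ is a
subsolution with the supremum as constant. -/
lemma lambdaP_le_iSup_opI (hp : 1 < p) (huv : IsWeightPair u v p D)
    {q : (ℝ → ℝ) × (ℝ → ℝ)} (hq : q ∈ FItilde v p D) :
    lambdaP u v p D ≤ ⨆ x ∈ openDom D, (opI u p q.1 q.2 x)⁻¹ := by
  obtain ⟨x₀, x₁, hx₀, hx₁, h01, hfc, hqd, hneg, hoff, hconst, hzero⟩ := hq
  set C := ⨆ x ∈ openDom D, (opI u p q.1 q.2 x)⁻¹ with hC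
  by_cases hCtop : C = ∞
  · rw [hCtop]; exact le_top
  have hp1 : 0 < p - 1 := by linarith
  have hsub : Ioo x₀ x₁ ⊆ openDom D := Ioo_subset_openDom' hx₀.1.le hx₁.2.le
  have hf1 : q.1 x₁ = 0 := hzero x₁ (openDom_subset_closedDom D hx₁) le_rfl
  set W : ℝ → ℝ := fun x => |q.2 x| with hW
  have hWoff : ∀ x ∉ Ioo x₀ x₁, W x = 0 := fun x hx => by simp [hW, hoff x hx]
  have hfc' : ContinuousOn q.1 (Icc 0 x₁) := by
    rw [← Icc_union_Icc_eq_Icc hx₀.1.le h01.le]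
    exact ContinuousOn.union_of_isClosed (continuousOn_const.congr hconst) hfc isClosed_Icc
      isClosed_Icc
  have hdiff : ∀ a b, x₀ < a → a ≤ b → b < x₁ →
      ENNReal.ofReal (q.1 a - q.1 b) ≤
        tail (wm D (vhat v p)) (fun s => ENNReal.ofReal (W s)) a := by
    intro a b ha hab hb
    rw [← hqd.lintegral_eq hp huv.v_pos huv.locallyIntegrable_vhat hsub
      (fun t ht => (hneg t ht).le) hab fun t ht => ⟨ha.trans_le ht.1, ht.2.trans_lt hb⟩]
    exact lintegral_mono_set fun t ht => ht.1
  have htail1 : ∀ x ∈ Ioo x₀ x₁, ENNReal.ofReal (q.1 x)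
      ≤ tail (wm D (vhat v p)) (fun s => ENNReal.ofReal (W s)) x := by
    intro x hx
    have hcont : Filter.Tendsto q.1 (nhdsWithin x₁ (Iio x₁)) (nhds 0) := by
      rw [← hf1]
      exact (hfc x₁ ⟨h01.le, le_rfl⟩).mono_of_mem_nhdsWithin (Icc_mem_nhdsLT h01)
    have hlim : Filter.Tendsto (fun b => ENNReal.ofReal (q.1 x - q.1 b))
        (nhdsWithin x₁ (Iio x₁)) (nhds (ENNReal.ofReal (q.1 x - 0))) :=
      ENNReal.tendsto_ofReal (tendsto_const_nhds.sub hcont)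
    rw [sub_zero] at hlim
    refine le_of_tendsto hlim ?_
    filter_upwards [Ioo_mem_nhdsLT hx.2] with b hb
    exact hdiff x b hx.1 hb.1.le hb.2
  have htail0 : ENNReal.ofReal (q.1 x₀)
      ≤ tail (wm D (vhat v p)) (fun s => ENNReal.ofReal (W s)) x₀ := by
    have hcont : Filter.Tendsto q.1 (nhdsWithin x₀ (Ioi x₀)) (nhds (q.1 x₀)) :=
      (hfc x₀ ⟨le_rfl, h01.le⟩).mono_of_mem_nhdsWithin (Icc_mem_nhdsGT h01)
    refine le_of_tendsto (ENNReal.tendsto_ofReal hcont) ?_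
    filter_upwards [Ioo_mem_nhdsGT h01] with x hx
    exact (htail1 x hx).trans (tail_antitone _ _ hx.1.le)
  have htail : ∀ x ∈ Ioo 0 x₁, ENNReal.ofReal (q.1 x)
      ≤ tail (wm D (vhat v p)) (fun s => ENNReal.ofReal (W s)) x := by
    intro x hx
    rcases le_or_gt x x₀ with h | h
    · rw [hconst x ⟨hx.1.le, h⟩]
      exact htail0.trans (tail_antitone _ _ h)
    · exact htail1 x ⟨h, hx.2⟩
  -- Nonnegativity is not part of the class; it follows from the decrease of `f` to $f(x_1)=0$.
  have hf0 : ∀ x ∈ Icc 0 x₁, 0 ≤ q.1 x := by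
    have hanti : ∀ x ∈ Ioo x₀ x₁, 0 ≤ q.1 x := by
      intro x hx
      have hcont : Filter.Tendsto q.1 (nhdsWithin x₁ (Iio x₁)) (nhds 0) := by
        rw [← hf1]
        exact (hfc x₁ ⟨h01.le, le_rfl⟩).mono_of_mem_nhdsWithin (Icc_mem_nhdsLT h01)
      refine le_of_tendsto hcont ?_
      filter_upwards [Ioo_mem_nhdsLT hx.2] with b hb
      have hsubI : uIcc x b ⊆ Ioo x₀ x₁ := by
        rw [uIcc_of_le hb.1.le]
        exact fun t ht => ⟨hx.1.trans_le ht.1, ht.2.trans_lt hb.2⟩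
      have h := hqd.sub_eq_integral hp huv.v_pos hsub hsubI
      have : 0 ≤ ∫ t in x..b, -(dens D (vhat v p) t * q.2 t) := by
        refine intervalIntegral.integral_nonneg hb.1.le fun t ht => ?_
        have h1 := hneg t (hsubI (by rwa [uIcc_of_le hb.1.le]))
        have h2 := dens_nonneg D (vhat v p) t
        nlinarith
      rw [intervalIntegral.integral_neg] at this
      linarith
    have hx₀0 : 0 ≤ q.1 x₀ := by
      have hcont : Filter.Tendsto q.1 (nhdsWithin x₀ (Ioi x₀)) (nhds (q.1 x₀)) :=
        (hfc x₀ ⟨le_rfl, h01.le⟩).mono_of_mem_nhdsWithin (Icc_mem_nhdsGT h01)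
      refine ge_of_tendsto hcont ?_
      filter_upwards [Ioo_mem_nhdsGT h01] with x hx
      exact hanti x hx
    intro x hx
    rcases le_or_gt x x₀ with h | h
    · rwa [hconst x ⟨hx.1, h⟩]
    · rcases hx.2.eq_or_lt with rfl | h'
      · exact hf1.ge
      · exact hanti x ⟨h, h'⟩
  obtain ⟨B, hB⟩ := isCompact_Icc.exists_bound_of_continuousOn hfc'
  have hprim : ∀ s ∈ Ioo x₀ x₁, primitive u p q.1 s
      = head (wm D u) p (fun t => ENNReal.ofReal (q.1 t)) s := by
    intro s hs
    have hsub' : Ioo 0 s ⊆ Icc 0 x₁ := fun t ht => ⟨ht.1.le, (ht.2.trans hs.2).le⟩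
    exact primitive_eq_head hp huv (hsub hs).2.le (hfc'.mono hsub') fun t ht => hf0 t (hsub' ht)
  have hheadtop : ∀ s, s ≤ x₁ → head (wm D u) p (fun t => ENNReal.ofReal (q.1 t)) s ≠ ∞ :=
    fun s hs => head_ne_top_of_le hp huv.locallyIntegrable_u (M := ENNReal.ofReal B) (by simp)
      fun t ht hts => ENNReal.ofReal_le_ofReal
        ((le_abs_self _).trans (hB t ⟨ht.1.le, hts.le.trans hs⟩))
  have hmain : ∀ s ∈ Ioo x₀ x₁, ENNReal.ofReal (W s) ^ (p - 1)
      ≤ C * head (wm D u) p (fun t => ENNReal.ofReal (q.1 t)) s := by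
    intro s hs
    have h : (opI u p q.1 q.2 s)⁻¹ ≤ C := le_iSup₂_of_le s (hsub hs) le_rfl
    rw [opI, hprim s hs] at h
    rw [hW, ENNReal.ofReal_rpow_of_nonneg (abs_nonneg _) hp1.le]
    exact le_mul_of_inv_div_le (ofReal_abs_rpow_ne_zero (hneg s hs).ne) (by simp) hCtop
      (hheadtop s hs.2.le) h
  -- The quasi-derivative is continuous only on the open interval. Finiteness of the supremum gives
  -- $|w|^{p-1}\le K$, which supplies its boundedness.
  set K := C * head (wm D u) p (fun t => ENNReal.ofReal (q.1 t)) x₁ with hK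
  have hKtop : K ≠ ∞ := ENNReal.mul_ne_top hCtop (hheadtop x₁ le_rfl)
  refine lambdaP_le_of_sub hp huv isOpen_Ioo hqd.2.1.abs (fun x => abs_nonneg _) hWoff
    (R := x₁) (M := (K ^ (p - 1)⁻¹).toReal) (fun t ht => ht.2) (fun x => ?_) hx₀.1.le h01 hx₁.2.le
    (fun t ht => abs_pos.2 (hneg t ht).ne) fun s hs => ?_
  · by_cases hx : x ∈ Ioo x₀ x₁
    · rw [← ENNReal.ofReal_le_iff_le_toReal
        (ENNReal.rpow_ne_top_of_nonneg (inv_nonneg.2 hp1.le) hKtop)]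
      rw [ENNReal.le_rpow_inv_iff hp1]
      refine (hmain x hx).trans ?_
      rw [hK]
      gcongr
      exact head_monotone _ _ _ hx.2.le
    · rw [show |q.2 x| = 0 from hWoff x hx]
      exact ENNReal.toReal_nonneg
  · refine (hmain s hs.1).trans ?_
    gcongr
    exact head_wm_le hp huv.locallyIntegrable_u fun t ht hts => htail t ⟨ht.1, hts.trans hs.1.2⟩

/-- Freezing a solution with a zero near the origin gives a member of `F̃_I`. -/
lemma IsSolution.exists_FItilde {c : ℝ} {f : ℝ → ℝ} (hf : IsSolution u v p D c f) (hp : 1 < p)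
    (huv : IsWeightPair u v p D) (hc : 0 < c) {x₀ x₁ : ℝ} (hx₁ : x₁ ∈ openDom D) (hfx₁ : f x₁ = 0)
    (hpos : ∀ x, 0 ≤ x → x < x₁ → 0 < f x) (hx₀ : 0 < x₀) (h01 : x₀ < x₁) :
    ∃ q ∈ FItilde v p D, ⨆ x ∈ openDom D, (opI u p q.1 q.2 x)⁻¹
      ≤ ENNReal.ofReal c * ENNReal.ofReal (f x₀)⁻¹ ^ (p - 1) := by
  have hp1 : 0 < p - 1 := by linarith
  have hx₀D : x₀ ∈ openDom D := mem_openDom_of_lt hx₀ h01.le hx₁.2.le (Or.inl h01)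
  have hsub : Ioo x₀ x₁ ⊆ openDom D := Ioo_subset_openDom' hx₀.le hx₁.2.le
  set g : ℝ → ℝ := fun x => max (f (max x x₀)) 0 with hg
  set w : ℝ → ℝ := (Ioo x₀ x₁).indicator fun x => -posFlux u p D c f x with hw
  have hgc : Continuous g := (hf.cont.comp (continuous_id.max continuous_const)).max
    continuous_const
  have hg0 : ∀ x, 0 ≤ g x := fun x => le_max_right _ _
  have hgeq : ∀ x, x₀ ≤ x → x < x₁ → g x = f x := fun x h h' => by
    rw [hg]
    simp only [max_eq_left h, max_eq_left (hpos x (hx₀.le.trans h) h').le]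
  have hgconst : ∀ x ≤ x₀, g x = f x₀ := fun x h => by
    rw [hg]
    simp only [max_eq_right h, max_eq_left (hpos x₀ hx₀.le h01).le]
  have hfx₀ := hpos x₀ hx₀.le h01
  have hqd : HasQuasiDerivOn v p g w (Ioo x₀ x₁) := by
    have h := hasQuasiDerivOn_of_integral hp huv.v_pos (hf.locallyIntegrable hp huv)
      (isOpen_Ioo (a := x₀) (b := x₁)) hsub ordConnected_Ioo (f := g) (c := 1)
      (fun x hx => by rw [hgeq x hx.1.le hx.2, hf.eq x (hsub hx).1.le])
      (continuous_posFlux hp huv hf.cont).continuousOn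
    refine ⟨h.1, h.2.1.congr fun x hx => indicator_of_mem hx _, ?_⟩
    filter_upwards [h.2.2] with x hx hxs
    rw [hx hxs, hw, indicator_of_mem hxs]
  have hprim : ∀ x ∈ openDom D, primitive u p g x
      = head (wm D u) p (fun t => ENNReal.ofReal (g t)) x := fun x hx =>
    primitive_eq_head hp huv hx.2.le hgc.continuousOn fun t _ => hg0 t
  have hgx₀ : g x₀ = f x₀ := hgconst x₀ le_rfl
  refine ⟨(g, w), ⟨x₀, x₁, hx₀D, hx₁, h01, hgc.continuousOn, hqd, fun x hx => ?_, fun x hx => ?_,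
    fun x hx => ?_, fun x hx hx1 => ?_⟩, iSup₂_le fun x hx => ?_⟩
  · rw [hw]
    simp only [indicator_of_mem hx]
    linarith [hf.posFlux_pos hp huv hc (hsub hx)]
  · change w x = 0
    exact indicator_of_notMem hx _
  · change g x = g x₀
    rw [hgconst x hx.2, hgx₀]
  · have hle := hf.le_of_le hp huv hc.le hx₁.1.le (hx1.trans (le_max_left x x₀))
    rw [hg]
    exact max_eq_right (hle.trans hfx₁.le)
  · by_cases hxI : x ∈ Ioo x₀ x₁
    · rw [opI, hprim x hx]
      have hwx : |w x| = posFlux u p D c f x := by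
        rw [hw, indicator_of_mem hxI, abs_neg, abs_of_nonneg (posFlux_nonneg hc.le f x)]
      have hfl := hf.posFlux_pos hp huv hc hx
      rw [hwx]
      refine inv_div_le ?_ (by simp) ?_
      · simpa using Real.rpow_pos_of_pos hfl _
      · rw [← ENNReal.ofReal_rpow_of_nonneg hfl.le hp1.le,
          ofReal_posFlux_rpow hp huv hc.le hf.cont hx.1.le, mul_assoc,
          ← head_const_mul hp ENNReal.ofReal_ne_top]
        gcongr
        -- The bound is $f\le f(x_0)^{-1}g$: to the left of $x_0$ because $f\le1$, to the right
        -- because $f(x_0)\le1$.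
        refine head_wm_le hp huv.locallyIntegrable_u fun t ht htx => ?_
        rw [← ENNReal.ofReal_mul (by positivity)]
        refine ENNReal.ofReal_le_ofReal ?_
        rw [inv_mul_eq_div, le_div_iff₀ hfx₀]
        have h1 := hf.le_one hp huv hc.le ht.1.le
        have h2 := hf.le_one hp huv hc.le hx₀.le
        have h3 := hpos t ht.1.le (htx.trans hxI.2)
        rcases le_or_gt t x₀ with h | h
        · rw [hgconst t h]
          nlinarith
        · rw [hgeq t h.le (htx.trans hxI.2)]
          nlinarith
    -- Where the derivative vanishes the numerator is positive, so $I=\infty$ and such points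
    -- contribute zero.
    · have hw0 : w x = 0 := indicator_of_notMem hxI _
      have hne : primitive u p g x ≠ 0 := by
        rw [hprim x hx]
        refine head_pos hp huv le_rfl (lt_min hx₀ hx.1) (min_le_right x₀ x)
          ((EReal.coe_le_coe_iff.2 (min_le_right x₀ x)).trans hx.2.le) hgc.continuousOn
          fun t ht => ?_
        rw [hgconst t (ht.2.le.trans (min_le_left _ _))]
        exact hfx₀
      simp [opI, hw0, Real.zero_rpow hp1.ne', ENNReal.div_zero hne]

/-- Above `λ_p` solutions vanish inside `(0, D)`. -/
lemma exists_solution_with_zero (hp : 1 < p) (huv : IsWeightPair u v p D) {c : ℝ}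
    (hc : lambdaP u v p D < ENNReal.ofReal c) : ∃ f, IsSolution u v p D c f ∧
      ∃ x₁ ∈ openDom D, f x₁ = 0 ∧ ∀ x, 0 ≤ x → x < x₁ → 0 < f x := by
  have hc0 : 0 < c := ENNReal.ofReal_pos.1 (bot_le.trans_lt hc)
  obtain ⟨f, hf⟩ := exists_isSolution hp huv hc0.le
  refine ⟨f, hf, (hf.pos_or_first_zero hp huv hc0.le).resolve_left fun h => ?_⟩
  exact absurd (hf.le_lambdaP hp huv hc0 h) (not_le.2 hc)

/-- Only finite real constants need testing, which is what the initial value problem accepts. -/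
lemma le_of_forall_lt_ofReal {a b : ℝ≥0∞}
    (h : ∀ c : ℝ, b < ENNReal.ofReal c → a ≤ ENNReal.ofReal c) : a ≤ b := by
  refine le_of_forall_gt_imp_ge_of_dense fun d hd => ?_
  obtain ⟨c, h1, h2⟩ := exists_between hd
  have hc : ENNReal.ofReal c.toReal = c := ENNReal.ofReal_toReal (ne_top_of_lt h2)
  have := h c.toReal (by rwa [hc])
  rw [hc] at this
  exact this.trans h2.le

lemma iInf_FItilde_le (hp : 1 < p) (huv : IsWeightPair u v p D) :
    ⨅ q ∈ FItilde v p D, ⨆ x ∈ openDom D, (opI u p q.1 q.2 x)⁻¹ ≤ lambdaP u v p D := by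
  refine le_of_forall_lt_ofReal fun c hc => ?_
  have hc0 : 0 < c := ENNReal.ofReal_pos.1 (bot_le.trans_lt hc)
  obtain ⟨f, hf, x₁, hx₁, hfx₁, hpos⟩ := exists_solution_with_zero hp huv hc
  -- Freezing on $[0,x_0]$ costs the factor $f(x_0)^{-(p-1)}$, which tends to one as $x_0\to0$.
  have hlim : Filter.Tendsto (fun x₀ => ENNReal.ofReal c * ENNReal.ofReal (f x₀)⁻¹ ^ (p - 1))
      (nhdsWithin 0 (Ioi 0)) (nhds (ENNReal.ofReal c * ENNReal.ofReal 1⁻¹ ^ (p - 1))) := by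
    refine ENNReal.Tendsto.const_mul ?_ (Or.inr ENNReal.ofReal_ne_top)
    refine (ENNReal.continuous_rpow_const.tendsto _).comp (ENNReal.tendsto_ofReal ?_)
    refine Filter.Tendsto.inv₀ ?_ one_ne_zero
    rw [← hf.apply_zero]
    exact hf.cont.continuousAt.mono_left nhdsWithin_le_nhds
  simp only [inv_one, ENNReal.ofReal_one, ENNReal.one_rpow, mul_one] at hlim
  refine ge_of_tendsto hlim ?_
  filter_upwards [Ioo_mem_nhdsGT hx₁.1] with x₀ hx₀
  obtain ⟨q, hq, hle⟩ := hf.exists_FItilde hp huv hc0 hx₁ hfx₁ hpos hx₀.1 hx₀.2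
  exact (iInf₂_le q hq).trans hle

lemma IsSolution.mem_FI {c : ℝ} {f : ℝ → ℝ} (hf : IsSolution u v p D c f) (hp : 1 < p)
    (huv : IsWeightPair u v p D) (hc : 0 < c) (hpos : ∀ x ∈ openDom D, 0 < f x) :
    (f, fun x => -posFlux u p D c f x) ∈ FI v p D :=
  ⟨hf.cont.continuousOn,
    hf.hasQuasiDerivOn hp huv (isOpen_openDom D) subset_rfl (ordConnected_openDom D), hpos,
    fun x hx => by
      have := hf.posFlux_pos hp huv hc hx
      simpa using this⟩

lemma IsSolution.le_iInf_opI {c : ℝ} {f : ℝ → ℝ} (hf : IsSolution u v p D c f) (hp : 1 < p)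
    (huv : IsWeightPair u v p D) (hc : 0 < c) (hpos : ∀ x ∈ openDom D, 0 < f x) :
    ENNReal.ofReal c ≤ ⨅ x ∈ openDom D, (opI u p f (fun x => -posFlux u p D c f x) x)⁻¹ := by
  refine le_iInf₂ fun x hx => le_inv_div (by simpa using hc) (by simp) ?_
  rw [primitive_eq_head hp huv hx.2.le hf.cont.continuousOn fun t ht =>
    (hpos t (Ioo_subset_openDom hx.2.le ht)).le, abs_neg,
    abs_of_nonneg (posFlux_nonneg hc.le f x),
    ← ENNReal.ofReal_rpow_of_nonneg (posFlux_nonneg hc.le f x) (by linarith),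
    ofReal_posFlux_rpow hp huv hc.le hf.cont hx.1.le]

/-- `exp (-∫_0^x v̂)` belongs to `F_I`. -/
lemma FI_nonempty (hp : 1 < p) (huv : IsWeightPair u v p D) : (FI v p D).Nonempty := by
  have hk := huv.locallyIntegrable_vhat
  set V : ℝ → ℝ := fun x => ∫ t in 0..x, dens D (vhat v p) t with hV
  have hVc : Continuous V := intervalIntegral.continuous_primitive
    (fun a b => intervalIntegrable_of_locallyIntegrable hk a b) 0
  have hV0 : ∀ x, 0 ≤ x → 0 ≤ V x := fun x hx =>
    intervalIntegral.integral_nonneg hx fun t _ => dens_nonneg _ _ t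
  refine ⟨(fun x => Real.exp (-V x), fun x => -Real.exp (-V x)), by fun_prop, ⟨fun a ha b hb => ?_,
    by fun_prop, ?_⟩, fun x _ => Real.exp_pos _, fun x _ => by simpa using Real.exp_pos _⟩
  · refine absolutelyContinuousOnInterval_of_dist_le
      (absolutelyContinuousOnInterval_primitive hk 0 a b) fun x hx y hy => ?_
    -- The map $s\mapsto e^{-s}$ is 1-Lipschitz on $[0,\infty)$, so absolute continuity passes from
    -- the primitive of $\hat v$.
    have key : ∀ s t, 0 ≤ s → 0 ≤ t → Real.exp (-s) - Real.exp (-t) ≤ |s - t| := by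
      intro s t hs ht
      rcases le_total s t with h | h
      · have h1 : Real.exp (-t) = Real.exp (-s) * Real.exp (-(t - s)) := by
          rw [← Real.exp_add]; ring_nf
        have h2 := Real.add_one_le_exp (-(t - s))
        have h3 : Real.exp (-s) ≤ 1 := Real.exp_le_one_iff.2 (by linarith)
        have h4 := Real.exp_pos (-s)
        rw [h1, abs_of_nonpos (by linarith)]
        nlinarith
      · have : Real.exp (-s) ≤ Real.exp (-t) := Real.exp_le_exp.2 (by linarith)
        linarith [abs_nonneg (s - t)]
    have hx0 := hV0 x (((ordConnected_openDom D).uIcc_subset ha hb hx).1.le)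
    have hy0 := hV0 y (((ordConnected_openDom D).uIcc_subset ha hb hy).1.le)
    change |Real.exp (-V x) - Real.exp (-V y)| ≤ |V x - V y|
    rw [abs_le]
    have h1 := key _ _ hx0 hy0
    have h2 := key _ _ hy0 hx0
    rw [abs_sub_comm] at h2
    constructor <;> linarith
  · filter_upwards [LocallyIntegrable.ae_hasDerivAt_integral hk, huv.v_pos] with x hx hvx hxs
    have hvx := hvx hxs
    have h1 : HasDerivAt (fun x => Real.exp (-V x)) _ x := (hx 0).neg.exp
    rw [h1.deriv, dens_of_pos hxs (vhat_pos hvx), vhat_eq hp, conj_sub_one hp]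
    have h2 : v x ^ (p - 1)⁻¹ * v x ^ (-(p - 1)⁻¹) = 1 := by
      rw [← Real.rpow_add hvx]; simp
    change _ * (Real.exp (-V x) * _) = _
    linear_combination (-Real.exp (-V x)) * h2

end

end

section

section

variable {u v : ℝ → ℝ} {p : ℝ} {D : EReal}

/-! ### Double integral forms -/

/-- The double integral in `II(f)` as a tail integral. -/
lemma opII_eq (hp : 1 < p) (huv : IsWeightPair u v p D) {f : ℝ → ℝ}
    (hf : ContinuousOn f (openDom D)) (h0 : ∀ t ∈ openDom D, 0 ≤ f t) {x : ℝ} (hx : 0 ≤ x) :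
    opII u v p D f x = tail (wm D (vhat v p)) ((openDom D ∩ Function.support f).indicator
        fun s => head (wm D u) p (fun t => ENNReal.ofReal (f t)) s ^ (p - 1)⁻¹) x ^ (p - 1) /
      ENNReal.ofReal (f x ^ (p - 1)) := by
  have hU : IsOpen (openDom D ∩ Function.support f) :=
    hf.isOpen_inter_preimage (isOpen_openDom D) isOpen_ne
  have hset : {s : ℝ | x < s ∧ (s : EReal) < D} ∩ Function.support f
      = Ioi x ∩ (openDom D ∩ Function.support f) := by
    ext s
    exact ⟨fun h => ⟨h.1.1, ⟨hx.trans_lt h.1.1, h.1.2⟩, h.2⟩, fun h => ⟨⟨h.1, h.2.1.2⟩, h.2.2⟩⟩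
  have hm : Measurable ((openDom D ∩ Function.support f).indicator
      fun s => head (wm D u) p (fun t => ENNReal.ofReal (f t)) s ^ (p - 1)⁻¹) :=
    ((measurable_head _ _ _).pow_const _).indicator hU.measurableSet
  rw [opII, hset]
  congr 2
  rw [tail, setLIntegral_wm huv.locallyIntegrable_vhat measurableSet_Ioi hm.aemeasurable,
    ← lintegral_indicator (measurableSet_Ioi.inter hU.measurableSet),
    ← lintegral_indicator measurableSet_Ioi]
  refine lintegral_congr_ae ?_
  filter_upwards [huv.ae_vhat_pos] with s hs
  by_cases hsx : s ∈ Ioi x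
  · by_cases hsU : s ∈ openDom D ∩ Function.support f
    · rw [indicator_of_mem (show s ∈ Ioi x ∩ _ from ⟨hsx, hsU⟩), indicator_of_mem hsx,
        indicator_of_mem hsU, dens_of_pos hsU.1 (hs hsU.1), conj_sub_one hp,
        primitive_eq_head hp huv hsU.1.2.le (hf.mono (Ioo_subset_openDom hsU.1.2.le))
          fun t ht => h0 t (Ioo_subset_openDom hsU.1.2.le ht)]
    · rw [indicator_of_notMem (fun h => hsU h.2), indicator_of_mem hsx, indicator_of_notMem hsU,
        mul_zero]
  · rw [indicator_of_notMem (fun h => hsx h.1), indicator_of_notMem hsx]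

lemma rpow_mul_rpow_inv {p : ℝ} (hp : 1 < p) (c a : ℝ≥0∞) :
    (c ^ (p - 1)⁻¹ * a) ^ (p - 1) = c * a ^ (p - 1) := by
  rw [ENNReal.mul_rpow_of_nonneg _ _ (by linarith), ← ENNReal.rpow_mul,
    inv_mul_cancel₀ (by linarith), ENNReal.rpow_one]

lemma tail_const_mul {ν : Measure ℝ} {c : ℝ≥0∞} (hc : c ≠ ∞) (W : ℝ → ℝ≥0∞) (x : ℝ) :
    tail ν (fun s => c * W s) x = c * tail ν W x := lintegral_const_mul' _ _ hc

/-- Choose $W^{p-1}=c'\int_0^s f^{p-1}d\mu$, so the flux inequality is an equality; the bound on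
$I\!I$ says precisely that the tail of `W` is at most `f`. -/
lemma iInf_opII_le (hp : 1 < p) (huv : IsWeightPair u v p D) {f : ℝ → ℝ} (hf : f ∈ FII D) :
    ⨅ x ∈ openDom D, (opII u v p D f x)⁻¹ ≤ lambdaP u v p D := by
  obtain ⟨hfc, hpos⟩ := hf
  have hp1 : 0 < p - 1 := by linarith
  have hfo := hfc.mono (openDom_subset_closedDom D)
  set H := head (wm D u) p (fun t => ENNReal.ofReal (f t)) with hH
  have hHpos : ∀ s ∈ openDom D, H s ≠ 0 := fun s hs =>
    head_pos hp huv le_rfl hs.1 le_rfl hs.2.le (hfo.mono (Ioo_subset_openDom hs.2.le))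
      fun t ht => hpos t (Ioo_subset_openDom hs.2.le ht)
  have hHtop : ∀ s ∈ openDom D, H s ≠ ∞ := by
    intro s hs
    have hsub : Icc 0 s ⊆ closedDom D := fun t ht =>
      ⟨ht.1, (EReal.coe_le_coe_iff.2 ht.2).trans hs.2.le⟩
    obtain ⟨B, hB⟩ := isCompact_Icc.exists_bound_of_continuousOn (hfc.mono hsub)
    exact head_ne_top_of_le hp huv.locallyIntegrable_u (M := ENNReal.ofReal B) (by simp)
      fun t ht hts => ENNReal.ofReal_le_ofReal ((le_abs_self _).trans (hB t ⟨ht.1.le, hts.le⟩))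
  refine le_of_forall_lt fun c hc => ?_
  -- A constant strictly below the infimum and above `c` is finite and nonzero, as a supersolution
  -- with values in $(0,\infty)$ requires.
  obtain ⟨c', hcc', hc'⟩ := exists_between hc
  refine hcc'.trans_le ?_
  have hc'0 : c' ≠ 0 := (bot_le.trans_lt hcc').ne'
  have hc'top : c' ≠ ∞ := ne_top_of_lt hc'
  have hr : 0 < (p - 1)⁻¹ := inv_pos.2 hp1
  have hcr : c' ^ (p - 1)⁻¹ ≠ ∞ := ENNReal.rpow_ne_top_of_nonneg hr.le hc'top
  refine le_lambdaP_of_super hp huv (W := fun s => c' ^ (p - 1)⁻¹ * H s ^ (p - 1)⁻¹)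
    (g := fun t => ENNReal.ofReal (f t)) (((measurable_head _ _ _).pow_const _).const_mul _)
    (fun s hs => ⟨?_, ?_⟩) (fun x hx => ?_) fun s hs => ?_
  · exact mul_ne_zero (ENNReal.rpow_pos (pos_iff_ne_zero.2 hc'0) hc'top).ne'
      (ENNReal.rpow_pos (pos_iff_ne_zero.2 (hHpos s hs)) (hHtop s hs)).ne'
  · exact ENNReal.mul_ne_top hcr (ENNReal.rpow_ne_top_of_nonneg hr.le (hHtop s hs))
  · have h : c' ≤ (opII u v p D f x)⁻¹ := hc'.le.trans (iInf₂_le x hx)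
    rw [opII_eq hp huv hfo (fun t ht => (hpos t ht).le) hx.1.le] at h
    have hfx := hpos x hx
    have h2 := mul_le_of_le_inv_div (by simpa using Real.rpow_pos_of_pos hfx _) (by simp) h
    rw [← rpow_mul_rpow_inv hp, ← ENNReal.ofReal_rpow_of_nonneg hfx.le hp1.le,
      ENNReal.rpow_le_rpow_iff hp1] at h2
    refine le_trans (le_of_eq ?_) h2
    rw [tail_const_mul hcr]
    congr 1
    refine lintegral_congr_ae (ae_restrict_of_ae ?_)
    filter_upwards [ae_wm_mem huv.locallyIntegrable_vhat] with s hs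
    rw [indicator_of_mem (show s ∈ openDom D ∩ Function.support f from ⟨hs, (hpos s hs).ne'⟩)]
  · rw [rpow_mul_rpow_inv hp, ← ENNReal.rpow_mul, inv_mul_cancel₀ hp1.ne', ENNReal.rpow_one]

/-- Take $W^{p-1}=\int_0^s f^{p-1}d\mu$ on the support of `f`. The bound on $I\!I$ controls
$f^{p-1}$ by $C$ times the power $p-1$ of the tail of `W`; integrating it makes `W` a subsolution.
-/
lemma lambdaP_le_iSup_opII (hp : 1 < p) (huv : IsWeightPair u v p D) {f : ℝ → ℝ}
    (hf : f ∈ FIItilde D) :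
    lambdaP u v p D ≤ ⨆ x ∈ closedDom D ∩ Function.support f, (opII u v p D f x)⁻¹ := by
  obtain ⟨x₀, hx₀, hfc, hzero, hnn, y, hyD, hfy⟩ := hf
  set C := ⨆ x ∈ closedDom D ∩ Function.support f, (opII u v p D f x)⁻¹ with hC
  by_cases hCtop : C = ∞
  · rw [hCtop]; exact le_top
  have hp1 : 0 < p - 1 := by linarith
  have hr : 0 < (p - 1)⁻¹ := inv_pos.2 hp1
  -- Clamping the argument yields a function continuous on the whole line that agrees with `f` on
  -- $[0,D]$.
  set g : ℝ → ℝ := fun x => f (max 0 (min x₀ x)) with hg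
  have hmapsto : ∀ x, max 0 (min x₀ x) ∈ Icc 0 x₀ := fun x =>
    ⟨le_max_left _ _, max_le hx₀.1.le (min_le_left _ _)⟩
  have hgc : Continuous g := hfc.comp_continuous
    (continuous_const.max (continuous_const.min continuous_id)) hmapsto
  have hgf : ∀ x ∈ closedDom D, g x = f x := by
    intro x hx
    rcases le_total x₀ x with h | h
    · rw [hzero x hx h, hg]
      simp only [min_eq_left h, max_eq_right hx₀.1.le]
      exact hzero x₀ (openDom_subset_closedDom D hx₀) le_rfl
    · rw [hg]
      simp only [min_eq_right h, max_eq_right hx.1]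
  have hgf' : ∀ x ∈ openDom D, g x = f x := fun x hx => hgf x (openDom_subset_closedDom D hx)
  have hfo : ContinuousOn f (openDom D) := hgc.continuousOn.congr fun x hx => (hgf' x hx).symm
  set U := openDom D ∩ Function.support f with hUdef
  have hU : IsOpen U := hfo.isOpen_inter_preimage (isOpen_openDom D) isOpen_ne
  have hUlt : ∀ x ∈ U, x < x₀ := fun x hx => by
    by_contra h
    exact hx.2 (hzero x (openDom_subset_closedDom D hx.1) (not_lt.1 h))
  set W : ℝ → ℝ := U.indicator (posFlux u p D 1 g) with hW
  have hWmem : ∀ t ∈ U, W t = posFlux u p D 1 g t := fun t ht => indicator_of_mem ht _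
  have hoff : ∀ t ∉ U, W t = 0 := fun t ht => indicator_of_notMem ht _
  have hfl := continuous_posFlux (c := 1) hp huv hgc
  obtain ⟨M, hM⟩ := isCompact_Icc.exists_bound_of_continuousOn (s := Icc 0 x₀) hfl.continuousOn
  have hM0 : 0 ≤ M := (norm_nonneg _).trans (hM 0 ⟨le_rfl, hx₀.1.le⟩)
  have hheadeq : ∀ s, head (wm D u) p (fun t => ENNReal.ofReal (g t)) s
      = head (wm D u) p (fun t => ENNReal.ofReal (f t)) s := fun s =>
    head_wm_congr hp huv.locallyIntegrable_u fun t ht _ => by rw [hgf' t ht]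
  have hWr : ∀ s ∈ U, ENNReal.ofReal (W s) ^ (p - 1)
      = head (wm D u) p (fun t => ENNReal.ofReal (f t)) s := by
    intro s hs
    rw [hWmem s hs, ofReal_posFlux_rpow hp huv zero_le_one hgc hs.1.1.le, ENNReal.ofReal_one,
      one_mul, hheadeq]
  have hWE : (fun s => ENNReal.ofReal (W s)) = U.indicator
      fun s => head (wm D u) p (fun t => ENNReal.ofReal (f t)) s ^ (p - 1)⁻¹ := by
    ext s
    by_cases hs : s ∈ U
    · rw [indicator_of_mem hs, ← hWr s hs, ← ENNReal.rpow_mul, mul_inv_cancel₀ hp1.ne',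
        ENNReal.rpow_one]
    · rw [indicator_of_notMem hs, hoff s hs, ENNReal.ofReal_zero]
  have hWM : ∀ t, W t ≤ M := fun t => by
    by_cases ht : t ∈ U
    · rw [hWmem t ht]
      exact (le_abs_self _).trans (hM t ⟨ht.1.1.le, (hUlt t ht).le⟩)
    · rw [hoff t ht]; exact hM0
  have htailtop : ∀ x, tail (wm D (vhat v p)) (fun s => ENNReal.ofReal (W s)) x ≠ ∞ :=
    tail_ne_top huv.locallyIntegrable_vhat
      (fun t ht => by rw [hoff t fun h => not_lt.2 ht (hUlt t h), ENNReal.ofReal_zero])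
      ENNReal.ofReal_ne_top fun t => ENNReal.ofReal_le_ofReal (hWM t)
  have hfle : ∀ t ∈ openDom D, ENNReal.ofReal (f t) ^ (p - 1)
      ≤ C * tail (wm D (vhat v p)) (fun s => ENNReal.ofReal (W s)) t ^ (p - 1) := by
    intro t ht
    by_cases hft : f t = 0
    · rw [hft, ENNReal.ofReal_zero, ENNReal.zero_rpow_of_pos hp1]
      exact zero_le
    have hftpos : 0 < f t :=
      lt_of_le_of_ne (hnn t (openDom_subset_closedDom D ht)) (Ne.symm hft)
    have h : (opII u v p D f t)⁻¹ ≤ C :=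
      le_iSup₂_of_le t ⟨openDom_subset_closedDom D ht, hft⟩ le_rfl
    rw [opII_eq hp huv hfo (fun s hs => hnn s (openDom_subset_closedDom D hs)) ht.1.le,
      ← hWE] at h
    rw [ENNReal.ofReal_rpow_of_nonneg hftpos.le hp1.le]
    exact le_mul_of_inv_div_le (by simpa using Real.rpow_pos_of_pos hftpos _) (by simp) hCtop
      (ENNReal.rpow_ne_top_of_nonneg hp1.le (htailtop t)) h
  have hyx₀ : y < x₀ := by
    by_contra h
    exact hfy (hzero y hyD (not_lt.1 h))
  have hgy : 0 < g y := by
    rw [hgf y hyD]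
    exact lt_of_le_of_ne (hnn y hyD) (Ne.symm hfy)
  -- The point `y` may be the endpoint 0, so the interval where `f` is positive is taken to its
  -- right.
  obtain ⟨δ, hδ, hball⟩ := Metric.eventually_nhds_iff.1
    (hgc.continuousAt.eventually (lt_mem_nhds hgy))
  set b := min (y + δ) x₀ with hb
  have hyb : y < b := lt_min (by linarith) hyx₀
  have hbD : (b : EReal) ≤ D := (EReal.coe_le_coe_iff.2 (min_le_right _ _)).trans hx₀.2.le
  have hIoo : ∀ t ∈ Ioo y b, 0 < g t := fun t ht => by
    refine hball ?_
    rw [Real.dist_eq, abs_of_pos (by linarith [ht.1])]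
    linarith [ht.2, min_le_left (y + δ) x₀]
  have hsubD := Ioo_subset_openDom' (D := D) hyD.1 hbD
  refine lambdaP_le_of_sub hp huv hU (hfl.continuousOn.congr hWmem)
    (indicator_nonneg fun t _ => posFlux_nonneg zero_le_one g t) hoff (R := x₀) (M := M) hUlt hWM
    hyD.1 hyb hbD (fun t ht => ?_) fun s hs => ?_
  · have htU : t ∈ U := ⟨hsubD ht, by
      have := hIoo t ht
      rw [hgf' t (hsubD ht)] at this
      exact this.ne'⟩
    rw [← ENNReal.ofReal_pos, pos_iff_ne_zero]
    intro h0
    have h1 := hWr t htU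
    rw [h0, ENNReal.zero_rpow_of_pos hp1, ← hheadeq] at h1
    exact head_pos hp huv hyD.1 ht.1 le_rfl ((EReal.coe_le_coe_iff.2 ht.2.le).trans hbD)
      hgc.continuousOn (fun s hs => hIoo s ⟨hs.1, hs.2.trans ht.2⟩) h1.symm
  · rw [hWr s hs.1, head, head, ← lintegral_const_mul' _ _ hCtop]
    refine setLIntegral_mono_ae' measurableSet_Iio
      ((ae_wm_mem huv.locallyIntegrable_u).mono fun t ht _ => hfle t ht)

/-- For $c>\lambda_p$ the positive part of the solution is itself a competitor: it equals the
integral of its flux up to the first zero, so its value is at most `c`. -/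
lemma iInf_FIItilde_le (hp : 1 < p) (huv : IsWeightPair u v p D) :
    ⨅ f ∈ FIItilde D, ⨆ x ∈ closedDom D ∩ Function.support f, (opII u v p D f x)⁻¹
      ≤ lambdaP u v p D := by
  refine le_of_forall_lt_ofReal fun c hc => ?_
  have hp1 : 0 < p - 1 := by linarith
  have hr : 0 < (p - 1)⁻¹ := inv_pos.2 hp1
  have hc0 : 0 < c := ENNReal.ofReal_pos.1 (bot_le.trans_lt hc)
  obtain ⟨f, hf, x₁, hx₁, hfx₁, hpos⟩ := exists_solution_with_zero hp huv hc
  set g : ℝ → ℝ := fun x => max (f x) 0 with hg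
  have hgc : Continuous g := hf.cont.max continuous_const
  have hg0 : ∀ x, 0 ≤ g x := fun x => le_max_right _ _
  have hgz : ∀ x, x₁ ≤ x → g x = 0 := fun x hx =>
    max_eq_right (hfx₁ ▸ hf.le_of_le hp huv hc0.le hx₁.1.le hx)
  have hgf : ∀ x, 0 ≤ x → x < x₁ → g x = f x := fun x h0 h => max_eq_left (hpos x h0 h).le
  have hmem : g ∈ FIItilde D := ⟨x₁, hx₁, hgc.continuousOn, fun x _ hx => hgz x hx,
    fun x _ => hg0 x, 0, ⟨le_rfl, (EReal.coe_le_coe_iff.2 hx₁.1.le).trans hx₁.2.le⟩, by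
      rw [hgf 0 le_rfl hx₁.1, hf.apply_zero]; exact one_ne_zero⟩
  refine (iInf₂_le g hmem).trans (iSup₂_le fun x hx => ?_)
  have hxx₁ : x < x₁ := by
    by_contra h
    exact hx.2 (hgz x (not_lt.1 h))
  have hgx : 0 < g x := lt_of_le_of_ne (hg0 x) (Ne.symm hx.2)
  rw [opII_eq hp huv hgc.continuousOn (fun t _ => hg0 t) hx.1.1]
  refine inv_div_le (by simpa using Real.rpow_pos_of_pos hgx _) (by simp) ?_
  rw [← rpow_mul_rpow_inv hp, ← ENNReal.ofReal_rpow_of_nonneg hgx.le hp1.le,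
    ENNReal.rpow_le_rpow_iff hp1, hgf x hx.1.1 hxx₁]
  have h1 := hf.lintegral_posFlux hp huv hc0.le hx.1.1 hxx₁.le
  rw [hfx₁, sub_zero] at h1
  have hcr : ENNReal.ofReal c ^ (p - 1)⁻¹ ≠ ∞ :=
    ENNReal.rpow_ne_top_of_nonneg hr.le ENNReal.ofReal_ne_top
  rw [← h1, ← tail_const_mul hcr]
  refine le_trans ?_ (lintegral_mono_set (s := Ioo x x₁) fun t ht => ht.1)
  refine setLIntegral_mono' measurableSet_Ioo fun s hs => ?_
  have hs0 : 0 < s := hx.1.1.trans_lt hs.1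
  have hsU : s ∈ openDom D ∩ Function.support g :=
    ⟨mem_openDom_of_lt hs0 hs.2.le hx₁.2.le (Or.inl hs.2), by
      rw [Function.mem_support, hgf s hs0.le hs.2]
      exact (hpos s hs0.le hs.2).ne'⟩
  rw [indicator_of_mem hsU, ← ENNReal.mul_rpow_of_nonneg _ _ hr.le, ENNReal.le_rpow_inv_iff hp1,
    ofReal_posFlux_rpow hp huv hc0.le hf.cont hs0.le]
  gcongr
  refine head_wm_le hp huv.locallyIntegrable_u fun t ht hts => ?_
  exact ENNReal.ofReal_le_ofReal (le_max_left _ _)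

lemma IsSolution.le_iInf_opII {c : ℝ} {f : ℝ → ℝ} (hf : IsSolution u v p D c f) (hp : 1 < p)
    (huv : IsWeightPair u v p D) (hc : 0 < c) (hpos : ∀ x ∈ openDom D, 0 < f x) :
    ENNReal.ofReal c ≤ ⨅ x ∈ openDom D, (opII u v p D f x)⁻¹ := by
  have hp1 : 0 < p - 1 := by linarith
  have hr : 0 < (p - 1)⁻¹ := inv_pos.2 hp1
  refine le_iInf₂ fun x hx => ?_
  rw [opII_eq hp huv hf.cont.continuousOn (fun t ht => (hpos t ht).le) hx.1.le]
  refine le_inv_div (by simpa using hc) (by simp) ?_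
  have hcr : ENNReal.ofReal c ^ (p - 1)⁻¹ ≠ ∞ :=
    ENNReal.rpow_ne_top_of_nonneg hr.le ENNReal.ofReal_ne_top
  rw [← rpow_mul_rpow_inv hp, ← ENNReal.ofReal_rpow_of_nonneg (hpos x hx).le hp1.le,
    ENNReal.rpow_le_rpow_iff hp1, ← tail_const_mul hcr]
  refine le_trans ?_ (hf.tail_le hp huv hc.le hpos hx)
  refine setLIntegral_mono_ae' measurableSet_Ioi
    ((ae_wm_mem huv.locallyIntegrable_vhat).mono fun s hs _ => ?_)
  rw [indicator_of_mem (show s ∈ openDom D ∩ Function.support f from ⟨hs, (hpos s hs).ne'⟩),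
    ← ENNReal.mul_rpow_of_nonneg _ _ hr.le, ENNReal.rpow_inv_le_iff hp1,
    ofReal_posFlux_rpow hp huv hc.le hf.cont hs.1.le]

end

end

section

/-! ### Differential forms -/

lemma Icc_subset_halfDom {E : EReal} {x : ℝ} (hx : (x : EReal) < E) : Icc 0 x ⊆ halfDom E :=
  fun _ ht => ⟨ht.1, (EReal.coe_le_coe_iff.2 ht.2).trans_lt hx⟩

lemma Icc_subset_openDom {E : EReal} {a b : ℝ} (ha : 0 < a) (hb : (b : EReal) < E) :
    Icc a b ⊆ openDom E :=
  fun _ ht => ⟨ha.trans_le ht.1, (EReal.coe_le_coe_iff.2 ht.2).trans_lt hb⟩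

lemma openDom_mono {E D : EReal} (h : E ≤ D) : openDom E ⊆ openDom D :=
  fun _ hx => ⟨hx.1, hx.2.trans_le h⟩

lemma halfDom_mono {E D : EReal} (h : E ≤ D) : halfDom E ⊆ halfDom D :=
  fun _ hx => ⟨hx.1, hx.2.trans_le h⟩

/-- The derivative of `v ((-h) g) ^ (p - 1)` when `g' = h g`. -/
lemma hasDerivAt_mul_rpow {v h g : ℝ → ℝ} {p x : ℝ} (hv : DifferentiableAt ℝ v x)
    (hh : DifferentiableAt ℝ h x) (hg : HasDerivAt g (h x * g x) x) (hneg : h x < 0)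
    (hgpos : 0 < g x) :
    HasDerivAt (fun y => v y * (-h y * g y) ^ (p - 1)) (-riccati v p h x * g x ^ (p - 1)) x := by
  have hh0 : 0 < -h x := by linarith
  have h1 := (hh.hasDerivAt.neg.mul hg).rpow_const (p := p - 1) (Or.inl (mul_pos hh0 hgpos).ne')
  have h2 := hv.hasDerivAt.mul h1
  refine h2.congr_deriv ?_
  simp only [Pi.neg_apply, Pi.mul_apply]
  have e1 : p - 1 - 1 = p - 2 := by ring
  have e2 : (-h x) ^ (p - 1) = (-h x) ^ (p - 2) * (-h x) := by
    rw [← Real.rpow_add_one hh0.ne']; congr 1; ring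
  have e3 : g x ^ (p - 1) = g x ^ (p - 2) * g x := by
    rw [← Real.rpow_add_one hgpos.ne']; congr 1; ring
  rw [riccati, abs_of_neg hneg, e1, Real.mul_rpow hh0.le hgpos.le, Real.mul_rpow hh0.le hgpos.le,
    e2, e3]
  ring

lemma hasDerivAt_primitive {k : ℝ → ℝ} {U : Set ℝ} (hU : IsOpen U) (hk : ContinuousOn k U) {x : ℝ}
    (hx : x ∈ U) (hi : IntervalIntegrable k volume 0 x) :
    HasDerivAt (fun y => ∫ t in 0..y, k t) (k x) x :=
  intervalIntegral.integral_hasDerivAt_right hi (hk.stronglyMeasurableAtFilter hU x hx)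
    (hk.continuousAt (hU.mem_nhds hx))

/-- `exp (∫_0^x h)`. -/
def expPrim (h : ℝ → ℝ) (x : ℝ) : ℝ := Real.exp (∫ t in 0..x, h t)

lemma expPrim_pos (h : ℝ → ℝ) (x : ℝ) : 0 < expPrim h x := Real.exp_pos _

section

variable {h : ℝ → ℝ} {E : EReal}

lemma intervalIntegrable_of_halfDom (hh : ContinuousOn h (halfDom E)) {x : ℝ}
    (hx : x ∈ halfDom E) : IntervalIntegrable h volume 0 x :=
  (hh.mono (by rw [uIcc_of_le hx.1]; exact Icc_subset_halfDom hx.2)).intervalIntegrable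

lemma hasDerivAt_expPrim (hh : ContinuousOn h (halfDom E)) {x : ℝ} (hx : x ∈ openDom E) :
    HasDerivAt (expPrim h) (h x * expPrim h x) x := by
  rw [mul_comm]
  exact (hasDerivAt_primitive (isOpen_openDom E) (hh.mono (openDom_subset_halfDom E)) hx
    (intervalIntegrable_of_halfDom hh (openDom_subset_halfDom E hx))).exp

lemma continuousOn_expPrim (hh : ContinuousOn h (halfDom E)) {x : ℝ} (hx : x ∈ halfDom E) :
    ContinuousOn (expPrim h) (Icc 0 x) := by
  have h1 := intervalIntegral.continuousOn_primitive_interval (μ := volume) (f := h) (a := 0)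
    (b := x) (by
      rw [uIcc_of_le hx.1]
      exact (hh.mono (Icc_subset_halfDom hx.2)).integrableOn_Icc)
  rw [uIcc_of_le hx.1] at h1
  exact Real.continuous_exp.comp_continuousOn h1

end

/-- A strictly negative `h` on `(0, E)` together with regular positive weights. -/
structure IsRiccati (u v : ℝ → ℝ) (p : ℝ) (E : EReal) (h : ℝ → ℝ) : Prop where
  u_pos : ∀ x ∈ halfDom E, 0 < u x
  v_pos : ∀ x ∈ halfDom E, 0 < v x
  u_cont : ContinuousOn u (halfDom E)
  v_diff : ContDiffOn ℝ 1 v (halfDom E)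
  h_diff : ContDiffOn ℝ 1 h (openDom E)
  h_cont : ContinuousOn h (halfDom E)
  h_zero : h 0 = 0
  h_neg : ∀ x ∈ openDom E, h x < 0

namespace IsRiccati

variable {u v h : ℝ → ℝ} {p : ℝ} {D E : EReal}

lemma differentiableAt_v (H : IsRiccati u v p E h) {x : ℝ} (hx : x ∈ openDom E) :
    DifferentiableAt ℝ v x :=
  ((H.v_diff.mono (openDom_subset_halfDom E)).differentiableOn one_ne_zero).differentiableAt
    ((isOpen_openDom E).mem_nhds hx)

lemma differentiableAt_h (H : IsRiccati u v p E h) {x : ℝ} (hx : x ∈ openDom E) :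
    DifferentiableAt ℝ h x :=
  (H.h_diff.differentiableOn one_ne_zero).differentiableAt ((isOpen_openDom E).mem_nhds hx)

lemma h_nonpos (H : IsRiccati u v p E h) {x : ℝ} (hx : x ∈ halfDom E) : h x ≤ 0 := by
  rcases hx.1.eq_or_lt with rfl | h0
  · exact H.h_zero.le
  · exact (H.h_neg x ⟨h0, hx.2⟩).le

lemma continuousOn_integrand (H : IsRiccati u v p E h) {x : ℝ} (hx : x ∈ halfDom E) :
    ContinuousOn (fun t => u t * expPrim h t ^ (p - 1)) (Icc 0 x) :=
  (H.u_cont.mono (Icc_subset_halfDom hx.2)).mul ((continuousOn_expPrim H.h_cont hx).rpow_const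
    fun t _ => Or.inl (expPrim_pos h t).ne')

lemma hasDerivAt_weight (H : IsRiccati u v p E h) {x : ℝ} (hx : x ∈ openDom E) :
    HasDerivAt (fun y => ∫ t in 0..y, u t * expPrim h t ^ (p - 1))
      (u x * expPrim h x ^ (p - 1)) x := by
  refine hasDerivAt_primitive (isOpen_openDom E) ?_ hx ?_
  · exact (H.u_cont.mono (openDom_subset_halfDom E)).mul (ContinuousOn.rpow_const
      (fun t ht => (hasDerivAt_expPrim H.h_cont ht).continuousAt.continuousWithinAt)
      fun t _ => Or.inl (expPrim_pos h t).ne')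
  · have := H.continuousOn_integrand (openDom_subset_halfDom E hx)
    rw [← uIcc_of_le hx.1.le] at this
    exact this.intervalIntegrable

/-- The flux balance has a derivative with the sign of $R(h)-c$. Thus a one-sided bound on $R(h)$
integrates to one on the flux. -/
lemma hasDerivAt_sub (H : IsRiccati u v p E h) (c : ℝ) {x : ℝ} (hx : x ∈ openDom E) :
    HasDerivAt (fun y => v y * (-h y * expPrim h y) ^ (p - 1)
        - c * ∫ t in 0..y, u t * expPrim h t ^ (p - 1))
      ((opR u v p h x - c) * (u x * expPrim h x ^ (p - 1))) x := by
  refine ((hasDerivAt_mul_rpow (p := p) (H.differentiableAt_v hx) (H.differentiableAt_h hx)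
    (hasDerivAt_expPrim H.h_cont hx) (H.h_neg x hx) (expPrim_pos h x)).sub
    ((H.hasDerivAt_weight hx).const_mul c)).congr_deriv ?_
  have hu := (H.u_pos x (openDom_subset_halfDom E hx)).ne'
  rw [opR]
  field_simp

lemma continuousOn_sub (H : IsRiccati u v p E h) (hp : 1 < p) (c : ℝ) {x : ℝ}
    (hx : x ∈ halfDom E) :
    ContinuousOn (fun y => v y * (-h y * expPrim h y) ^ (p - 1)
        - c * ∫ t in 0..y, u t * expPrim h t ^ (p - 1)) (Icc 0 x) := by
  have hsub := Icc_subset_halfDom hx.2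
  refine ((H.v_diff.continuousOn.mono hsub).mul ((((H.h_cont.mono hsub).neg).mul
    (continuousOn_expPrim H.h_cont hx)).rpow_const fun t _ => Or.inr (by linarith))).sub
    (continuousOn_const.mul ?_)
  have h1 := intervalIntegral.continuousOn_primitive_interval (μ := volume)
    (f := fun t => u t * expPrim h t ^ (p - 1)) (a := 0) (b := x) (by
      rw [uIcc_of_le hx.1]
      exact (H.continuousOn_integrand hx).integrableOn_Icc)
  rwa [uIcc_of_le hx.1] at h1

/-- The Neumann condition $h(0)=0$ starts the balance at zero. -/
lemma sub_zero_eq (H : IsRiccati u v p E h) (hp : 1 < p) (c : ℝ) :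
    v 0 * (-h 0 * expPrim h 0) ^ (p - 1)
        - c * ∫ t in (0 : ℝ)..0, u t * expPrim h t ^ (p - 1) = 0 := by
  rw [H.h_zero, neg_zero, zero_mul, Real.zero_rpow (by linarith), intervalIntegral.integral_same]
  ring

lemma le_flux (H : IsRiccati u v p E h) (hp : 1 < p) {c : ℝ}
    (hc : ∀ x ∈ openDom E, c ≤ opR u v p h x) {x : ℝ} (hx : x ∈ openDom E) :
    c * ∫ t in 0..x, u t * expPrim h t ^ (p - 1) ≤ v x * (-h x * expPrim h x) ^ (p - 1) := by
  have hsub : interior (Icc 0 x) ⊆ openDom E := by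
    rw [interior_Icc]
    exact Ioo_subset_openDom hx.2.le
  have hmono := monotoneOn_of_deriv_nonneg (convex_Icc 0 x)
    (H.continuousOn_sub hp c (openDom_subset_halfDom E hx))
    (fun t ht => (H.hasDerivAt_sub c (hsub ht)).differentiableAt.differentiableWithinAt)
    fun t ht => by
      rw [(H.hasDerivAt_sub c (hsub ht)).deriv]
      exact mul_nonneg (sub_nonneg.2 (hc t (hsub ht)))
        (mul_nonneg (H.u_pos t (openDom_subset_halfDom E (hsub ht))).le
          (Real.rpow_nonneg (expPrim_pos h t).le _))
  have h1 := hmono (left_mem_Icc.2 hx.1.le) (right_mem_Icc.2 hx.1.le) hx.1.le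
  simp only [H.sub_zero_eq hp c] at h1
  linarith

lemma flux_le (H : IsRiccati u v p E h) (hp : 1 < p) {c : ℝ}
    (hc : ∀ x ∈ openDom E, opR u v p h x ≤ c) {x : ℝ} (hx : x ∈ openDom E) :
    v x * (-h x * expPrim h x) ^ (p - 1) ≤ c * ∫ t in 0..x, u t * expPrim h t ^ (p - 1) := by
  have hsub : interior (Icc 0 x) ⊆ openDom E := by
    rw [interior_Icc]
    exact Ioo_subset_openDom hx.2.le
  have hmono := antitoneOn_of_deriv_nonpos (convex_Icc 0 x)
    (H.continuousOn_sub hp c (openDom_subset_halfDom E hx))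
    (fun t ht => (H.hasDerivAt_sub c (hsub ht)).differentiableAt.differentiableWithinAt)
    fun t ht => by
      rw [(H.hasDerivAt_sub c (hsub ht)).deriv]
      exact mul_nonpos_of_nonpos_of_nonneg (sub_nonpos.2 (hc t (hsub ht)))
        (mul_nonneg (H.u_pos t (openDom_subset_halfDom E (hsub ht))).le
          (Real.rpow_nonneg (expPrim_pos h t).le _))
  have h1 := hmono (left_mem_Icc.2 hx.1.le) (right_mem_Icc.2 hx.1.le) hx.1.le
  simp only [H.sub_zero_eq hp c] at h1
  linarith

lemma head_eq (H : IsRiccati u v p E h) (hp : 1 < p) (huv : IsWeightPair u v p D) (hE : E ≤ D)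
    {x : ℝ} (hx : x ∈ openDom E) :
    head (wm D u) p (fun t => ENNReal.ofReal (expPrim h t)) x
      = ENNReal.ofReal (∫ t in 0..x, u t * expPrim h t ^ (p - 1)) := by
  have hk := huv.locallyIntegrable_u
  have hxh := openDom_subset_halfDom E hx
  have hg : ContinuousOn (fun t => expPrim h t ^ (p - 1)) (Icc 0 x) :=
    (continuousOn_expPrim H.h_cont hxh).rpow_const fun t _ => Or.inl (expPrim_pos h t).ne'
  have hdens : ∀ t ∈ uIoc 0 x, dens D u t = u t := fun t ht => by
    rw [uIoc_of_le hx.1.le] at ht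
    have htE : t ∈ openDom E := ⟨ht.1, (EReal.coe_le_coe_iff.2 ht.2).trans_lt hx.2⟩
    exact dens_of_pos (openDom_mono hE htE) (H.u_pos t (openDom_subset_halfDom E htE))
  rw [head, setLIntegral_Iio_wm hk]
  simp_rw [ENNReal.ofReal_rpow_of_nonneg (expPrim_pos h _).le (by linarith : 0 ≤ p - 1)]
  rw [setLIntegral_Ioo_wm hk hx.1.le ((hg.mono Ioo_subset_Icc_self).aemeasurable measurableSet_Ioo)
    (fun t _ => Real.rpow_nonneg (expPrim_pos h t).le _)]
  · congr 1
    exact intervalIntegral.integral_congr_ae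
      (Filter.Eventually.of_forall fun t ht => by rw [hdens t ht])
  · rw [← uIcc_of_le hx.1.le] at hg
    exact (intervalIntegrable_of_locallyIntegrable hk 0 x).mul_continuousOn hg

/-- The quasi-derivative `v ^ (1 / (p - 1)) (-h) exp (∫ h)` cut off outside `(0, E)`. -/
def slope (v : ℝ → ℝ) (p : ℝ) (E : EReal) (h : ℝ → ℝ) : ℝ → ℝ :=
  (openDom E).indicator fun x => v x ^ (p - 1)⁻¹ * (-h x * expPrim h x)

lemma slope_of_mem {x : ℝ} (hx : x ∈ openDom E) :
    slope v p E h x = v x ^ (p - 1)⁻¹ * (-h x * expPrim h x) := indicator_of_mem hx _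

lemma slope_of_notMem {x : ℝ} (hx : x ∉ openDom E) : slope v p E h x = 0 :=
  indicator_of_notMem hx _

lemma slope_pos (H : IsRiccati u v p E h) {x : ℝ} (hx : x ∈ openDom E) : 0 < slope v p E h x := by
  rw [slope_of_mem hx]
  have h1 := H.h_neg x hx
  exact mul_pos (Real.rpow_pos_of_pos (H.v_pos x (openDom_subset_halfDom E hx)) _)
    (mul_pos (by linarith) (expPrim_pos h x))

lemma slope_nonneg (H : IsRiccati u v p E h) (x : ℝ) : 0 ≤ slope v p E h x := by
  by_cases hx : x ∈ openDom E
  · exact (H.slope_pos hx).le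
  · rw [slope_of_notMem hx]

lemma slope_rpow (H : IsRiccati u v p E h) (hp : 1 < p) {x : ℝ} (hx : x ∈ openDom E) :
    slope v p E h x ^ (p - 1) = v x * (-h x * expPrim h x) ^ (p - 1) := by
  have hv := H.v_pos x (openDom_subset_halfDom E hx)
  have h1 := H.h_neg x hx
  rw [slope_of_mem hx, Real.mul_rpow (Real.rpow_nonneg hv.le _)
    (mul_nonneg (by linarith) (expPrim_pos h x).le), ← Real.rpow_mul hv.le,
    inv_mul_cancel₀ (by linarith), Real.rpow_one]

lemma continuousOn_slope (H : IsRiccati u v p E h) : ContinuousOn (slope v p E h) (openDom E) := by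
  refine ContinuousOn.congr ?_ fun x hx => slope_of_mem hx
  have hsub := openDom_subset_halfDom E
  exact ((H.v_diff.continuousOn.mono hsub).rpow_const
    fun t ht => Or.inl (H.v_pos t (hsub ht)).ne').mul (((H.h_cont.mono hsub).neg).mul
    fun t ht => (hasDerivAt_expPrim H.h_cont ht).continuousAt.continuousWithinAt)

lemma lintegral_slope (H : IsRiccati u v p E h) (hp : 1 < p) (huv : IsWeightPair u v p D)
    (hE : E ≤ D) {a b : ℝ} (ha : 0 < a) (hab : a ≤ b) (hb : (b : EReal) < E) :
    ∫⁻ t in Ioo a b, ENNReal.ofReal (slope v p E h t) ∂wm D (vhat v p)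
      = ENNReal.ofReal (expPrim h a - expPrim h b) := by
  have hk := huv.locallyIntegrable_vhat
  have hsub := Icc_subset_openDom ha hb
  have hsub' : uIcc a b ⊆ openDom E := by rwa [uIcc_of_le hab]
  have hc := H.continuousOn_slope
  rw [setLIntegral_Ioo_wm hk hab
    ((hc.mono (Ioo_subset_Icc_self.trans hsub)).aemeasurable measurableSet_Ioo)
    (fun t _ => H.slope_nonneg t)
    ((intervalIntegrable_of_locallyIntegrable hk a b).mul_continuousOn (hc.mono hsub'))]
  congr 1
  have hder : ∀ t ∈ uIcc a b, HasDerivAt (expPrim h) (h t * expPrim h t) t := fun t ht =>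
    hasDerivAt_expPrim H.h_cont (hsub' ht)
  have hint : IntervalIntegrable (fun t => h t * expPrim h t) volume a b :=
    ContinuousOn.intervalIntegrable (((H.h_cont.mono (openDom_subset_halfDom E)).mono hsub').mul
      fun t ht => (hder t ht).continuousAt.continuousWithinAt)
  rw [← neg_sub, ← intervalIntegral.integral_eq_sub_of_hasDerivAt hder hint,
    ← intervalIntegral.integral_neg]
  refine intervalIntegral.integral_congr fun t ht => ?_
  have htE := hsub' ht
  have hv := H.v_pos t (openDom_subset_halfDom E htE)
  rw [dens_of_pos (openDom_mono hE htE) (vhat_pos hv), vhat_eq hp, slope_of_mem htE, ← mul_assoc,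
    ← Real.rpow_add hv]
  simp

lemma ofReal_slope_rpow (H : IsRiccati u v p E h) (hp : 1 < p) {x : ℝ} (hx : x ∈ openDom E) :
    ENNReal.ofReal (slope v p E h x) ^ (p - 1)
      = ENNReal.ofReal (v x * (-h x * expPrim h x) ^ (p - 1)) := by
  rw [ENNReal.ofReal_rpow_of_nonneg (H.slope_nonneg x) (by linarith), H.slope_rpow hp hx]

/-- The quasi-derivative of $g=\exp\int_0^\cdot h$ is a supersolution: its flux dominates $c\int u
g^{p-1}$, and positivity of `g` bounds its tail. -/
lemma le_lambdaP (H : IsRiccati u v p D h) (hp : 1 < p) (huv : IsWeightPair u v p D) {c : ℝ}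
    (hc0 : 0 ≤ c) (hc : ∀ x ∈ openDom D, c ≤ opR u v p h x) :
    ENNReal.ofReal c ≤ lambdaP u v p D := by
  refine le_lambdaP_of_super hp huv (W := fun t => ENNReal.ofReal (slope v p D h t))
    (g := fun t => ENNReal.ofReal (expPrim h t))
    (measurable_of_continuousOn_open (isOpen_openDom D) H.continuousOn_slope
      fun x hx => slope_of_notMem hx).ennreal_ofReal
    (fun s hs => ⟨by simpa using H.slope_pos hs, by simp⟩) (fun x hx => ?_) fun s hs => ?_
  · rw [tail, setLIntegral_wm_inter huv.locallyIntegrable_vhat]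
    refine (lintegral_mono_set (t := {s : ℝ | x < s ∧ (s : EReal) < D})
      fun t ht => ⟨ht.1, ht.2.2⟩).trans (setLIntegral_le_of_forall_Ioo fun b hxb hb => ?_)
    rw [H.lintegral_slope hp huv le_rfl hx.1 hxb.le hb]
    exact ENNReal.ofReal_le_ofReal (by linarith [expPrim_pos h b])
  · rw [H.ofReal_slope_rpow hp hs, H.head_eq hp huv le_rfl hs, ← ENNReal.ofReal_mul hc0]
    exact ENNReal.ofReal_le_ofReal (H.le_flux hp hc hs)

lemma expPrim_le (H : IsRiccati u v p E h) {a b : ℝ} (ha : 0 ≤ a) (hab : a ≤ b)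
    (hb : (b : EReal) < E) : expPrim h b ≤ expPrim h a := by
  have hbE : b ∈ halfDom E := ⟨ha.trans hab, hb⟩
  have haE : a ∈ halfDom E := ⟨ha, (EReal.coe_le_coe_iff.2 hab).trans_lt hb⟩
  refine Real.exp_le_exp.2 ?_
  have h1 := intervalIntegral.integral_interval_sub_left
    (intervalIntegrable_of_halfDom H.h_cont hbE) (intervalIntegrable_of_halfDom H.h_cont haE)
  have h2 : 0 ≤ ∫ t in a..b, -h t := intervalIntegral.integral_nonneg hab fun t ht => by
    have := H.h_nonpos (x := t) ⟨ha.trans ht.1, (EReal.coe_le_coe_iff.2 ht.2).trans_lt hb⟩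
    linarith
  rw [intervalIntegral.integral_neg] at h2
  linarith

/-- If `∫_0^{x₀} h = -∞`, then `exp (∫_0^· h)` tends to zero at `x₀`. -/
lemma exists_expPrim_lt {x₀ : ℝ} (H : IsRiccati u v p x₀ h)
    (hinf : ∫⁻ x in Ioo 0 x₀, ENNReal.ofReal (-h x) = ∞) {η : ℝ} (hη : 0 < η) {x : ℝ}
    (hx : x ∈ Ioo 0 x₀) : ∃ b ∈ Ioo x x₀, expPrim h b < η := by
  by_contra! hcon
  have hset : {s : ℝ | 0 < s ∧ (s : EReal) < x₀} = Ioo 0 x₀ := by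
    ext s
    simp [EReal.coe_lt_coe_iff]
  have hle : ∫⁻ s in {s : ℝ | 0 < s ∧ (s : EReal) < x₀}, ENNReal.ofReal (-h s)
      ≤ ENNReal.ofReal (-Real.log η) := by
    refine setLIntegral_le_of_forall_Ioo fun b hb hbx => ?_
    have hbx' : b < x₀ := EReal.coe_lt_coe_iff.1 hbx
    -- Moving the endpoint past the midpoint places it in $(x,x_0)$, where the assumed lower bound
    -- on the exponential holds.
    set b' := max b ((x + x₀) / 2) with hb'
    have h1 : b ≤ b' := le_max_left _ _
    have h2 : b' < x₀ := max_lt hbx' (by linarith [hx.2])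
    have h3 : x < b' := lt_of_lt_of_le (by linarith [hx.2]) (le_max_right _ _)
    have hb'E : b' ∈ halfDom (x₀ : EReal) := ⟨hb.le.trans h1, EReal.coe_lt_coe_iff.2 h2⟩
    have hcb := hcon b' ⟨h3, h2⟩
    have hsub : Icc 0 b' ⊆ halfDom (x₀ : EReal) := Icc_subset_halfDom hb'E.2
    refine (lintegral_mono_set (Ioo_subset_Ioo_right h1)).trans ?_
    rw [← ofReal_integral_eq_lintegral_ofReal, ← integral_Ioc_eq_integral_Ioo,
      ← intervalIntegral.integral_of_le (hb.le.trans h1), intervalIntegral.integral_neg]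
    · refine ENNReal.ofReal_le_ofReal (neg_le_neg ?_)
      rw [Real.log_le_iff_le_exp hη]
      exact hcb
    · exact (((H.h_cont.mono hsub).neg).integrableOn_Icc).mono_set Ioo_subset_Icc_self
    · refine (ae_restrict_iff' measurableSet_Ioo).2 (Filter.Eventually.of_forall fun t ht => ?_)
      have := H.h_nonpos (hsub (Ioo_subset_Icc_self ht))
      simpa using this
  rw [hset, hinf, top_le_iff] at hle
  exact ENNReal.ofReal_ne_top hle

lemma lambdaP_le {x₀ : ℝ} (H : IsRiccati u v p x₀ h) (hp : 1 < p) (huv : IsWeightPair u v p D)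
    (hx₀ : x₀ ∈ openDom D) (hu : ContinuousOn u (Icc 0 x₀))
    (hinf : ∫⁻ x in Ioo 0 x₀, ENNReal.ofReal (-h x) = ∞) {c : ℝ} (hc0 : 0 ≤ c)
    (hc : ∀ x ∈ Ioo 0 x₀, opR u v p h x ≤ c) : lambdaP u v p D ≤ ENNReal.ofReal c := by
  have hp1 : 0 < p - 1 := by linarith
  have hE : (x₀ : EReal) ≤ D := hx₀.2.le
  have hdom : openDom (x₀ : EReal) = Ioo 0 x₀ := by
    ext s
    simp [openDom, EReal.coe_lt_coe_iff]
  rw [← hdom] at hc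
  obtain ⟨B, hB⟩ := isCompact_Icc.exists_bound_of_continuousOn hu
  have hB0 : 0 ≤ B := (norm_nonneg _).trans (hB 0 ⟨le_rfl, hx₀.1.le⟩)
  have htail : ∀ x ∈ Ioo 0 x₀, ENNReal.ofReal (expPrim h x)
      ≤ tail (wm D (vhat v p)) (fun s => ENNReal.ofReal (slope v p x₀ h s)) x := by
    intro x hx
    refine ENNReal.le_of_forall_pos_le_add fun ε hε _ => ?_
    obtain ⟨b, hb, hbη⟩ := H.exists_expPrim_lt hinf (η := ε) (by exact_mod_cast hε) hx
    have h1 := H.lintegral_slope hp huv hE hx.1 hb.1.le (EReal.coe_lt_coe_iff.2 hb.2)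
    calc ENNReal.ofReal (expPrim h x)
        ≤ ENNReal.ofReal ((expPrim h x - expPrim h b) + ε) :=
          ENNReal.ofReal_le_ofReal (by linarith)
      _ ≤ ENNReal.ofReal (expPrim h x - expPrim h b) + ε := by
          refine ENNReal.ofReal_add_le.trans ?_
          simp
      _ ≤ _ := by
          rw [← h1]
          gcongr
          exact lintegral_mono_set fun t ht => ht.1
  refine lambdaP_le_of_sub hp huv (isOpen_openDom (x₀ : EReal)) H.continuousOn_slope
    H.slope_nonneg (fun x hx => slope_of_notMem hx) (R := x₀)
    (M := (c * (x₀ * B)) ^ (p - 1)⁻¹)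
    (fun t ht => EReal.coe_lt_coe_iff.1 ht.2) (fun x => ?_) le_rfl hx₀.1 hE
    (fun t ht => H.slope_pos (hdom ▸ ht)) fun s hs => ?_
  · by_cases hx : x ∈ openDom (x₀ : EReal)
    · have hxI : x ∈ Ioo 0 x₀ := hdom ▸ hx
      -- Because $\exp\int_0^\cdot h\le1$ and $u\le B$ on $[0,x_0]$, the flux is bounded up to
      -- $x_0$, although `h` itself is not.
      have hbound : ∫ t in 0..x, u t * expPrim h t ^ (p - 1) ≤ x₀ * B := by
        calc ∫ t in 0..x, u t * expPrim h t ^ (p - 1) ≤ ∫ t in 0..x, B := by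
              refine intervalIntegral.integral_mono_on hx.1.le ?_ intervalIntegrable_const
                fun t ht => ?_
              · have := H.continuousOn_integrand (openDom_subset_halfDom _ hx)
                rw [← uIcc_of_le hx.1.le] at this
                exact this.intervalIntegrable
              · have h1 : expPrim h t ≤ 1 := by
                  have := H.expPrim_le le_rfl ht.1
                    ((EReal.coe_le_coe_iff.2 ht.2).trans_lt hx.2)
                  simpa [expPrim] using this
                have h2 := (le_abs_self _).trans (hB t ⟨ht.1, ht.2.trans hxI.2.le⟩)
                have h3 := Real.rpow_le_one (expPrim_pos h t).le h1 hp1.le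
                have h4 := Real.rpow_nonneg (expPrim_pos h t).le (p - 1)
                nlinarith
          _ = x * B := by simp
          _ ≤ x₀ * B := by gcongr; exact hxI.2.le
      rw [Real.le_rpow_inv_iff_of_pos (H.slope_nonneg x) (by
        have := hx₀.1
        positivity) hp1, H.slope_rpow hp hx]
      exact (H.flux_le hp hc hx).trans (by gcongr)
    · rw [slope_of_notMem hx]
      have := hx₀.1
      positivity
  · rw [H.ofReal_slope_rpow hp hs.1]
    refine (ENNReal.ofReal_le_ofReal (H.flux_le hp hc hs.1)).trans ?_
    rw [ENNReal.ofReal_mul hc0, ← H.head_eq hp huv hE hs.1]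
    gcongr
    refine head_wm_le hp huv.locallyIntegrable_u fun t ht hts => ?_
    exact htail t ⟨ht.1, hts.trans (EReal.coe_lt_coe_iff.1 hs.1.2)⟩

end IsRiccati

end

/-! ### Regular weights: from solutions to logarithmic derivatives. -/

section

/-- Positive weights with `u` continuous and `v` continuously differentiable on `[0, D)`. -/
structure IsRegular (u v : ℝ → ℝ) (D : EReal) : Prop where
  u_pos : ∀ x ∈ halfDom D, 0 < u x
  v_pos : ∀ x ∈ halfDom D, 0 < v x
  u_cont : ContinuousOn u (halfDom D)
  v_diff : ContDiffOn ℝ 1 v (halfDom D)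

variable {u v : ℝ → ℝ} {p : ℝ} {D E : EReal}

lemma IsRegular.mono (hr : IsRegular u v D) (hE : E ≤ D) : IsRegular u v E where
  u_pos x hx := hr.u_pos x (halfDom_mono hE hx)
  v_pos x hx := hr.v_pos x (halfDom_mono hE hx)
  u_cont := hr.u_cont.mono (halfDom_mono hE)
  v_diff := hr.v_diff.mono (halfDom_mono hE)

lemma openDom_coe (x₀ : ℝ) : openDom (x₀ : EReal) = Ioo 0 x₀ := by
  ext s
  simp [openDom, EReal.coe_lt_coe_iff]

lemma halfDom_coe (x₀ : ℝ) : halfDom (x₀ : EReal) = Ico 0 x₀ := by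
  ext s
  simp [halfDom, EReal.coe_lt_coe_iff]

/-- An interior zero of a nonpositive `h` is a maximum, so $h'=0$ and $R(h)=0$ there. Hence $h\le0$
suffices in the class whenever the lower bound is positive. -/
lemma neg_of_opR_pos {h : ℝ → ℝ} {x : ℝ} (hle : ∀ y ∈ openDom D, h y ≤ 0) (hx : x ∈ openDom D)
    (hR : 0 < opR u v p h x) : h x < 0 := by
  refine (hle x hx).lt_of_ne fun h0 => hR.ne' ?_
  have hmax : IsLocalMax h x := by
    filter_upwards [(isOpen_openDom D).mem_nhds hx] with y hy
    rw [h0]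
    exact hle y hy
  simp [opR, riccati, h0, hmax.deriv_eq_zero]

lemma iInf_opR_le (hp : 1 < p) (huv : IsWeightPair u v p D) (hr : IsRegular u v D) {h : ℝ → ℝ}
    (hh : h ∈ HH v p D) :
    ⨅ x ∈ openDom D, (opR u v p h x : EReal) ≤ (lambdaP u v p D : EReal) := by
  obtain ⟨h1, h2, h3, h4, h5⟩ := hh
  have hle : ∀ y ∈ openDom D, h y ≤ 0 := fun y hy => by
    by_cases hn : nuHatTotal v p D = ∞
    · exact h5 hn y hy
    · exact (h4 (lt_top_iff_ne_top.2 hn) y hy).le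
  refine le_of_forall_lt_imp_le_of_dense fun d hd => ?_
  induction d with
  | bot => exact bot_le
  | top => exact absurd hd not_top_lt
  | coe c =>
    rcases le_or_gt c 0 with hc | hc
    · exact (EReal.coe_nonpos.2 hc).trans (EReal.coe_ennreal_nonneg _)
    have hR : ∀ x ∈ openDom D, c ≤ opR u v p h x := fun x hx =>
      EReal.coe_le_coe_iff.1 (hd.le.trans (iInf₂_le x hx))
    have H : IsRiccati u v p D h := ⟨hr.u_pos, hr.v_pos, hr.u_cont, hr.v_diff, h1, h2, h3,
      fun x hx => neg_of_opR_pos hle hx (hc.trans_le (hR x hx))⟩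
    have h6 := EReal.coe_ennreal_le_coe_ennreal_iff.2 (H.le_lambdaP hp huv hc.le hR)
    rwa [EReal.coe_ennreal_ofReal, max_eq_left hc.le] at h6

lemma lambdaP_le_iSup_opR (hp : 1 < p) (huv : IsWeightPair u v p D) (hr : IsRegular u v D)
    {h : ℝ → ℝ} (hh : h ∈ HHtilde v p D) :
    (lambdaP u v p D : EReal) ≤ ⨆ x ∈ openDom D, (opR u v p h x : EReal) := by
  obtain ⟨x₀, hx₀, h1, h2, h3, h4, -, h6, δ, hδ, h7⟩ := hh
  have hE : (x₀ : EReal) ≤ D := hx₀.2.le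
  have hr' := hr.mono hE
  rw [← openDom_coe] at h1 h4
  rw [← halfDom_coe] at h2
  have H : IsRiccati u v p x₀ h :=
    ⟨hr'.u_pos, hr'.v_pos, hr'.u_cont, hr'.v_diff, h1, h2, h3, h4⟩
  have hS : ∀ x ∈ openDom D, (opR u v p h x : EReal)
      ≤ ⨆ x ∈ openDom D, (opR u v p h x : EReal) := fun x hx =>
    le_iSup₂ (f := fun x (_ : x ∈ openDom D) => (opR u v p h x : EReal)) x hx
  generalize (⨆ x ∈ openDom D, (opR u v p h x : EReal)) = S at hS
  induction S with
  | top => exact le_top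
  | bot => exact absurd (hS x₀ hx₀) (by simp)
  | coe c =>
    have hR : ∀ x ∈ Ioo 0 x₀, opR u v p h x ≤ c := fun x hx =>
      EReal.coe_le_coe_iff.1 (hS x (Ioo_subset_openDom hE hx))
    have hmid : x₀ / 2 ∈ Ioo 0 x₀ := ⟨by linarith [hx₀.1], by linarith [hx₀.1]⟩
    -- The uniform negativity of the Riccati expression, read at one interior point, makes the
    -- supremum nonnegative.
    have hc : 0 ≤ c := by
      refine le_trans (mul_nonneg (inv_nonneg.2 ?_) ?_) (hR _ hmid)
      · exact (hr.u_pos _ (openDom_subset_halfDom D (Ioo_subset_openDom hE hmid))).le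
      · linarith [h7 _ hmid]
    have h8 := EReal.coe_ennreal_le_coe_ennreal_iff.2
      (H.lambdaP_le hp huv hx₀ (hr.u_cont.mono (Icc_subset_halfDom hx₀.2)) h6 hc hR)
    rwa [EReal.coe_ennreal_ofReal, max_eq_left hc] at h8

lemma contDiffOn_one_of_hasDerivAt {U : Set ℝ} (hU : IsOpen U) {f f' : ℝ → ℝ}
    (h : ∀ x ∈ U, HasDerivAt f (f' x) x) (hc : ContinuousOn f' U) : ContDiffOn ℝ 1 f U := by
  rw [contDiffOn_one_iff_derivWithin hU.uniqueDiffOn]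
  refine ⟨fun x hx => (h x hx).differentiableAt.differentiableWithinAt, hc.congr fun x hx => ?_⟩
  rw [derivWithin_of_isOpen hU hx, (h x hx).deriv]

/-- A positive function `g` on `[0, E)` with `v |g'| ^ (p - 1) = φ`, for a flux `φ` of class `C¹`
that vanishes at `0` only. -/
structure IsFluxPair (v : ℝ → ℝ) (p : ℝ) (E : EReal) (φ g : ℝ → ℝ) : Prop where
  φ_cont : ContinuousOn φ (halfDom E)
  φ_zero : φ 0 = 0
  φ_pos : ∀ x ∈ openDom E, 0 < φ x
  φ_diff : ContDiffOn ℝ 1 φ (openDom E)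
  g_cont : ContinuousOn g (halfDom E)
  g_pos : ∀ x ∈ halfDom E, 0 < g x
  g_deriv : ∀ x ∈ openDom E, HasDerivAt g (-(vhat v p x * φ x ^ (p - 1)⁻¹)) x

/-- The logarithmic derivative of the second component of a flux pair. -/
def logSlope (v : ℝ → ℝ) (p : ℝ) (φ g : ℝ → ℝ) (x : ℝ) : ℝ :=
  -(vhat v p x * φ x ^ (p - 1)⁻¹ / g x)

lemma IsRegular.contDiffOn_vhat (hr : IsRegular u v E) :
    ContDiffOn ℝ 1 (vhat v p) (openDom E) :=
  (hr.v_diff.mono (openDom_subset_halfDom E)).rpow_const_of_ne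
    fun x hx => (hr.v_pos x (openDom_subset_halfDom E hx)).ne'

lemma IsRegular.continuousOn_vhat (hr : IsRegular u v E) :
    ContinuousOn (vhat v p) (halfDom E) :=
  hr.v_diff.continuousOn.rpow_const fun x hx => Or.inl (hr.v_pos x hx).ne'

namespace IsFluxPair

variable {φ g h : ℝ → ℝ}

lemma contDiffOn_rpow (H : IsFluxPair v p E φ g) :
    ContDiffOn ℝ 1 (fun x => φ x ^ (p - 1)⁻¹) (openDom E) :=
  H.φ_diff.rpow_const_of_ne fun x hx => (H.φ_pos x hx).ne'

lemma isRiccati (H : IsFluxPair v p E φ g) (hp : 1 < p) (hr : IsRegular u v E)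
    (hh : EqOn h (logSlope v p φ g) (halfDom E)) (h0 : h 0 = 0) : IsRiccati u v p E h where
  u_pos := hr.u_pos
  v_pos := hr.v_pos
  u_cont := hr.u_cont
  v_diff := hr.v_diff
  h_diff := by
    have hsub := openDom_subset_halfDom E
    have hg : ContDiffOn ℝ 1 g (openDom E) :=
      contDiffOn_one_of_hasDerivAt (isOpen_openDom E) H.g_deriv
        (hr.contDiffOn_vhat.continuousOn.mul H.contDiffOn_rpow.continuousOn).neg
    exact (((hr.contDiffOn_vhat.mul H.contDiffOn_rpow).div hg
      fun x hx => (H.g_pos x (hsub hx)).ne').neg).congr fun x hx => hh (hsub hx)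
  h_cont := by
    refine ContinuousOn.congr ?_ hh
    exact ((hr.continuousOn_vhat.mul (H.φ_cont.rpow_const fun x _ => Or.inr
      (inv_nonneg.2 (by linarith)))).div H.g_cont fun x hx => (H.g_pos x hx).ne').neg
  h_zero := h0
  h_neg x hx := by
    have hx' := openDom_subset_halfDom E hx
    rw [hh hx', logSlope, neg_lt_zero]
    exact div_pos (mul_pos (vhat_pos (hr.v_pos x hx')) (Real.rpow_pos_of_pos (H.φ_pos x hx) _))
      (H.g_pos x hx')

lemma logSlope_zero (H : IsFluxPair v p E φ g) (hp : 1 < p) : logSlope v p φ g 0 = 0 := by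
  rw [logSlope, H.φ_zero, Real.zero_rpow (inv_ne_zero (by linarith))]
  simp

lemma hasDerivAt_g (H : IsFluxPair v p E φ g) (hh : EqOn h (logSlope v p φ g) (halfDom E)) {x : ℝ}
    (hx : x ∈ openDom E) : HasDerivAt g (h x * g x) x := by
  have hx' := openDom_subset_halfDom E hx
  refine (H.g_deriv x hx).congr_deriv ?_
  rw [hh hx', logSlope, neg_mul, div_mul_cancel₀ _ (H.g_pos x hx').ne']

/-- With $h=g'/g$ the quantity $v(-hg)^{p-1}$ is the prescribed flux `φ`; differentiating it
evaluates the Riccati expression with no second derivative of `g` computed. -/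
lemma neg_riccati_mul (H : IsFluxPair v p E φ g) (hp : 1 < p) (hr : IsRegular u v E)
    (hh : EqOn h (logSlope v p φ g) (halfDom E)) (h0 : h 0 = 0) {x : ℝ} (hx : x ∈ openDom E) :
    -riccati v p h x * g x ^ (p - 1) = deriv φ x := by
  have HR := H.isRiccati hp hr hh h0
  have h1 := hasDerivAt_mul_rpow (p := p) (HR.differentiableAt_v hx) (HR.differentiableAt_h hx)
    (H.hasDerivAt_g hh hx) (HR.h_neg x hx) (H.g_pos x (openDom_subset_halfDom E hx))
  refine (h1.congr_of_eventuallyEq ?_).deriv.symm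
  filter_upwards [(isOpen_openDom E).mem_nhds hx] with y hy
  have hy' := openDom_subset_halfDom E hy
  have hv := hr.v_pos y hy'
  have hp1 : p - 1 ≠ 0 := by linarith
  have e : -h y * g y = vhat v p y * φ y ^ (p - 1)⁻¹ := by
    rw [hh hy', logSlope, neg_neg, div_mul_cancel₀ _ (H.g_pos y hy').ne']
  rw [e, Real.mul_rpow (vhat_pos hv).le (Real.rpow_nonneg (H.φ_pos y hy).le _), vhat_eq hp,
    ← Real.rpow_mul hv.le, ← Real.rpow_mul (H.φ_pos y hy).le, neg_mul, inv_mul_cancel₀ hp1,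
    Real.rpow_one, Real.rpow_neg_one, ← mul_assoc, mul_inv_cancel₀ hv.ne', one_mul]

lemma opR_eq (H : IsFluxPair v p E φ g) (hp : 1 < p) (hr : IsRegular u v E)
    (hh : EqOn h (logSlope v p φ g) (halfDom E)) (h0 : h 0 = 0) {x : ℝ} (hx : x ∈ openDom E) :
    opR u v p h x = (u x)⁻¹ * (deriv φ x / g x ^ (p - 1)) := by
  rw [opR, ← H.neg_riccati_mul hp hr hh h0 hx, mul_div_assoc, div_self, mul_one]
  exact (Real.rpow_pos_of_pos (H.g_pos x (openDom_subset_halfDom E hx)) _).ne'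

/-- Since $h=(\log g)'$, divergence of $\int h$ amounts to `g` tending to zero. -/
lemma lintegral_neg (H : IsFluxPair v p E φ g) (hp : 1 < p) (hr : IsRegular u v E)
    (hh : EqOn h (logSlope v p φ g) (halfDom E)) (h0 : h 0 = 0) {b : ℝ} (hb : b ∈ openDom E) :
    ∫⁻ x in Ioo 0 b, ENNReal.ofReal (-h x) = ENNReal.ofReal (Real.log (g 0) - Real.log (g b)) := by
  have HR := H.isRiccati hp hr hh h0
  have hsub := Icc_subset_halfDom hb.2
  have hint : IntervalIntegrable h volume 0 b :=
    intervalIntegrable_of_halfDom HR.h_cont (openDom_subset_halfDom E hb)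
  have h1 : ∫ x in 0..b, h x = Real.log (g b) - Real.log (g 0) := by
    refine intervalIntegral.integral_eq_sub_of_hasDerivAt_of_le hb.1.le
      ((H.g_cont.mono hsub).log fun x hx => (H.g_pos x (hsub hx)).ne') (fun x hx => ?_) hint
    have hxE := Ioo_subset_openDom hb.2.le hx
    have hg := (H.g_pos x (openDom_subset_halfDom E hxE)).ne'
    have h2 := (H.hasDerivAt_g hh hxE).log hg
    rwa [mul_div_cancel_right₀ _ hg] at h2
  rw [← ofReal_integral_eq_lintegral_ofReal, ← integral_Ioc_eq_integral_Ioo,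
    ← intervalIntegral.integral_of_le hb.1.le, intervalIntegral.integral_neg, h1, neg_sub]
  · exact (((HR.h_cont.mono hsub).neg).integrableOn_Icc).mono_set Ioo_subset_Icc_self
  · refine (ae_restrict_iff' measurableSet_Ioo).2 (Filter.Eventually.of_forall fun t ht => ?_)
    have := HR.h_nonpos (hsub (Ioo_subset_Icc_self ht))
    simpa using this

end IsFluxPair

namespace IsSolution

variable {c : ℝ} {f : ℝ → ℝ}

lemma hasDerivAt_posPrim (hf : IsSolution u v p D c f) (hp : 1 < p) (huv : IsWeightPair u v p D)
    (hr : IsRegular u v D) {x : ℝ} (hx : x ∈ openDom D) :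
    HasDerivAt (posPrim u p D f) (u x * max (f x) 0 ^ (p - 1)) x := by
  have hd : EqOn (dens D u) u (openDom D) := fun t ht =>
    dens_of_pos ht (hr.u_pos t (openDom_subset_halfDom D ht))
  rw [← hd hx]
  have hc := continuous_posPart_rpow hp hf.cont
  exact hasDerivAt_primitive (k := fun t => dens D u t * max (f t) 0 ^ (p - 1))
    (isOpen_openDom D)
    (((hr.u_cont.mono (openDom_subset_halfDom D)).congr hd).mul hc.continuousOn) hx
    ((intervalIntegrable_of_locallyIntegrable huv.locallyIntegrable_u 0 x).mul_continuousOn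
      hc.continuousOn)

lemma hasDerivAt (hf : IsSolution u v p D c f) (hp : 1 < p) (huv : IsWeightPair u v p D)
    (hr : IsRegular u v D) {x : ℝ} (hx : x ∈ openDom D) :
    HasDerivAt f (-(vhat v p x * posFlux u p D c f x)) x := by
  have hd : EqOn (dens D (vhat v p)) (vhat v p) (openDom D) := fun t ht =>
    dens_of_pos ht (vhat_pos (hr.v_pos t (openDom_subset_halfDom D ht)))
  rw [← hd hx]
  have hc : Continuous (posFlux u p D c f) := continuous_posFlux hp huv hf.cont
  have h1 := (hasDerivAt_primitive (k := fun t => dens D (vhat v p) t * posFlux u p D c f t)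
    (isOpen_openDom D)
    ((hr.contDiffOn_vhat.continuousOn.congr hd).mul hc.continuousOn) hx
    ((intervalIntegrable_of_locallyIntegrable huv.locallyIntegrable_vhat 0 x).mul_continuousOn
      hc.continuousOn)).const_sub 1
  refine h1.congr_of_eventuallyEq ?_
  filter_upwards [Ioi_mem_nhds hx.1] with y hy
  exact hf.eq y (le_of_lt hy)

lemma isFluxPair (hf : IsSolution u v p D c f) (hp : 1 < p) (huv : IsWeightPair u v p D)
    (hr : IsRegular u v D) (hc : 0 < c) (hE : E ≤ D) (hpos : ∀ x ∈ halfDom E, 0 < f x) :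
    IsFluxPair v p E (fun x => c * posPrim u p D f x) f where
  φ_cont := (continuous_const.mul (continuous_posPrim hp huv hf.cont)).continuousOn
  φ_zero := by rw [posPrim_zero, mul_zero]
  φ_pos x hx := mul_pos hc (hf.posPrim_pos hp huv (openDom_mono hE hx))
  φ_diff := contDiffOn_one_of_hasDerivAt (isOpen_openDom E)
    (fun x hx => (hf.hasDerivAt_posPrim hp huv hr (openDom_mono hE hx)).const_mul c)
    (continuousOn_const.mul ((hr.u_cont.mono
      ((openDom_subset_halfDom E).trans (halfDom_mono hE))).mul
      (continuous_posPart_rpow hp hf.cont).continuousOn))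
  g_cont := hf.cont.continuousOn
  g_pos := hpos
  g_deriv x hx := hf.hasDerivAt hp huv hr (openDom_mono hE hx)

lemma opR_eq (hf : IsSolution u v p D c f) (hp : 1 < p) (huv : IsWeightPair u v p D)
    (hr : IsRegular u v D) (hc : 0 < c) (hE : E ≤ D) (hpos : ∀ x ∈ halfDom E, 0 < f x)
    {h : ℝ → ℝ} (hh : EqOn h (logSlope v p (fun x => c * posPrim u p D f x) f) (halfDom E))
    (h0 : h 0 = 0) {x : ℝ} (hx : x ∈ openDom E) : opR u v p h x = c := by
  have hfx := hpos x (openDom_subset_halfDom E hx)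
  have hu := hr.u_pos x (halfDom_mono hE (openDom_subset_halfDom E hx))
  rw [(hf.isFluxPair hp huv hr hc hE hpos).opR_eq hp (hr.mono hE) hh h0 hx,
    ((hf.hasDerivAt_posPrim hp huv hr (openDom_mono hE hx)).const_mul c).deriv,
    max_eq_left hfx.le]
  have := (Real.rpow_pos_of_pos hfx (p - 1)).ne'
  field_simp

end IsSolution

/-- At the junction `h` may blow up from the left; then `deriv` takes its default value 0. If
differentiable, the one-sided derivative decides. -/
lemma deriv_eq_zero_of_Ici {h : ℝ → ℝ} {x : ℝ} (hh : ∀ y, x ≤ y → h y = 0) : deriv h x = 0 := by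
  by_cases hd : DifferentiableAt ℝ h x
  · exact (uniqueDiffWithinAt_Ici x).eq_deriv _ hd.hasDerivAt.hasDerivWithinAt
      ((hasDerivWithinAt_const x (Ici x) (0 : ℝ)).congr (fun y hy => hh y hy) (hh x le_rfl))
  · exact deriv_zero_of_not_differentiableAt hd

/-- The logarithmic derivative of the solution, set to zero from the first zero on, has $R=c$ before
that zero and $R=0$ after it. -/
lemma IsSolution.exists_HHtilde {c : ℝ} {f : ℝ → ℝ} (hf : IsSolution u v p D c f) (hp : 1 < p)
    (huv : IsWeightPair u v p D) (hr : IsRegular u v D) (hc : 0 < c) {x₁ : ℝ}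
    (hx₁ : x₁ ∈ openDom D) (hfx₁ : f x₁ = 0) (hpos : ∀ x, 0 ≤ x → x < x₁ → 0 < f x) :
    ∃ h ∈ HHtilde v p D, ∀ x ∈ openDom D, opR u v p h x ≤ c := by
  have hE : (x₁ : EReal) ≤ D := hx₁.2.le
  have hpos' : ∀ x ∈ halfDom (x₁ : EReal), 0 < f x := fun x hx =>
    hpos x hx.1 (EReal.coe_lt_coe_iff.1 hx.2)
  set ψ := logSlope v p (fun x => c * posPrim u p D f x) f with hψ
  set h : ℝ → ℝ := (Iio x₁).indicator ψ with hh
  have HF := hf.isFluxPair hp huv hr hc hE hpos'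
  have heq : EqOn h ψ (halfDom (x₁ : EReal)) := fun x hx =>
    indicator_of_mem (mem_Iio.2 (EReal.coe_lt_coe_iff.1 hx.2)) _
  have hoff : ∀ x, x₁ ≤ x → h x = 0 := fun x hx => indicator_of_notMem (notMem_Iio.2 hx) _
  have h0 : h 0 = 0 := by
    rw [heq ⟨le_rfl, EReal.coe_lt_coe_iff.2 hx₁.1⟩]
    exact HF.logSlope_zero hp
  have HR := HF.isRiccati hp (hr.mono hE) heq h0
  have hR : ∀ x ∈ Ioo 0 x₁, opR u v p h x = c := fun x hx =>
    hf.opR_eq hp huv hr hc hE hpos' heq h0 (openDom_coe x₁ ▸ hx)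
  refine ⟨h, ⟨x₁, hx₁, ?_, ?_, h0, ?_, fun x _ => hoff x, ?_, ?_⟩, fun x hx => ?_⟩
  · exact openDom_coe x₁ ▸ HR.h_diff
  · exact halfDom_coe x₁ ▸ HR.h_cont
  · exact openDom_coe x₁ ▸ HR.h_neg
  · refine ENNReal.eq_top_of_forall_nnreal_le fun r => ?_
    have hlim : Filter.Tendsto f (nhdsWithin x₁ (Iio x₁)) (nhds 0) := by
      rw [← hfx₁]
      exact hf.cont.continuousAt.continuousWithinAt
    obtain ⟨b, hb1, hb2⟩ := ((hlim.eventually (gt_mem_nhds (Real.exp_pos (-r)))).and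
      (Ioo_mem_nhdsLT hx₁.1)).exists
    have hbE : b ∈ openDom (x₁ : EReal) := openDom_coe x₁ ▸ hb2
    have h1 : (r : ℝ) ≤ -Real.log (f b) := by
      have := (Real.log_le_iff_le_exp (hpos b hb2.1.le hb2.2)).2 hb1.le
      linarith
    refine le_trans ?_ (lintegral_mono_set (Ioo_subset_Ioo_right hb2.2.le))
    rw [HF.lintegral_neg hp (hr.mono hE) heq h0 hbE, hf.apply_zero, Real.log_one, zero_sub,
      ← ENNReal.ofReal_coe_nnreal]
    exact ENNReal.ofReal_le_ofReal h1
  -- The Riccati expression equals $-cu$, so the gap is $c$ times the minimum of `u` on the compact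
  -- interval $[0,x_1]$.
  · obtain ⟨y, hy, hmin⟩ := isCompact_Icc.exists_isMinOn (nonempty_Icc.2 hx₁.1.le)
      (hr.u_cont.mono (Icc_subset_halfDom hx₁.2))
    refine ⟨c * u y, mul_pos hc (hr.u_pos y (Icc_subset_halfDom hx₁.2 hy)), fun x hx => ?_⟩
    have hux := hr.u_pos x (Icc_subset_halfDom hx₁.2 (Ioo_subset_Icc_self hx))
    have h1 := hR x hx
    rw [opR, inv_mul_eq_div, div_eq_iff hux.ne'] at h1
    have h2 : u y ≤ u x := hmin (Ioo_subset_Icc_self hx)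
    have h3 := mul_le_mul_of_nonneg_left h2 hc.le
    linarith
  · rcases lt_or_ge x x₁ with hlt | hge
    · exact (hR x ⟨hx.1, hlt⟩).le
    · have h1 : deriv h x = 0 := deriv_eq_zero_of_Ici fun y hy => hoff y (hge.trans hy)
      simp [opR, riccati, hoff x hge, h1, hc.le]

lemma iInf_HHtilde_le (hp : 1 < p) (huv : IsWeightPair u v p D) (hr : IsRegular u v D) :
    ⨅ h ∈ HHtilde v p D, ⨆ x ∈ openDom D, (opR u v p h x : EReal)
      ≤ (lambdaP u v p D : EReal) := by
  refine le_of_forall_gt_imp_ge_of_dense fun d hd => ?_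
  obtain ⟨c, hc1, hc2⟩ := EReal.lt_iff_exists_real_btwn.1 hd
  have hc0 : 0 < c := EReal.coe_pos.1 ((EReal.coe_ennreal_nonneg _).trans_lt hc1)
  have hlt : lambdaP u v p D < ENNReal.ofReal c := by
    rw [← EReal.coe_ennreal_lt_coe_ennreal_iff, EReal.coe_ennreal_ofReal, max_eq_left hc0.le]
    exact hc1
  obtain ⟨f, hf, x₁, hx₁, hfx₁, hpos⟩ := exists_solution_with_zero hp huv hlt
  obtain ⟨h, hh, hle⟩ := hf.exists_HHtilde hp huv hr hc0 hx₁ hfx₁ hpos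
  exact (iInf₂_le h hh).trans ((iSup₂_le fun x hx => EReal.coe_le_coe_iff.2 (hle x hx)).trans
    hc2.le)

lemma IsRiccati.mem_HH {h : ℝ → ℝ} (H : IsRiccati u v p D h) : h ∈ HH v p D :=
  ⟨H.h_diff, H.h_cont, H.h_zero, fun _ => H.h_neg, fun _ x hx => (H.h_neg x hx).le⟩

lemma primitive_le_nuHatTotal (huv : IsWeightPair u v p D) (hr : IsRegular u v D)
    (hn : nuHatTotal v p D < ∞) {x : ℝ} (hx : x ∈ halfDom D) :
    ∫ t in 0..x, dens D (vhat v p) t ≤ (nuHatTotal v p D).toReal := by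
  have hk := huv.locallyIntegrable_vhat
  rw [intervalIntegral.integral_of_le hx.1, integral_Ioc_eq_integral_Ioo,
    integral_eq_lintegral_of_nonneg_ae (Filter.Eventually.of_forall (dens_nonneg D _))
      hk.aestronglyMeasurable.restrict]
  refine ENNReal.toReal_mono hn.ne ?_
  have hsub : Ioo 0 x ⊆ openDom D := Ioo_subset_openDom hx.2.le
  calc ∫⁻ t in Ioo 0 x, ENNReal.ofReal (dens D (vhat v p) t)
      = ∫⁻ t in Ioo 0 x, ENNReal.ofReal (vhat v p t) :=
        setLIntegral_congr_fun measurableSet_Ioo fun t ht => by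
          rw [dens_of_pos (hsub ht) (vhat_pos (hr.v_pos t (openDom_subset_halfDom D (hsub ht))))]
    _ ≤ nuHatTotal v p D := lintegral_mono_set hsub

/-- Serves $\lambda_p=0$ with finite total $\hat\nu$, where the class demands $h<0$. An increasing
flux gives $R(h)\ge0$; as it stays below one, `g` loses at most $\hat\nu(0,D)$ and the initial value
$1+\hat\nu(0,D)$ keeps it positive. -/
lemma exists_isFluxPair_of_nuHatTotal_lt_top (hp : 1 < p) (huv : IsWeightPair u v p D)
    (hr : IsRegular u v D) (hn : nuHatTotal v p D < ∞) :
    ∃ g, IsFluxPair v p D (fun x => 1 - Real.exp (-x)) g := by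
  have hk := huv.locallyIntegrable_vhat
  have hq : 0 ≤ (p - 1)⁻¹ := inv_nonneg.2 (by linarith)
  have hφ : Continuous fun x : ℝ => 1 - Real.exp (-x) := by fun_prop
  have hφq : Continuous fun x : ℝ => (1 - Real.exp (-x)) ^ (p - 1)⁻¹ :=
    hφ.rpow_const fun _ => Or.inr hq
  have hd : EqOn (dens D (vhat v p)) (vhat v p) (openDom D) := fun t ht =>
    dens_of_pos ht (vhat_pos (hr.v_pos t (openDom_subset_halfDom D ht)))
  have hint : ∀ x, IntervalIntegrable
      (fun t => dens D (vhat v p) t * (1 - Real.exp (-t)) ^ (p - 1)⁻¹) volume 0 x := fun x =>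
    (intervalIntegrable_of_locallyIntegrable hk 0 x).mul_continuousOn hφq.continuousOn
  refine ⟨fun x => 1 + (nuHatTotal v p D).toReal
    - ∫ t in 0..x, dens D (vhat v p) t * (1 - Real.exp (-t)) ^ (p - 1)⁻¹,
    hφ.continuousOn, by simp, fun x hx => ?_, ?_, ?_, fun x hx => ?_, fun x hx => ?_⟩
  · have := Real.exp_lt_one_iff.2 (neg_lt_zero.2 hx.1)
    linarith
  · exact ContDiff.contDiffOn (by fun_prop)
  · exact (continuous_const.sub (continuous_primitive_dens
      (hk.mul_continuous hφq))).continuousOn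
  · have h1 := primitive_le_nuHatTotal huv hr hn hx
    have h2 : ∫ t in 0..x, dens D (vhat v p) t * (1 - Real.exp (-t)) ^ (p - 1)⁻¹
        ≤ ∫ t in 0..x, dens D (vhat v p) t := by
      refine intervalIntegral.integral_mono_on hx.1 (hint x)
        (intervalIntegrable_of_locallyIntegrable hk 0 x) fun t ht => ?_
      refine mul_le_of_le_one_right (dens_nonneg D _ t) (Real.rpow_le_one ?_ ?_ hq)
      · have := Real.exp_le_one_iff.2 (neg_nonpos.2 ht.1)
        linarith
      · linarith [Real.exp_pos (-t)]
    linarith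
  · rw [← hd hx]
    exact (hasDerivAt_primitive (isOpen_openDom D)
      ((hr.contDiffOn_vhat.continuousOn.congr hd).mul hφq.continuousOn) hx (hint x)).const_sub _

/-- Supplies a positive eigenfunction at the finite value $\lambda_p>0$; the remaining case needs
only a nonnegative lower bound. -/
lemma eq_zero_or_exists_isSolution (hp : 1 < p) (hD : 0 < D) (huv : IsWeightPair u v p D) :
    lambdaP u v p D = 0 ∨ ∃ c f, 0 < c ∧ IsSolution u v p D c f ∧ (∀ x ∈ openDom D, 0 < f x) ∧
      ENNReal.ofReal c = lambdaP u v p D := by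
  refine or_iff_not_imp_left.2 fun hl => ?_
  have htop := lambdaP_ne_top hp hD huv
  have hc : 0 < (lambdaP u v p D).toReal := ENNReal.toReal_pos hl htop
  have hcl := ENNReal.ofReal_toReal htop
  obtain ⟨f, hf⟩ := exists_isSolution hp huv hc.le
  exact ⟨_, f, hc, hf, hf.pos_of_eq_lambdaP hp huv hc hcl, hcl⟩

lemma exists_le_iInf_opR (hp : 1 < p) (hD : 0 < D) (huv : IsWeightPair u v p D)
    (hr : IsRegular u v D) :
    ∃ h ∈ HH v p D, (lambdaP u v p D : EReal) ≤ ⨅ x ∈ openDom D, (opR u v p h x : EReal) := by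
  rcases eq_zero_or_exists_isSolution hp hD huv with hl | ⟨c, f, hc, hf, hpos, hcl⟩
  · rw [hl, EReal.coe_ennreal_zero]
    -- For infinite total $\hat\nu$ the class admits $h=0$, for which $R(h)=0$; otherwise a strictly
    -- negative member is required.
    by_cases hn : nuHatTotal v p D = ∞
    · refine ⟨0, ⟨contDiffOn_const, continuousOn_const, rfl, fun h => absurd hn h.ne,
        fun _ x _ => le_rfl⟩, le_iInf₂ fun x _ => ?_⟩
      simp [opR, riccati, deriv_eq_zero_of_Ici (h := 0) (x := x) fun _ _ => rfl]
    · obtain ⟨g, hg⟩ := exists_isFluxPair_of_nuHatTotal_lt_top hp huv hr (lt_top_iff_ne_top.2 hn)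
      have h0 := hg.logSlope_zero hp
      refine ⟨_, (hg.isRiccati hp hr (eqOn_refl _ _) h0).mem_HH, le_iInf₂ fun x hx => ?_⟩
      have hx' := openDom_subset_halfDom D hx
      have hd : HasDerivAt (fun x : ℝ => 1 - Real.exp (-x)) (Real.exp (-x)) x := by
        simpa using ((hasDerivAt_neg x).exp).const_sub 1
      rw [hg.opR_eq hp hr (eqOn_refl _ _) h0 hx, hd.deriv, EReal.coe_nonneg]
      exact mul_nonneg (inv_nonneg.2 (hr.u_pos x hx').le)
        (div_nonneg (Real.exp_pos _).le (Real.rpow_nonneg (hg.g_pos x hx').le _))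
  · have hpos' : ∀ x ∈ halfDom D, 0 < f x := fun x hx => by
      rcases hx.1.eq_or_lt with rfl | h0
      · rw [hf.apply_zero]
        exact one_pos
      · exact hpos x ⟨h0, hx.2⟩
    have HF := hf.isFluxPair hp huv hr hc le_rfl hpos'
    have h0 := HF.logSlope_zero hp
    refine ⟨_, (HF.isRiccati hp hr (eqOn_refl _ _) h0).mem_HH, le_iInf₂ fun x hx => ?_⟩
    rw [hf.opR_eq hp huv hr hc le_rfl hpos' (eqOn_refl _ _) h0 hx,
      ← hcl, EReal.coe_ennreal_ofReal, max_eq_left hc.le]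

end

end PLaplacianND

end

/-! ### Assembly of the three pairs of variational formulas. -/

theorem theorem2p1 (u v : ℝ → ℝ) (p : ℝ) (hp : 1 < p) (D : EReal) (hD : 0 < D)
    (huv : PLaplacianND.IsWeightPair u v p D) :
    -- single integral forms
    ((⨅ q ∈ PLaplacianND.FItilde v p D, ⨆ x ∈ PLaplacianND.openDom D,
          (PLaplacianND.opI u p q.1 q.2 x)⁻¹) = PLaplacianND.lambdaP u v p D ∧
      PLaplacianND.lambdaP u v p D =
        (⨆ q ∈ PLaplacianND.FI v p D, ⨅ x ∈ PLaplacianND.openDom D,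
          (PLaplacianND.opI u p q.1 q.2 x)⁻¹) ∧
      ∃ q ∈ PLaplacianND.FI v p D,
        (⨅ x ∈ PLaplacianND.openDom D, (PLaplacianND.opI u p q.1 q.2 x)⁻¹) =
          PLaplacianND.lambdaP u v p D) ∧
    -- double integral forms
    ((⨅ f ∈ PLaplacianND.FIItilde D,
          ⨆ x ∈ PLaplacianND.closedDom D ∩ Function.support f,
            (PLaplacianND.opII u v p D f x)⁻¹) = PLaplacianND.lambdaP u v p D ∧
      PLaplacianND.lambdaP u v p D =
        (⨆ f ∈ PLaplacianND.FII D, ⨅ x ∈ PLaplacianND.openDom D,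
          (PLaplacianND.opII u v p D f x)⁻¹) ∧
      ∃ f ∈ PLaplacianND.FII D,
        (⨅ x ∈ PLaplacianND.openDom D, (PLaplacianND.opII u v p D f x)⁻¹) =
          PLaplacianND.lambdaP u v p D) ∧
    -- differential forms
    ((∀ x ∈ PLaplacianND.halfDom D, 0 < u x ∧ 0 < v x) →
      ContinuousOn u (PLaplacianND.halfDom D) →
      ContDiffOn ℝ 1 v (PLaplacianND.halfDom D) →
      (⨅ h ∈ PLaplacianND.HHtilde v p D, ⨆ x ∈ PLaplacianND.openDom D,
          (PLaplacianND.opR u v p h x : EReal)) = (PLaplacianND.lambdaP u v p D : EReal) ∧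
      (PLaplacianND.lambdaP u v p D : EReal) =
        (⨆ h ∈ PLaplacianND.HH v p D, ⨅ x ∈ PLaplacianND.openDom D,
          (PLaplacianND.opR u v p h x : EReal)) ∧
      ∃ h ∈ PLaplacianND.HH v p D,
        (⨅ x ∈ PLaplacianND.openDom D, (PLaplacianND.opR u v p h x : EReal)) =
          (PLaplacianND.lambdaP u v p D : EReal)) := by
  have hlow : PLaplacianND.lambdaP u v p D = 0 ∨ ∃ c f, 0 < c ∧
      PLaplacianND.IsSolution u v p D c f ∧ (∀ x ∈ PLaplacianND.openDom D, 0 < f x) ∧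
      ENNReal.ofReal c = PLaplacianND.lambdaP u v p D :=
    PLaplacianND.eq_zero_or_exists_isSolution hp hD huv
  have h1 : ∃ q ∈ PLaplacianND.FI v p D,
      (⨅ x ∈ PLaplacianND.openDom D, (PLaplacianND.opI u p q.1 q.2 x)⁻¹) =
        PLaplacianND.lambdaP u v p D := by
    rcases hlow with h0 | ⟨c, f, hc, hf, hpos, hcl⟩
    -- When $\lambda_p=0$ every member attains the supremum: its infimum lies between zero and
    -- $\lambda_p$.
    · obtain ⟨q, hq⟩ := PLaplacianND.FI_nonempty hp huv
      exact ⟨q, hq, le_antisymm (PLaplacianND.iInf_opI_le hp huv hq) (h0 ▸ zero_le)⟩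
    · have hq := hf.mem_FI hp huv hc hpos
      exact ⟨_, hq, le_antisymm (PLaplacianND.iInf_opI_le hp huv hq)
        (hcl ▸ hf.le_iInf_opI hp huv hc hpos)⟩
  have h2 : ∃ f ∈ PLaplacianND.FII D,
      (⨅ x ∈ PLaplacianND.openDom D, (PLaplacianND.opII u v p D f x)⁻¹) =
        PLaplacianND.lambdaP u v p D := by
    rcases hlow with h0 | ⟨c, f, hc, hf, hpos, hcl⟩
    · have hq : (fun _ => 1) ∈ PLaplacianND.FII D :=
        ⟨continuousOn_const, fun _ _ => one_pos⟩
      exact ⟨_, hq, le_antisymm (PLaplacianND.iInf_opII_le hp huv hq) (h0 ▸ zero_le)⟩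
    · have hq : f ∈ PLaplacianND.FII D := ⟨hf.cont.continuousOn, hpos⟩
      exact ⟨f, hq, le_antisymm (PLaplacianND.iInf_opII_le hp huv hq)
        (hcl ▸ hf.le_iInf_opII hp huv hc hpos)⟩
  refine ⟨⟨?_, ?_, h1⟩, ⟨?_, ?_, h2⟩, fun hpos hu hv => ?_⟩
  · exact le_antisymm (PLaplacianND.iInf_FItilde_le hp huv)
      (le_iInf₂ fun q hq => PLaplacianND.lambdaP_le_iSup_opI hp huv hq)
  · obtain ⟨q, hq, he⟩ := h1
    exact le_antisymm (he ▸ le_iSup₂ (f := fun q (_ : q ∈ PLaplacianND.FI v p D) =>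
      ⨅ x ∈ PLaplacianND.openDom D, (PLaplacianND.opI u p q.1 q.2 x)⁻¹) q hq)
      (iSup₂_le fun q hq => PLaplacianND.iInf_opI_le hp huv hq)
  · exact le_antisymm (PLaplacianND.iInf_FIItilde_le hp huv)
      (le_iInf₂ fun f hf => PLaplacianND.lambdaP_le_iSup_opII hp huv hf)
  · obtain ⟨f, hf, he⟩ := h2
    exact le_antisymm (he ▸ le_iSup₂ (f := fun f (_ : f ∈ PLaplacianND.FII D) =>
      ⨅ x ∈ PLaplacianND.openDom D, (PLaplacianND.opII u v p D f x)⁻¹) f hf)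
      (iSup₂_le fun f hf => PLaplacianND.iInf_opII_le hp huv hf)
  · have hr : PLaplacianND.IsRegular u v D :=
      ⟨fun x hx => (hpos x hx).1, fun x hx => (hpos x hx).2, hu, hv⟩
    obtain ⟨h, hh, hle⟩ := PLaplacianND.exists_le_iInf_opR hp hD huv hr
    refine ⟨le_antisymm (PLaplacianND.iInf_HHtilde_le hp huv hr)
      (le_iInf₂ fun h hh => PLaplacianND.lambdaP_le_iSup_opR hp huv hr hh),
      le_antisymm ?_ (iSup₂_le fun h hh => PLaplacianND.iInf_opR_le hp huv hr hh),
      h, hh, le_antisymm (PLaplacianND.iInf_opR_le hp huv hr hh) hle⟩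
    exact hle.trans (le_iSup₂ (f := fun h (_ : h ∈ PLaplacianND.HH v p D) =>
      ⨅ x ∈ PLaplacianND.openDom D, (PLaplacianND.opR u v p h x : EReal)) h hh)
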